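/- Let $p>3$ be a prime and let $\bar k$ be an algebraically closed field of characteristic different from $2$, $3$ and $p$. Fix a generator $\gamma$ of $\mathbb{F}_{p^2}^{\times}$. For an elliptic curve $E/\bar k$, let $\mathbb{P}(E[p])$ be the set of the $p+1$ cyclic subgroups of order $p$ of $E$. An \emph{oriented necklace} of $E$ is a list $\mathfrak v=(C_0,C_1,\dots,C_p)$ of all the elements of $\mathbb{P}(E[p])$ without repetition, taken up to cyclic permutation, for which there is an $h\in \mathrm{PGL}(E[p])$ with $h(C_i)=C_{i+1}$ for $0\le i\le p-1$ such that $h$ has a representative in $\mathrm{GL}(E[p])$ whose characteristic polynomial is the minimal polynomial of $\gamma$ over $\mathbb{F}_p$. Let $w(C_0,\dots,C_p)=(C_p,\dots,C_0)$ be the involution that reverses the orientation. The points of the modular curve $X_{\mathrm{nsp}}$ over $\bar k$ other than cusps are the $\bar k$-isomorphism classes of pairs $(E,\mathfrak v)$ of an elliptic curve $E/\bar k$ and an oriented necklace $\mathfrak v$ of $E$. For $r=2$ and $r=3$, let $e_r$ be the number of elliptic points of $X_{\mathrm{nsp}}$ with $g$ of order $r$, that is, of points represented by a pair $(E,\mathfrak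 v)$ such that some automorphism of $E$ induces an element $g\in\mathrm{PGL}(E[p])$ of order $r$ with $g(\mathfrak v)=\mathfrak v$. Then these numbers are finite, and $$e_2 = 1-\left(\frac{-1}{p}\right)=\begin{cases}0&\text{if }p\equiv 1 \pmod 4,\\ 2&\text{if }p\equiv 3\pmod 4,\end{cases}\qquad e_3 = 1-\left(\frac{-3}{p}\right)=\begin{cases}0&\text{if }p\equiv 1 \pmod 3,\\ 2&\text{if }p\equiv 2\pmod 3.\end{cases}$$ If $e_r=2$, the two corresponding oriented necklaces are in the same $w$-orbit: there are an elliptic curve $E$ and an oriented necklace $\mathfrak v$ of $E$ such that the two points are the classes of $(E,\mathfrak v)$ and $(E,w(\mathfrak v))$. The same numbers $e_2=1-\left(\frac{-1}{p}\right)$ and $e_3=1-\left(\frac{-3}{p}\right)$ are obtained when $X_{\mathrm{nsp}}$ is described as the quotient $X_{\mathcal H}$ of $X(p)$ by any non-split Cartan subgroup $\mathcal H$ of $\mathrm{GL}_2(\mathbb{F}_p)$ (the stabiliser of $(1:\alpha)\in\mathbb{P}^1(\mathbb{F}_{p^2})$, for $\alpha\in\mathbb{F}_{p^2}\setminus\mathbb{F}_p$,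 under the right action on row vectors). Here the points other than cusps are the isomorphism classes of pairs $(E,b\mathcal H)$ of an elliptic curve $E/\bar k$ and an orbit of bases $b=(P,Q)$ of $E[p]$ under $(P,Q)\left(\begin{smallmatrix}a&b\\c&d\end{smallmatrix}\right)=(aP+cQ,\,bP+dQ)$, and the elliptic points with $g$ of order $r$ are those represented by a pair $(E,b\mathcal H)$ such that some automorphism of $E$ induces an element $g\in\mathrm{PGL}(E[p])$ of order $r$ and maps $b\mathcal H$ to itself. -/

import Mathlib

/-! ### Projective general linear groups and oriented necklaces -/

section Projective

variable (K V : Type*) [Field K] [AddCommGroup V] [Module K V]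

/-- The subgroup of nonzero scalars in `GL(V)`. -/
def scalarSubgroup : Subgroup (LinearMap.GeneralLinearGroup K V) :=
  (Units.map (algebraMap K (Module.End K V)).toMonoidHom).range

instance scalarSubgroup_normal : (scalarSubgroup K V).Normal := by
  constructor
  rintro _ ⟨c, rfl⟩ g
  refine ⟨c, ?_⟩
  have h : g * Units.map (algebraMap K (Module.End K V)).toMonoidHom c =
      Units.map (algebraMap K (Module.End K V)).toMonoidHom c * g := by
    ext x
    simp [Algebra.algebraMap_eq_smul_one]
  rw [h, mul_inv_cancel_right]

/-- `PGL(V) = GL(V) / scalars`. -/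
abbrev PGL : Type _ := LinearMap.GeneralLinearGroup K V ⧸ scalarSubgroup K V

/-- The action of `PGL(V)` on the set `ℙ(V)` of lines of `V`. -/
def PGL.toPerm : PGL K V →* Equiv.Perm (Projectivization K V) :=
  QuotientGroup.lift (scalarSubgroup K V)
    (MulAction.toPermHom (LinearMap.GeneralLinearGroup K V) (Projectivization K V)) (by
      rintro _ ⟨c, rfl⟩
      ext P
      induction P using Projectivization.ind with
      | h v hv =>
        simp only [MulAction.toPermHom_apply, MulAction.toPerm_apply, Equiv.Perm.coe_one, id_eq,
          Projectivization.smul_mk, Projectivization.mk_eq_mk_iff]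
        refine ⟨c, ?_⟩
        simp [Algebra.algebraMap_eq_smul_one, Units.smul_def])

variable {K V}

/-- For a two-dimensional space `V`, the set of the `h` in `PGL(V)` that have a representative in
`GL(V)` with characteristic polynomial `f` (computed on the matrix in a basis). -/
def charpolyClass (V : Type*) [AddCommGroup V] [Module K V] (f : Polynomial K) : Set (PGL K V) :=
  {h | ∃ (g : LinearMap.GeneralLinearGroup K V) (b : Module.Basis (Fin 2) K V),
    (g : PGL K V) = h ∧ (LinearMap.toMatrix b b (g : Module.End K V)).charpoly = f}

/-- If `h` has a representative with characteristic polynomial `f`, so has `h⁻¹`: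
if `g` represents `h`, then `det(g) g⁻¹` has the same trace and determinant as `g`. -/
theorem charpolyClass_inv {f : Polynomial K} {h : PGL K V} (hh : h ∈ charpolyClass V f) :
    h⁻¹ ∈ charpolyClass V f := by
  classical
  obtain ⟨g, b, rfl, rfl⟩ := hh
  set M := LinearMap.toMatrix b b (g : Module.End K V) with hM
  set N := LinearMap.toMatrix b b ((g⁻¹ : LinearMap.GeneralLinearGroup K V) : Module.End K V)
    with hN
  have hMN : M * N = 1 := by
    rw [hM, hN, ← LinearMap.toMatrix_mul, Units.mul_inv, LinearMap.toMatrix_one]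
  have hdet : M.det * N.det = 1 := by rw [← Matrix.det_mul, hMN, Matrix.det_one]
  have hd : IsUnit M.det := IsUnit.of_mul_eq_one _ hdet
  have hadj : M.det • N = M.adjugate := by
    have h1 : M.adjugate * (M * N) = M.adjugate := by rw [hMN, mul_one]
    rwa [← mul_assoc, Matrix.adjugate_mul, Matrix.smul_mul, one_mul] at h1
  refine ⟨Units.map (algebraMap K (Module.End K V)).toMonoidHom hd.unit * g⁻¹, b, ?_, ?_⟩
  · have h1 : ((Units.map (algebraMap K (Module.End K V)).toMonoidHom hd.unit :
        LinearMap.GeneralLinearGroup K V) : PGL K V) = 1 :=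
      (QuotientGroup.eq_one_iff _).2 ⟨_, rfl⟩
    rw [QuotientGroup.mk_mul, h1, one_mul, QuotientGroup.mk_inv]
  · have h2 : LinearMap.toMatrix b b
        ((Units.map (algebraMap K (Module.End K V)).toMonoidHom hd.unit * g⁻¹ :
          LinearMap.GeneralLinearGroup K V) : Module.End K V) = M.adjugate := by
      rw [← hadj, hN, ← LinearEquiv.map_smul]
      congr 1
    rw [h2, Matrix.charpoly_fin_two, Matrix.charpoly_fin_two, Matrix.adjugate_fin_two]
    have h3 : (!![M 1 1, -M 0 1; -M 1 0, M 0 0] : Matrix (Fin 2) (Fin 2) K).trace = M.trace := by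
      simp [Matrix.trace_fin_two, add_comm]
    have h4 : (!![M 1 1, -M 0 1; -M 1 0, M 0 0] : Matrix (Fin 2) (Fin 2) K).det = M.det := by
      simp [Matrix.det_fin_two, mul_comm]
    rw [h3, h4]

/-- A cyclic arrangement `c` (a list up to cyclic permutation) of points of `ℙ(V)` is an oriented
necklace if it is the class of a list `C₀, C₁, …` of all the points of `ℙ(V)`, without repetition,
for which there is an `h` in the class belonging to `f` such that `h(Cᵢ) = Cᵢ₊₁` for any two
consecutive entries. -/
def IsOrientedNecklace (f : Polynomial K) (c : Cycle (Projectivization K V)) : Prop :=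
  ∃ l : List (Projectivization K V), (l : Cycle (Projectivization K V)) = c ∧
    l.Nodup ∧ (∀ P, P ∈ l) ∧
    ∃ h ∈ charpolyClass V f, l.IsChain (fun P Q => PGL.toPerm K V h P = Q)

theorem IsOrientedNecklace.reverse {f : Polynomial K} {c : Cycle (Projectivization K V)}
    (hc : IsOrientedNecklace f c) : IsOrientedNecklace f c.reverse := by
  obtain ⟨l, rfl, hl, hall, h, hh, hch⟩ := hc
  refine ⟨l.reverse, by simp, by simpa using hl, by simpa using hall, h⁻¹, charpolyClass_inv hh, ?_⟩
  rw [List.isChain_reverse]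
  refine hch.imp ?_
  rintro P Q rfl
  simp

variable (V) in
/-- The set of oriented necklaces in `ℙ(V)`. -/
def OrientedNecklace (f : Polynomial K) : Type _ :=
  {c : Cycle (Projectivization K V) // IsOrientedNecklace f c}

/-- The involution `w`, which reverses the orientation:
`w(C₀, C₁, …, C_p) = (C_p, …, C₁, C₀)`. -/
def OrientedNecklace.w {f : Polynomial K} (v : OrientedNecklace V f) : OrientedNecklace V f :=
  ⟨v.1.reverse, v.2.reverse⟩

end Projective

/-! ### Elliptic curves, their isomorphisms and their `p`-torsion -/

section Elliptic

open WeierstrassCurve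

/-- An elliptic curve over `k`, given by a Weierstrass equation with nonzero discriminant. -/
structure EllCurve (k : Type*) [Field k] where
  W : WeierstrassCurve k
  isElliptic : W.IsElliptic

attribute [instance] EllCurve.isElliptic

variable {k : Type*} [Field k]

/-- The group of `k`-rational points. -/
abbrev EllCurve.Point (E : EllCurve k) : Type _ := E.W.toAffine.Point

/-- An isomorphism `E → E'` of elliptic curves over `k`: an admissible change of variables
`(u, r, s, t)` such that `(x, y) ↦ (u²x + r, u³y + u²sx + t)` transforms the equation of `E'` into
that of `E`, so that this formula maps `E` to `E'`. -/
@[ext]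
structure EllIso (E E' : EllCurve k) where
  C : VariableChange k
  smul_eq : C • E'.W = E.W

namespace EllIso

/-- The abscissa of the image of `(x, y)`. -/
def mapX (C : VariableChange k) (x : k) : k := (C.u : k) ^ 2 * x + C.r

/-- The ordinate of the image of `(x, y)`. -/
def mapY (C : VariableChange k) (x y : k) : k :=
  (C.u : k) ^ 3 * y + (C.u : k) ^ 2 * C.s * x + C.t

theorem equation_map (C : VariableChange k) (W : WeierstrassCurve k) {x y : k}
    (h : (C • W).toAffine.Equation x y) : W.toAffine.Equation (mapX C x) (mapY C x y) := by
  have hu : (C.u : k) ≠ 0 := C.u.ne_zero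
  rw [Affine.equation_iff] at h ⊢
  simp only [variableChange_def, Units.val_inv_eq_inv_val] at h
  field_simp at h
  simp only [mapX, mapY]
  linear_combination h

theorem mapX_inj (C : VariableChange k) {x x' : k} : mapX C x = mapX C x' ↔ x = x' := by
  have hu : (C.u : k) ≠ 0 := C.u.ne_zero
  simp [mapX, hu]

theorem mapY_inj (C : VariableChange k) {x y y' : k} : mapY C x y = mapY C x y' ↔ y = y' := by
  have hu : (C.u : k) ≠ 0 := C.u.ne_zero
  simp [mapY, hu]

theorem negY_map (C : VariableChange k) (W : WeierstrassCurve k) (x y : k) :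
    W.toAffine.negY (mapX C x) (mapY C x y) = mapY C x ((C • W).toAffine.negY x y) := by
  have hu : (C.u : k) ≠ 0 := C.u.ne_zero
  simp only [Affine.negY, mapX, mapY, variableChange_def, Units.val_inv_eq_inv_val]
  field_simp
  ring

theorem addX_map (C : VariableChange k) (W : WeierstrassCurve k) (x x' l : k) :
    W.toAffine.addX (mapX C x) (mapX C x') (C.u * l + C.s) =
      mapX C ((C • W).toAffine.addX x x' l) := by
  have hu : (C.u : k) ≠ 0 := C.u.ne_zero
  simp only [Affine.addX, mapX, variableChange_def, Units.val_inv_eq_inv_val]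
  field_simp
  ring

theorem addY_map (C : VariableChange k) (W : WeierstrassCurve k) (x x' y l : k) :
    W.toAffine.addY (mapX C x) (mapX C x') (mapY C x y) (C.u * l + C.s) =
      mapY C ((C • W).toAffine.addX x x' l) ((C • W).toAffine.addY x x' y l) := by
  have h : W.toAffine.negAddY (mapX C x) (mapX C x') (mapY C x y) (C.u * l + C.s) =
      mapY C ((C • W).toAffine.addX x x' l) ((C • W).toAffine.negAddY x x' y l) := by
    rw [Affine.negAddY, addX_map, Affine.negAddY]
    simp only [mapX, mapY]
    ring
  rw [Affine.addY, addX_map, h, negY_map, Affine.addY]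

theorem slope_map [DecidableEq k] (C : VariableChange k) (W : WeierstrassCurve k) {x x' y y' : k}
    (h₁ : (C • W).toAffine.Equation x y) (h₂ : (C • W).toAffine.Equation x' y')
    (hxy : ¬(x = x' ∧ y = (C • W).toAffine.negY x' y')) :
    W.toAffine.slope (mapX C x) (mapX C x') (mapY C x y) (mapY C x' y') =
      C.u * (C • W).toAffine.slope x x' y y' + C.s := by
  have hu : (C.u : k) ≠ 0 := C.u.ne_zero
  by_cases hx : x = x'
  · subst hx
    have hy : y ≠ (C • W).toAffine.negY x y' := fun h => hxy ⟨rfl, h⟩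
    have hy2 : mapY C x y ≠ W.toAffine.negY (mapX C x) (mapY C x y') := by
      rw [negY_map, Ne, mapY_inj]
      exact hy
    have hyy : y = y' := Affine.Y_eq_of_Y_ne h₁ h₂ rfl hy
    subst hyy
    rw [Affine.slope_of_Y_ne rfl hy, Affine.slope_of_Y_ne rfl hy2]
    have h0 : y - (C • W).toAffine.negY x y ≠ 0 := sub_ne_zero.2 hy
    have h3 : mapY C x y - W.toAffine.negY (mapX C x) (mapY C x y) =
        (C.u : k) ^ 3 * (y - (C • W).toAffine.negY x y) := by
      rw [negY_map]
      simp only [mapY]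
      ring
    have h4 : 3 * mapX C x ^ 2 + 2 * W.a₂ * mapX C x + W.a₄ - W.a₁ * mapY C x y =
        (C.u : k) ^ 4 * (3 * x ^ 2 + 2 * (C • W).a₂ * x + (C • W).a₄ - (C • W).a₁ * y) +
          C.s * ((C.u : k) ^ 3 * (y - (C • W).toAffine.negY x y)) := by
      simp only [Affine.negY, mapX, mapY, variableChange_def, Units.val_inv_eq_inv_val]
      field_simp
      ring
    rw [h3, h4]
    field_simp
  · rw [Affine.slope_of_X_ne hx, Affine.slope_of_X_ne (fun h => hx ((mapX_inj C).1 h))]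
    have h1 : x - x' ≠ 0 := sub_ne_zero.2 hx
    have h2 : mapX C x - mapX C x' = (C.u : k) ^ 2 * (x - x') := by simp only [mapX]; ring
    rw [h2]
    simp only [mapY]
    field_simp
    ring

variable {E E' E'' : EllCurve k}

/-- The map on points `(x, y) ↦ (u²x + r, u³y + u²sx + t)`. -/
def pointFun (φ : EllIso E E') : E.Point → E'.Point
  | .zero => .zero
  | .some x y h => .some (mapX φ.C x) (mapY φ.C x y) <|
      Affine.equation_iff_nonsingular.1 <| equation_map φ.C E'.W <| by
        rw [φ.smul_eq]; exact h.1

/-- The identity. -/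
def refl (E : EllCurve k) : EllIso E E := ⟨1, one_smul _ _⟩

/-- The inverse isomorphism. -/
def symm (φ : EllIso E E') : EllIso E' E := ⟨φ.C⁻¹, by rw [← φ.smul_eq, inv_smul_smul]⟩

/-- The composite isomorphism. -/
def trans (φ : EllIso E E') (ψ : EllIso E' E'') : EllIso E E'' :=
  ⟨φ.C * ψ.C, by rw [mul_smul, ψ.smul_eq, φ.smul_eq]⟩

theorem pointFun_refl (P : E.Point) : (refl E).pointFun P = P := by
  rcases P with _ | ⟨x, y, h⟩
  · rfl
  · simp [pointFun, refl, mapX, mapY, VariableChange.one_def]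

theorem pointFun_trans (φ : EllIso E E') (ψ : EllIso E' E'') (P : E.Point) :
    (φ.trans ψ).pointFun P = ψ.pointFun (φ.pointFun P) := by
  rcases P with _ | ⟨x, y, h⟩
  · rfl
  · simp only [pointFun, trans, mapX, mapY, VariableChange.mul_def, Affine.Point.some.injEq,
      Units.val_mul]
    constructor <;> ring

theorem trans_symm (φ : EllIso E E') : φ.trans φ.symm = refl E :=
  EllIso.ext (mul_inv_cancel φ.C)

theorem symm_trans (φ : EllIso E E') : φ.symm.trans φ = refl E' :=
  EllIso.ext (inv_mul_cancel φ.C)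

variable [DecidableEq k]

theorem pointFun_add (φ : EllIso E E') (P Q : E.Point) :
    φ.pointFun (P + Q) = φ.pointFun P + φ.pointFun Q := by
  obtain ⟨W, hW⟩ := E
  obtain ⟨C, hC⟩ := φ
  dsimp only at hC
  subst hC
  rcases P with _ | ⟨x, y, h⟩
  · exact (congrArg _ (zero_add Q)).trans (zero_add _).symm
  rcases Q with _ | ⟨x', y', h'⟩
  · exact (congrArg _ (add_zero _)).trans (add_zero _).symm
  by_cases hxy : x = x' ∧ y = (C • E'.W).toAffine.negY x' y'
  · rw [Affine.Point.add_of_Y_eq hxy.1 hxy.2]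
    simp only [pointFun]
    rw [Affine.Point.add_of_Y_eq (by rw [hxy.1])
      (by rw [negY_map, hxy.1, mapY_inj]; exact hxy.2)]
    rfl
  · have hxy2 : ¬(mapX C x = mapX C x' ∧
        mapY C x y = E'.W.toAffine.negY (mapX C x') (mapY C x' y')) := by
      rintro ⟨h1, h2⟩
      rw [mapX_inj] at h1
      subst h1
      rw [negY_map, mapY_inj] at h2
      exact hxy ⟨rfl, h2⟩
    rw [Affine.Point.add_some hxy]
    simp only [pointFun]
    rw [Affine.Point.add_some hxy2]
    simp only [Affine.Point.some.injEq]
    rw [slope_map C E'.W h.1 h'.1 hxy, addX_map, addY_map]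
    exact ⟨rfl, rfl⟩

/-- The isomorphism of groups of points induced by an isomorphism of elliptic curves. -/
def pointEquiv (φ : EllIso E E') : E.Point ≃+ E'.Point where
  toFun := φ.pointFun
  invFun := φ.symm.pointFun
  left_inv P := by rw [← pointFun_trans, trans_symm, pointFun_refl]
  right_inv P := by rw [← pointFun_trans, symm_trans, pointFun_refl]
  map_add' := φ.pointFun_add

end EllIso

variable [DecidableEq k]

/-- The `p`-torsion subgroup `E[p]`. -/
abbrev EllCurve.Tors (E : EllCurve k) (p : ℕ) : Type _ := AddSubgroup.torsionBy E.Point (p : ℤ)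

/-- `E[p]` is a vector space over `𝔽_p`. -/
instance EllCurve.Tors.module (E : EllCurve k) (p : ℕ) : Module (ZMod p) (E.Tors p) :=
  AddSubgroup.torsionBy.zmodModule

variable {E E' E'' : EllCurve k}

/-- The linear map `E[p] → E'[p]` induced by an isomorphism of elliptic curves. -/
def EllIso.torsHom (φ : EllIso E E') (p : ℕ) : E.Tors p →ₗ[ZMod p] E'.Tors p :=
  ((φ.pointEquiv.toAddMonoidHom.comp (AddSubgroup.subtype _)).codRestrict
    (AddSubgroup.torsionBy E'.Point (p : ℤ)) (fun P => by
      rw [AddSubgroup.torsionBy.nsmul_iff, ← map_nsmul, AddSubgroup.torsionBy.nsmul,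
        map_zero])).toZModLinearMap p

theorem EllIso.torsHom_apply (φ : EllIso E E') (p : ℕ) (P : E.Tors p) :
    ((φ.torsHom p P : E'.Tors p) : E'.Point) = φ.pointFun (P : E.Point) := rfl

theorem EllIso.torsHom_refl (p : ℕ) : (EllIso.refl E).torsHom p = LinearMap.id := by
  refine LinearMap.ext fun P => Subtype.ext ?_
  rw [torsHom_apply, pointFun_refl, LinearMap.id_apply]

theorem EllIso.torsHom_trans (φ : EllIso E E') (ψ : EllIso E' E'') (p : ℕ) :
    (φ.trans ψ).torsHom p = ψ.torsHom p ∘ₗ φ.torsHom p := by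
  refine LinearMap.ext fun P => Subtype.ext ?_
  rw [torsHom_apply, pointFun_trans, LinearMap.comp_apply, torsHom_apply, torsHom_apply]

/-- The linear isomorphism `E[p] → E'[p]` induced by an isomorphism of elliptic curves. -/
def EllIso.tors (φ : EllIso E E') (p : ℕ) : E.Tors p ≃ₗ[ZMod p] E'.Tors p where
  __ := φ.torsHom p
  invFun := φ.symm.torsHom p
  left_inv P := by
    have h := LinearMap.congr_fun (EllIso.torsHom_trans φ φ.symm p) P
    rw [trans_symm, torsHom_refl] at h
    exact h.symm
  right_inv P := by
    have h := LinearMap.congr_fun (EllIso.torsHom_trans φ.symm φ p) P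
    rw [symm_trans, torsHom_refl] at h
    exact h.symm

theorem EllIso.tors_apply (φ : EllIso E E') (p : ℕ) (P : E.Tors p) :
    ((φ.tors p P : E'.Tors p) : E'.Point) = φ.pointFun (P : E.Point) := rfl

theorem EllIso.tors_refl (p : ℕ) (P : E.Tors p) : (EllIso.refl E).tors p P = P :=
  LinearMap.congr_fun (EllIso.torsHom_refl p) P

theorem EllIso.tors_trans (φ : EllIso E E') (ψ : EllIso E' E'') (p : ℕ) (P : E.Tors p) :
    (φ.trans ψ).tors p P = ψ.tors p (φ.tors p P) :=
  LinearMap.congr_fun (EllIso.torsHom_trans φ ψ p) P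

/-- The element of `PGL(E[p])` induced by an automorphism of `E`. -/
def EllIso.toPGL (p : ℕ) [Fact p.Prime] (φ : EllIso E E) : PGL (ZMod p) (E.Tors p) :=
  ((LinearMap.GeneralLinearGroup.ofLinearEquiv (φ.tors p) :
    LinearMap.GeneralLinearGroup (ZMod p) (E.Tors p)) : PGL (ZMod p) (E.Tors p))

/-- The bijection `ℙ(E[p]) → ℙ(E'[p])` induced by an isomorphism of elliptic curves. -/
def EllIso.proj (p : ℕ) [Fact p.Prime] (φ : EllIso E E') :
    Projectivization (ZMod p) (E.Tors p) → Projectivization (ZMod p) (E'.Tors p) :=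
  Projectivization.map (φ.tors p).toLinearMap (φ.tors p).injective

theorem EllIso.proj_refl (p : ℕ) [Fact p.Prime] : (EllIso.refl E).proj p = id := by
  ext P
  induction P using Projectivization.ind with
  | h v hv => simp [proj, Projectivization.map_mk, tors_refl]

theorem EllIso.proj_trans (p : ℕ) [Fact p.Prime] (φ : EllIso E E') (ψ : EllIso E' E'') :
    (φ.trans ψ).proj p = ψ.proj p ∘ φ.proj p := by
  ext P
  induction P using Projectivization.ind with
  | h v hv => simp [proj, Projectivization.map_mk, tors_trans]

end Elliptic

/-! ### Elliptic curves with an oriented necklace -/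

section Necklaces

variable (k : Type*) [Field k] [DecidableEq k] (p : ℕ) [Fact p.Prime]

/-- The minimal polynomial of `γ ∈ 𝔽_{p²}` over `𝔽_p`. -/
noncomputable abbrev minpolyOf (γ : (GaloisField p 2)ˣ) : Polynomial (ZMod p) :=
  minpoly (ZMod p) (γ : GaloisField p 2)

variable (γ : (GaloisField p 2)ˣ)

/-- A pair `(E, v)` of an elliptic curve and an oriented `γ`-necklace of `E`. -/
structure NecklacePair where
  E : EllCurve k
  v : OrientedNecklace (E.Tors p) (minpolyOf p γ)

/-- Two pairs `(E, v)` and `(E', v')` are isomorphic if there is an isomorphism `E → E'` that maps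
`v` to `v'`. -/
def NecklacePair.setoid : Setoid (NecklacePair k p γ) where
  r x y := ∃ φ : EllIso x.E y.E, x.v.1.map (φ.proj p) = y.v.1
  iseqv :=
    { refl := fun x => ⟨EllIso.refl x.E, by
        rw [EllIso.proj_refl]
        exact Quotient.inductionOn' x.v.1 (fun l => by simp)⟩
      symm := by
        rintro x y ⟨φ, h⟩
        refine ⟨φ.symm, ?_⟩
        rw [← h]
        refine Quotient.inductionOn' x.v.1 (fun l => ?_)
        simp [← EllIso.proj_trans, EllIso.trans_symm, EllIso.proj_refl]
      trans := by
        rintro x y z ⟨φ, h⟩ ⟨ψ, h'⟩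
        refine ⟨φ.trans ψ, ?_⟩
        rw [← h', ← h, EllIso.proj_trans]
        exact Quotient.inductionOn' x.v.1 (fun l => by simp) }

/-- The points of the open modular curve `Y_nsp` over `k` (for `k` algebraically closed):
isomorphism classes of pairs `(E, v)`. -/
def Ynsp : Type _ := Quotient (NecklacePair.setoid k p γ)

variable {k p γ}

/-- The point of `Y_nsp` represented by `(E, v)`. -/
def Ynsp.mk (E : EllCurve k) (v : OrientedNecklace (E.Tors p) (minpolyOf p γ)) : Ynsp k p γ :=
  Quotient.mk (NecklacePair.setoid k p γ) ⟨E, v⟩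

variable (k p γ)

/-- The elliptic points with `g` of order `r`: the points that are represented by a pair `(E, v)`
such that some automorphism of `E` induces an element `g` of order `r` in `PGL(E[p])` with
`g(v) = v`. -/
def ellipticPoints (r : ℕ) : Set (Ynsp k p γ) :=
  {x | ∃ (E : EllCurve k) (v : OrientedNecklace (E.Tors p) (minpolyOf p γ)) (φ : EllIso E E),
    x = Ynsp.mk E v ∧ orderOf (φ.toPGL p) = r ∧
      v.1.map (PGL.toPerm (ZMod p) (E.Tors p) (φ.toPGL p)) = v.1}

end Necklaces

/-! ### Orbits of bases of `E[p]` under a subgroup of `GL₂(𝔽_p)` -/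

section Bases

/-- The stabiliser of `(1 : α) ∈ ℙ¹(𝔽_{p²})` under the right action of `GL₂(𝔽_p)`; it is a
non-split Cartan subgroup for `α ∉ 𝔽_p`, and every non-split Cartan subgroup is of this form. -/
noncomputable def cartan (p : ℕ) [Fact p.Prime] (α : GaloisField p 2) :
    Subgroup (GL (Fin 2) (ZMod p)) where
  carrier := {M | ∃ c : (GaloisField p 2)ˣ,
    Matrix.vecMul ![1, α] (M.1.map (algebraMap (ZMod p) (GaloisField p 2))) =
      (c : GaloisField p 2) • ![1, α]}
  one_mem' := ⟨1, by simp⟩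
  mul_mem' := by
    rintro M N ⟨c, hc⟩ ⟨d, hd⟩
    refine ⟨c * d, ?_⟩
    rw [Units.val_mul, Matrix.map_mul, ← Matrix.vecMul_vecMul, hc, Matrix.smul_vecMul, hd,
      smul_smul, Units.val_mul]
  inv_mem' := by
    rintro M ⟨c, hc⟩
    refine ⟨c⁻¹, ?_⟩
    have h : M.1.map (algebraMap (ZMod p) (GaloisField p 2)) *
        (M⁻¹).1.map (algebraMap (ZMod p) (GaloisField p 2)) = 1 := by
      rw [← Matrix.map_mul, ← Units.val_mul, mul_inv_cancel]
      simp
    have h2 := congrArg (fun v => Matrix.vecMul v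
      ((M⁻¹).1.map (algebraMap (ZMod p) (GaloisField p 2)))) hc
    simp only [Matrix.vecMul_vecMul, h, Matrix.vecMul_one, Matrix.smul_vecMul] at h2
    conv_rhs => rw [h2]
    rw [smul_smul, Units.inv_mul, one_smul]

variable (k : Type*) [Field k] [DecidableEq k] (p : ℕ) [Fact p.Prime]

/-- A pair `(E, (P, Q))` of an elliptic curve and a basis of `E[p]`. -/
structure BasisPair where
  E : EllCurve k
  b : Module.Basis (Fin 2) (ZMod p) (E.Tors p)

variable {k p} in
/-- The right action `(P, Q) · (a b; c d) = (aP + cQ, bP + dQ)` of matrices on pairs. -/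
def rightMul {V : Type*} [AddCommGroup V] [Module (ZMod p) V] (b : Fin 2 → V)
    (M : GL (Fin 2) (ZMod p)) : Fin 2 → V :=
  fun j => ∑ i, M.1 i j • b i

theorem rightMul_one {V : Type*} [AddCommGroup V] [Module (ZMod p) V] (b : Fin 2 → V) :
    rightMul b (1 : GL (Fin 2) (ZMod p)) = b := by
  funext j
  simp [rightMul, Matrix.one_apply]

theorem rightMul_mul {V : Type*} [AddCommGroup V] [Module (ZMod p) V] (b : Fin 2 → V)
    (M N : GL (Fin 2) (ZMod p)) : rightMul b (M * N) = rightMul (rightMul b M) N := by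
  funext j
  simp only [rightMul, Units.val_mul, Matrix.mul_apply, Fin.sum_univ_two]
  module

theorem map_rightMul {V V' : Type*} [AddCommGroup V] [Module (ZMod p) V] [AddCommGroup V']
    [Module (ZMod p) V'] (f : V ≃ₗ[ZMod p] V') (b : Fin 2 → V) (M : GL (Fin 2) (ZMod p)) :
    f ∘ rightMul b M = rightMul (f ∘ b) M := by
  funext j
  simp [rightMul]

variable (H : Subgroup (GL (Fin 2) (ZMod p)))

/-- `(E, b)` and `(E', b')` represent the same point of `Y_H` if some isomorphism `E → E'` maps
the orbit `b H` to the orbit `b' H`. -/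
def BasisPair.setoid : Setoid (BasisPair k p) where
  r x y := ∃ φ : EllIso x.E y.E, ∃ M ∈ H, rightMul (φ.tors p ∘ x.b) M = y.b
  iseqv :=
    { refl := fun x => ⟨EllIso.refl x.E, 1, H.one_mem, by
        rw [rightMul_one]
        funext j
        exact EllIso.tors_refl p _⟩
      symm := by
        rintro x y ⟨φ, M, hM, h⟩
        refine ⟨φ.symm, M⁻¹, H.inv_mem hM, ?_⟩
        rw [← h, map_rightMul, ← rightMul_mul, mul_inv_cancel, rightMul_one]
        funext j
        simp only [Function.comp_apply]
        rw [← EllIso.tors_trans, EllIso.trans_symm, EllIso.tors_refl]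
      trans := by
        rintro x y z ⟨φ, M, hM, h⟩ ⟨ψ, N, hN, h'⟩
        refine ⟨φ.trans ψ, M * N, H.mul_mem hM hN, ?_⟩
        rw [← h', ← h, map_rightMul, ← rightMul_mul]
        congr 1
        funext j
        simp [EllIso.tors_trans] }

/-- The points over `k` of the open modular curve `Y_H`: isomorphism classes of pairs `(E, b)`
modulo the right action of `H` on the bases `b` of `E[p]`. -/
def YH : Type _ := Quotient (BasisPair.setoid k p H)

/-- The elliptic points of `Y_H` with `g` of order `r`: the points that are represented by a pair
`(E, b)` such that some automorphism of `E` induces an element `g` of order `r` in `PGL(E[p])` and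
maps the orbit `b H` to itself. -/
def ellipticPointsH (r : ℕ) : Set (YH k p H) :=
  {x | ∃ (E : EllCurve k) (b : Module.Basis (Fin 2) (ZMod p) (E.Tors p)) (φ : EllIso E E),
    x = Quotient.mk (BasisPair.setoid k p H) ⟨E, b⟩ ∧ orderOf (φ.toPGL p) = r ∧
      ∃ M ∈ H, φ.tors p ∘ b = rightMul b M}

end Bases

/-! On a short equation y² = x³ + Ax + B an automorphism is (x, y) ↦ (u²x, u³y), with u⁶ = 1 unless
B = 0 and u⁴ = 1 unless A = 0; moreover u = -1 acts as the scalar -1. So an image of order 2 in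
PGL(E[p]) forces E ≅ (y² = x³ + x), and an image of order 3 forces E ≅ (y² = x³ + 1). For each r,
all elliptic points thus live on one curve E₀ and are detected by one automorphism φ₀, whose action
T on V = E₀[p] satisfies q(T) = 0 with q = X² + 1 or q = X² + X + 1 (`IsExtraAut`,
`IsExtraAut.exists_transport_necklace`, `IsExtraAut.exists_transport_basis`).

An element of PGL(V) preserves a necklace exactly when it commutes with the permutation h of ℙ(V)
that advances the necklace by one step (`IsOrbitCycle.map_eq_iff`). If q splits over 𝔽_p, then T has
an eigenline; an element that commutes with a transitive permutation and has a fixed point is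
trivial, so there is no elliptic point. If q is irreducible, T makes V a line over 𝔽_{p²}. A
representative of h commutes with T, hence is multiplication by a root of the minimal polynomial of
γ, that is, by γ or γ^p. As γ^(p+1) is a scalar, these are inverse to each other in PGL(V), and the
two necklaces are exchanged by w (`exists_fixed_necklaces`). No automorphism of E₀ identifies them,
because all automorphisms are powers of φ₀ up to scalars and so fix both.

On the Cartan side, a basis b identifies V with 𝔽_{p²}, and the orbit of b is preserved exactly when
T becomes multiplication by some c. This c is one of the two conjugate roots of q, and it determines
the orbit (`IsMulBy.exists_mem_cartan`, `IsExtraAut.ncard_ellipticPointsH`). The Legendre symbols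
record whether q has a root modulo p.

In the irreducible case dim V = 2 has to be known. Since 𝔽_{p²} acts on V, it suffices that V ≠ 0
and |V| ≤ p² (`finrank_eq_two_of_aeval_eq_zero`). Both come from the p-th division polynomial, of
degree (p² - 1)/2 in x, once its zeros are known to be the abscissae of the p-torsion points
(`ShortCurve.nsmul_eq_zero_iff_psi`). That criterion combines the multiplication formula
(`ShortCurve.mulFormula_of_psi_ne_zero`) with a divisibility property of the zeros of the sequence
ψ_n (`ShortCurve.dvd_of_psi_eq_zero`). The latter rests on the elliptic relation
(`ShortCurve.psi_relation`), proved at a universal point, where no ψ_n vanishes. -/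

/-! ### Point arithmetic on short Weierstrass curves -/

section ShortWeierstrass

open WeierstrassCurve

/-- The curve `y² = x³ + Ax + B`. -/
def shortCurve {F : Type*} [Field F] (A B : F) : WeierstrassCurve F := ⟨0, 0, 0, A, B⟩

namespace ShortCurve

variable {F : Type*} [Field F] {A B : F}

/-- The abscissa of a point, with value `0` at infinity. -/
def xc : (shortCurve A B).toAffine.Point → F
  | .zero => 0
  | .some x _ _ => x

/-- The ordinate of a point, with value `0` at infinity. -/
def yc : (shortCurve A B).toAffine.Point → F
  | .zero => 0
  | .some _ y _ => y

theorem equation_iff {x y : F} :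
    (shortCurve A B).toAffine.Equation x y ↔ y ^ 2 = x ^ 3 + A * x + B := by
  rw [Affine.equation_iff]
  simp [shortCurve]

theorem nonsingular_of_ne_zero (h2 : (2 : F) ≠ 0) {x y : F} (h : y ^ 2 = x ^ 3 + A * x + B)
    (hy : y ≠ 0) : (shortCurve A B).toAffine.Nonsingular x y := by
  rw [Affine.nonsingular_iff]
  refine ⟨equation_iff.2 h, Or.inr ?_⟩
  simp only [shortCurve, zero_mul, sub_zero]
  intro h'
  apply hy
  have : 2 * y = 0 := by linear_combination h'
  simpa [h2] using this

theorem negY_eq (x y : F) : (shortCurve A B).toAffine.negY x y = -y := by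
  simp [shortCurve, Affine.negY]

variable {P Q : (shortCurve A B).toAffine.Point}

theorem yc_sq (hP : P ≠ 0) : yc P ^ 2 = xc P ^ 3 + A * xc P + B := by
  rcases P with _ | ⟨x, y, h⟩
  · exact absurd rfl hP
  · exact equation_iff.1 h.1

theorem xc_neg (P : (shortCurve A B).toAffine.Point) : xc (-P) = xc P := by
  rcases P with _ | ⟨x, y, h⟩ <;> rfl

theorem yc_neg (P : (shortCurve A B).toAffine.Point) : yc (-P) = -yc P := by
  rcases P with _ | ⟨x, y, h⟩
  · exact neg_zero.symm
  · exact negY_eq x y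

theorem xc_eq_iff (hP : P ≠ 0) (hQ : Q ≠ 0) : xc P = xc Q ↔ P = Q ∨ P = -Q := by
  rcases P with _ | ⟨x, y, h⟩
  · exact absurd rfl hP
  rcases Q with _ | ⟨x', y', h'⟩
  · exact absurd rfl hQ
  exact Affine.Point.X_eq_iff

/-- The symmetric polynomial whose zeros in the third variable are the abscissae of the sum and
the difference of two points. -/
def sumPoly (A B a b c : F) : F :=
  (a - b) ^ 2 * c ^ 2 - 2 * ((a + b) * (A + a * b) + 2 * B) * c + (a * b - A) ^ 2
    - 4 * B * (a + b)

/-- For finite points with abscissae a, b, c, vanishing means P ± Q ± R = 0 for some signs, a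
condition symmetric in the three. Exchanging the roles of the points in this way drives the
inductions below. -/
theorem sumPoly_rotate (a b c : F) : sumPoly A B a b c = sumPoly A B c a b := by
  simp only [sumPoly]; ring

theorem sumPoly_swap (a b c : F) : sumPoly A B a b c = sumPoly A B b a c := by
  simp only [sumPoly]; ring

variable [DecidableEq F]

theorem add_ne_zero_of_xc_ne (h : xc P ≠ xc Q) : P + Q ≠ 0 := by
  intro h0
  rw [eq_neg_of_add_eq_zero_left h0, xc_neg] at h
  exact h rfl

theorem xc_add (hP : P ≠ 0) (hQ : Q ≠ 0) (h : xc P ≠ xc Q) :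
    xc (P + Q) * (xc P - xc Q) ^ 2 =
      (yc P - yc Q) ^ 2 - (xc P + xc Q) * (xc P - xc Q) ^ 2 := by
  rcases P with _ | ⟨x, y, h1⟩
  · exact absurd rfl hP
  rcases Q with _ | ⟨x', y', h2⟩
  · exact absurd rfl hQ
  change x ≠ x' at h
  rw [Affine.Point.add_of_X_ne h]
  simp only [xc, yc, Affine.addX, Affine.slope_of_X_ne h]
  have h3 : x - x' ≠ 0 := sub_ne_zero.2 h
  simp only [shortCurve]
  field_simp
  ring

theorem xc_sub (hP : P ≠ 0) (hQ : Q ≠ 0) (h : xc P ≠ xc Q) :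
    xc (P - Q) * (xc P - xc Q) ^ 2 =
      (yc P + yc Q) ^ 2 - (xc P + xc Q) * (xc P - xc Q) ^ 2 := by
  have := xc_add hP (neg_ne_zero.2 hQ) (by rwa [xc_neg])
  rw [xc_neg, yc_neg, ← sub_eq_add_neg] at this
  linear_combination this

/-- In the difference of the two chord formulas only the mixed terms of (y ∓ z)² survive. This links
ordinates to abscissae of sums and differences. -/
theorem xc_add_sub_xc_sub (hP : P ≠ 0) (hQ : Q ≠ 0) (h : xc P ≠ xc Q) :
    (xc (P + Q) - xc (P - Q)) * (xc P - xc Q) ^ 2 = -4 * yc P * yc Q := by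
  linear_combination xc_add hP hQ h - xc_sub hP hQ h

/-- The product of the chord formulas for P + Q and P - Q contains the ordinates only through their
squares, which the equation of the curve eliminates. -/
theorem sub_mul_sub_eq_sumPoly (hP : P ≠ 0) (hQ : Q ≠ 0) (h : xc P ≠ xc Q) (t : F) :
    (xc (P + Q) - t) * (xc (P - Q) - t) * (xc P - xc Q) ^ 2 = sumPoly A B (xc P) (xc Q) t := by
  have h0 : (xc P - xc Q) ^ 2 ≠ 0 := pow_ne_zero _ (sub_ne_zero.2 h)
  apply mul_right_cancel₀ h0
  have e1 := xc_add hP hQ h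
  have e2 := xc_sub hP hQ h
  have e3 := yc_sq hP
  have e4 := yc_sq hQ
  set a := xc P
  set b := xc Q
  set y := yc P
  set z := yc Q
  have : (xc (P + Q) - t) * (xc (P - Q) - t) * (a - b) ^ 2 * (a - b) ^ 2 =
      (xc (P + Q) * (a - b) ^ 2 - t * (a - b) ^ 2) *
        (xc (P - Q) * (a - b) ^ 2 - t * (a - b) ^ 2) := by ring
  rw [this, e1, e2]
  have : ((y - z) ^ 2 - (a + b) * (a - b) ^ 2 - t * (a - b) ^ 2) *
      ((y + z) ^ 2 - (a + b) * (a - b) ^ 2 - t * (a - b) ^ 2) =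
      (y ^ 2 - z ^ 2) ^ 2 - 2 * (y ^ 2 + z ^ 2) * ((a + b + t) * (a - b) ^ 2) +
      ((a + b + t) * (a - b) ^ 2) ^ 2 := by ring
  rw [this, e3, e4, sumPoly]
  ring

theorem add_self_ne_zero (h2 : (2 : F) ≠ 0) (hy : yc P ≠ 0) : P + P ≠ 0 := by
  intro h0
  have h := congrArg yc (eq_neg_of_add_eq_zero_left h0)
  rw [yc_neg] at h
  have : 2 * yc P = 0 := by linear_combination h
  exact hy (by simpa [h2] using this)

theorem double_formula (h2 : (2 : F) ≠ 0) (hP : P ≠ 0) (hy : yc P ≠ 0) :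
    xc (P + P) * (2 * yc P) ^ 2 = (3 * xc P ^ 2 + A) ^ 2 - 2 * xc P * (2 * yc P) ^ 2 ∧
    yc (P + P) * (2 * yc P) = (3 * xc P ^ 2 + A) * (xc P - xc (P + P)) - 2 * yc P ^ 2 := by
  rcases P with _ | ⟨x, y, h1⟩
  · exact absurd rfl hP
  change y ≠ 0 at hy
  have hne : y ≠ (shortCurve A B).toAffine.negY x y := by
    rw [negY_eq]
    intro h
    have : 2 * y = 0 := by linear_combination h
    exact hy (by simpa [h2] using this)
  rw [Affine.Point.add_self_of_Y_ne hne]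
  simp only [xc, yc, Affine.addX, Affine.addY, Affine.negAddY, negY_eq, Affine.slope_of_Y_ne rfl hne]
  have h4 : y - -y ≠ 0 := by
    intro h
    have : 2 * y = 0 := by linear_combination h
    exact hy (by simpa [h2] using this)
  have h5 : y - -y = 2 * y := by ring
  simp only [h5, shortCurve]
  constructor <;> field_simp <;> ring

/-- For equal abscissae the leading coefficient (a - b)² vanishes. What remains is linear in the
third variable, with root x(2P); this is the tangent formula. -/
theorem sumPoly_double (h2 : (2 : F) ≠ 0) (hP : P ≠ 0) (hy : yc P ≠ 0) (t : F) :
    sumPoly A B (xc P) (xc P) t = (2 * yc P) ^ 2 * (xc (P + P) - t) := by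
  have h := (double_formula h2 hP hy).1
  have e := yc_sq hP
  have : (2 * yc P) ^ 2 * (xc (P + P) - t) =
    xc (P + P) * (2 * yc P) ^ 2 - 4 * t * yc P ^ 2 := by ring
  rw [this, h]
  simp only [sumPoly, mul_pow, e]
  ring

end ShortCurve

end ShortWeierstrass

/-! ### Multiples of a point and the elliptic divisibility sequence -/

section DivisionValues

open WeierstrassCurve

namespace ShortCurve

section Ring

variable {R : Type*} [CommRing R]

/-- The value of the third division polynomial. -/
def psiThree (A B x : R) : R := 3 * x ^ 4 + 6 * A * x ^ 2 + 12 * B * x - A ^ 2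

/-- The value of the fourth division polynomial, divided by the second one. -/
def psiFour (A B x : R) : R :=
  2 * (x ^ 6 + 5 * A * x ^ 4 + 20 * B * x ^ 3 - 5 * A ^ 2 * x ^ 2 - 4 * A * B * x - 8 * B ^ 2
    - A ^ 3)

/-- The value of the `n`-th division polynomial at `(x, y)`. -/
def psi (A B x y : R) (n : ℤ) : R := normEDS (2 * y) (psiThree A B x) (psiFour A B x) n

/-- On the curve, ψ₄ is thereby expressed through ψ₃ and the ordinate. In particular it cannot
vanish together with ψ₃ unless 2y = 0. -/
theorem psiFour_eq {A B x y : R} (h : y ^ 2 = x ^ 3 + A * x + B) :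
    psiFour A B x = 2 * (3 * x ^ 2 + A) * psiThree A B x - (2 * y) ^ 4 := by
  have : (2 * y) ^ 4 = 16 * (y ^ 2) ^ 2 := by ring
  rw [this, h, psiFour, psiThree]
  ring

theorem psi_even (A B x y : R) (m : ℤ) : psi A B x y (2 * m) * (2 * y) =
    psi A B x y (m - 1) ^ 2 * psi A B x y m * psi A B x y (m + 2) -
      psi A B x y (m - 2) * psi A B x y m * psi A B x y (m + 1) ^ 2 :=
  normEDS_even ..

theorem psi_odd (A B x y : R) (m : ℤ) : psi A B x y (2 * m + 1) =
    psi A B x y (m + 2) * psi A B x y m ^ 3 - psi A B x y (m - 1) * psi A B x y (m + 1) ^ 3 :=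
  normEDS_odd ..

theorem map_psi {S : Type*} [CommRing S] (f : R →+* S) (A B x y : R) (n : ℤ) :
    f (psi A B x y n) = psi (f A) (f B) (f x) (f y) n := by
  rw [psi, map_normEDS]
  simp only [psi, psiThree, psiFour, map_mul, map_add, map_sub, map_pow, map_ofNat]

end Ring

variable {F : Type*} [Field F] [DecidableEq F] {A B : F}

/-- The `n`-th division polynomial gives the abscissa of `n • P`. -/
def MulFormula (P : (shortCurve A B).toAffine.Point) (n : ℕ) : Prop :=
  n • P ≠ 0 ∧ (xc P - xc (n • P)) * psi A B (xc P) (yc P) n ^ 2 =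
    psi A B (xc P) (yc P) (n + 1) * psi A B (xc P) (yc P) (n - 1)

variable {P : (shortCurve A B).toAffine.Point}

theorem mulFormula_one (hP : P ≠ 0) : MulFormula P 1 := by
  refine ⟨by rwa [one_smul], ?_⟩
  simp [psi]

theorem mulFormula_two (h2 : (2 : F) ≠ 0) (hP : P ≠ 0) (hy : yc P ≠ 0) : MulFormula P 2 := by
  refine ⟨by rw [two_smul]; exact add_self_ne_zero h2 hy, ?_⟩
  have h := sumPoly_double h2 hP hy (xc P)
  rw [two_smul]
  have e1 : psi A B (xc P) (yc P) ((2 : ℕ) : ℤ) = 2 * yc P := by simp [psi]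
  have e2 : psi A B (xc P) (yc P) (((2 : ℕ) : ℤ) + 1) = psiThree A B (xc P) :=
    normEDS_three ..
  have e3 : psi A B (xc P) (yc P) (((2 : ℕ) : ℤ) - 1) = 1 := normEDS_one ..
  rw [e1, e2, e3, psiThree]
  rw [sumPoly] at h
  linear_combination h

/-- The ordinate of 2P, obtained from the tangent formula alone, without any information on 3P. -/
theorem psi_four_eq (h2 : (2 : F) ≠ 0) (hP : P ≠ 0) (hy : yc P ≠ 0) :
    psi A B (xc P) (yc P) 4 = 2 * yc (2 • P) * psi A B (xc P) (yc P) 2 ^ 4 := by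
  have h1 := (mulFormula_two h2 hP hy).2
  have h3 := (double_formula h2 hP hy).2
  rw [two_smul] at h1 ⊢
  have e1 : psi A B (xc P) (yc P) ((2 : ℕ) : ℤ) = 2 * yc P := by simp [psi]
  have e1' : psi A B (xc P) (yc P) 2 = 2 * yc P := by simp [psi]
  have e2 : psi A B (xc P) (yc P) (((2 : ℕ) : ℤ) + 1) = psiThree A B (xc P) :=
    normEDS_three ..
  have e3 : psi A B (xc P) (yc P) (((2 : ℕ) : ℤ) - 1) = 1 := normEDS_one ..
  have e4 : psi A B (xc P) (yc P) 4 = psiFour A B (xc P) * (2 * yc P) := normEDS_four ..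
  rw [e1, e2, e3] at h1
  rw [e4, e1', psiFour_eq (yc_sq hP)]
  linear_combination (-2 * (2 * yc P) ^ 3) * h3 - (2 * (2 * yc P) * (3 * xc P ^ 2 + A)) * h1

/-- This recovers the ordinate of the multiple (m + 1)P. The even recursion expresses ψ_{2(m+1)}
through neighbouring terms; the multiplication formulas turn these into the difference of the
abscissae of mP and (m + 2)P, and `xc_add_sub_xc_sub` evaluates that difference. -/
theorem psi_two_mul_eq (h2 : (2 : F) ≠ 0) (hP : P ≠ 0) (hy : yc P ≠ 0) {m : ℕ}
    (h0 : MulFormula P (m + 1)) (h1 : MulFormula P (m + 2)) (h3 : MulFormula P m)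
    (hw : psi A B (xc P) (yc P) m ≠ 0) (hw' : psi A B (xc P) (yc P) (m + 2) ≠ 0) :
    psi A B (xc P) (yc P) (2 * (m + 1)) =
      2 * yc ((m + 1) • P) * psi A B (xc P) (yc P) (m + 1) ^ 4 := by
  obtain ⟨h0n, h0⟩ := h0
  obtain ⟨h1n, h1⟩ := h1
  obtain ⟨h3n, h3⟩ := h3
  push_cast at h0 h1 h3
  have key := psi_even A B (xc P) (yc P) (m + 1)
  rw [show (m : ℤ) + 1 + 1 = m + 2 by ring, show (m : ℤ) + 1 - 1 = m by ring] at h0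
  rw [show (m : ℤ) + 2 + 1 = m + 3 by ring, show (m : ℤ) + 2 - 1 = m + 1 by ring] at h1
  rw [show (m : ℤ) + 1 - 1 = m by ring, show (m : ℤ) + 1 - 2 = m - 1 by ring,
    show (m : ℤ) + 1 + 2 = m + 3 by ring, show (m : ℤ) + 1 + 1 = m + 2 by ring] at key
  have hx : xc ((m + 1) • P) ≠ xc P := by
    intro h
    rw [h, sub_self, zero_mul] at h0
    exact mul_ne_zero hw' hw h0.symm
  have e1 : (m + 1) • P + P = (m + 2) • P := by rw [add_smul m 2, two_smul, add_smul, one_smul]; abel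
  have e2 : (m + 1) • P - P = m • P := by rw [add_smul, one_smul, add_sub_cancel_right]
  have h4 := xc_add_sub_xc_sub h0n hP hx
  rw [e1, e2] at h4
  have h2y : 2 * yc P ≠ 0 := mul_ne_zero h2 hy
  apply mul_right_cancel₀ h2y
  rw [key]
  set w := psi A B (xc P) (yc P)
  linear_combination (-w m ^ 2) * h1 + w (m + 2) ^ 2 * h3 - (xc (m • P) - xc ((m + 2) • P)) *
    (w (m + 2) * w m + (xc P - xc ((m + 1) • P)) * w (m + 1) ^ 2) * h0 - w (m + 1) ^ 4 * h4

/-- Multiplying each of the two formulas by the square of the other ψ and subtracting gives the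
right-hand side of the odd recursion. -/
theorem psi_odd_eq {m : ℕ} (h0 : MulFormula P m) (h1 : MulFormula P (m + 1)) :
    psi A B (xc P) (yc P) (2 * m + 1) = (xc (m • P) - xc ((m + 1) • P)) *
      psi A B (xc P) (yc P) m ^ 2 * psi A B (xc P) (yc P) (m + 1) ^ 2 := by
  have key := psi_odd A B (xc P) (yc P) m
  have h0 := h0.2
  have h1 := h1.2
  push_cast at h0 h1
  rw [show (m : ℤ) + 1 + 1 = m + 2 by ring, show (m : ℤ) + 1 - 1 = m by ring] at h1
  rw [key]
  set w := psi A B (xc P) (yc P)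
  linear_combination (-w m ^ 2) * h1 + w (m + 1) ^ 2 * h0

/-- The sum and the difference of (m + 1)P and mP are (2m + 1)P and P. So x(P) - x((2m + 1)P) is a
product of ordinates, known from ψ_{2m} and ψ_{2m+2}. -/
theorem mulFormula_odd {m : ℕ} (h0 : MulFormula P m) (h1 : MulFormula P (m + 1))
    (h0' : psi A B (xc P) (yc P) (2 * m) = 2 * yc (m • P) * psi A B (xc P) (yc P) m ^ 4)
    (h1' : psi A B (xc P) (yc P) (2 * (m + 1)) =
      2 * yc ((m + 1) • P) * psi A B (xc P) (yc P) (m + 1) ^ 4)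
    (hw : psi A B (xc P) (yc P) (2 * m + 1) ≠ 0) : MulFormula P (2 * m + 1) := by
  have e := psi_odd_eq h0 h1
  have hx : xc ((m + 1) • P) ≠ xc (m • P) := by
    intro h
    rw [h, sub_self, zero_mul, zero_mul] at e
    exact hw e
  have e1 : (m + 1) • P + m • P = (2 * m + 1) • P := by rw [← add_smul]; congr 1; ring
  have e2 : (m + 1) • P - m • P = P := by rw [add_smul, one_smul, add_sub_cancel_left]
  have h4 := xc_add_sub_xc_sub h1.1 h0.1 hx
  rw [e1, e2] at h4
  refine ⟨by rw [← e1]; exact add_ne_zero_of_xc_ne hx, ?_⟩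
  push_cast
  rw [show 2 * (m : ℤ) + 1 + 1 = 2 * (m + 1) by ring, show 2 * (m : ℤ) + 1 - 1 = 2 * m by ring,
    e, h0', h1']
  set w := psi A B (xc P) (yc P)
  linear_combination (-w m ^ 4 * w (m + 1) ^ 4) * h4

theorem mulFormula_even (h2 : (2 : F) ≠ 0) {m : ℕ} (hP : P ≠ 0) (h0 : MulFormula P m)
    (h1 : MulFormula P (m + 1)) (h3 : MulFormula P (m + 2))
    (h1' : psi A B (xc P) (yc P) (2 * (m + 1)) =
      2 * yc ((m + 1) • P) * psi A B (xc P) (yc P) (m + 1) ^ 4)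
    (hw : psi A B (xc P) (yc P) m ≠ 0) (hw' : psi A B (xc P) (yc P) (m + 2) ≠ 0)
    (hw2 : psi A B (xc P) (yc P) (2 * (m + 1)) ≠ 0) : MulFormula P (2 * (m + 1)) := by
  have o1 := psi_odd_eq h0 h1
  have o2 := psi_odd_eq h1 h3
  have e := h1.2
  push_cast at e o1 o2
  rw [show (m : ℤ) + 1 + 1 = m + 2 by ring, show (m : ℤ) + 1 - 1 = m by ring] at e
  rw [show (m : ℤ) + 1 + 1 = m + 2 by ring] at o2
  have hx : xc ((m + 1) • P) ≠ xc P := by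
    intro h
    rw [h, sub_self, zero_mul] at e
    exact mul_ne_zero hw' hw e.symm
  have e1 : (m + 1) • P + P = (m + 2) • P := by rw [add_smul m 2, two_smul, add_smul, one_smul]; abel
  have e2 : (m + 1) • P - P = m • P := by rw [add_smul, one_smul, add_sub_cancel_right]
  have hy : yc ((m + 1) • P) ≠ 0 := by
    intro h
    rw [h, mul_zero, zero_mul] at h1'
    exact hw2 h1'
  have h4 := sub_mul_sub_eq_sumPoly h1.1 hP hx (xc ((m + 1) • P))
  have h5 := sumPoly_double h2 h1.1 hy (xc P)
  -- The abscissa of (m + 1)P occurs twice in `sumPoly`. After rotation the value is that of the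
  -- doubling formula, which brings in 2(m + 1)P.
  rw [e1, e2, sumPoly_rotate, h5, ← two_smul ℕ, ← mul_smul] at h4
  refine ⟨by rw [mul_smul, two_smul]; exact add_self_ne_zero h2 hy, ?_⟩
  push_cast
  rw [show 2 * ((m : ℤ) + 1) - 1 = 2 * m + 1 by ring, o1, o2, h1']
  set w := psi A B (xc P) (yc P)
  linear_combination w (m + 1) ^ 8 * h4 + (xc ((m + 1) • P) - xc ((m + 2) • P)) *
    (xc (m • P) - xc ((m + 1) • P)) * w (m + 1) ^ 4 *
    (w (m + 2) * w m + (xc P - xc ((m + 1) • P)) * w (m + 1) ^ 2) * e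

/-- As long as the division polynomials do not vanish at `P`, the multiples of `P` are nonzero and
given by them. -/
theorem mulFormula_of_psi_ne_zero (h2 : (2 : F) ≠ 0) (hP : P ≠ 0) (hy : yc P ≠ 0) (n : ℕ)
    (hn : 1 ≤ n) (h : ∀ j : ℕ, 1 ≤ j → j ≤ n → psi A B (xc P) (yc P) j ≠ 0) : MulFormula P n := by
  induction n using Nat.strong_induction_on with
  | _ n ih =>
    have ih' : ∀ j, 1 ≤ j → j < n → MulFormula P j := fun j h1 h3 =>
      ih j h3 h1 fun i hi hij => h i hi (hij.trans h3.le)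
    -- The ordinate of jP requires the formula for (j + 1)P, which the induction supplies only for j
    -- + 1 < n.
    have hY : ∀ j, 1 ≤ j → j + 1 < n → psi A B (xc P) (yc P) (2 * j) =
        2 * yc (j • P) * psi A B (xc P) (yc P) j ^ 4 := by
      intro j hj hjn
      obtain ⟨i, rfl⟩ : ∃ i, j = i + 1 := ⟨j - 1, by omega⟩
      rcases Nat.eq_zero_or_pos i with rfl | hi
      · simp [psi]
      · push_cast
        refine psi_two_mul_eq h2 hP hy (ih' _ (by omega) (by omega)) (ih' _ (by omega) (by omega))
          (ih' _ (by omega) (by omega)) (h _ (by omega) (by omega)) ?_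
        have := h (i + 2) (by omega) (by omega)
        exact_mod_cast this
    rcases Nat.even_or_odd' n with ⟨m, rfl | rfl⟩
    · rcases Nat.lt_or_ge m 2 with hm | hm
      · obtain rfl : m = 1 := by omega
        exact mulFormula_two h2 hP hy
      · obtain ⟨i, rfl⟩ : ∃ i, m = i + 1 := ⟨m - 1, by omega⟩
        have hYi := hY (i + 1) (by omega) (by omega)
        have w1 := h (i + 2) (by omega) (by omega)
        have w2 := h (2 * (i + 1)) (by omega) (by omega)
        push_cast at hYi w1 w2
        exact mulFormula_even h2 hP (ih' _ (by omega) (by omega)) (ih' _ (by omega) (by omega))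
          (ih' _ (by omega) (by omega)) hYi (h _ (by omega) (by omega)) w1 w2
    · rcases Nat.eq_zero_or_pos m with rfl | hm
      · exact mulFormula_one hP
      · have w := h (2 * m + 1) (by omega) le_rfl
        push_cast at w
        have hY1 : psi A B (xc P) (yc P) (2 * m) = 2 * yc (m • P) * psi A B (xc P) (yc P) m ^ 4 :=
          hY m hm (by omega)
        have hY2 : psi A B (xc P) (yc P) (2 * (m + 1)) =
            2 * yc ((m + 1) • P) * psi A B (xc P) (yc P) (m + 1) ^ 4 := by
          rcases Nat.lt_or_ge m 2 with hm2 | hm2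
          -- Here n = 3: the general ordinate formula for 2P would presuppose the formula for 3P, so
          -- the direct one is used.
          · obtain rfl : m = 1 := by omega
            exact psi_four_eq h2 hP hy
          · have := hY (m + 1) (by omega) (by omega)
            exact_mod_cast this
        exact mulFormula_odd (ih' _ (by omega) (by omega)) (ih' _ (by omega) (by omega)) hY1 hY2 w

end ShortCurve

end DivisionValues

/-! ### The elliptic relation and the zeros of the sequence -/

section EllipticRelation

open WeierstrassCurve

namespace ShortCurve

section Generic

variable {F : Type*} [Field F] [DecidableEq F] {A B : F} {P : (shortCurve A B).toAffine.Point}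

/-- Write x_j for the abscissa of jP. By symmetry of `sumPoly`, the products (x_n - x_{m+2})(x_n -
x_m) and (x_{m+1} - x_{n+1})(x_{m+1} - x_{n-1}) agree up to ψ-factors. Hence the relations for (m +
2, n) and (m, n), multiplied together and divided by that for (m + 1, n - 1), yield the one for (m +
1, n + 1). -/
theorem psi_add_mul_psi_sub (h2 : (2 : F) ≠ 0) (hP : P ≠ 0) (hy : yc P ≠ 0)
    (h : ∀ j : ℕ, 1 ≤ j → psi A B (xc P) (yc P) j ≠ 0) (n : ℕ) (hn : 1 ≤ n) (m : ℕ) (hnm : n < m) :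
    psi A B (xc P) (yc P) (m + n) * psi A B (xc P) (yc P) (m - n) =
      (xc (n • P) - xc (m • P)) * psi A B (xc P) (yc P) m ^ 2 * psi A B (xc P) (yc P) n ^ 2 := by
  have hX : ∀ j, 1 ≤ j → MulFormula P j := fun j hj =>
    mulFormula_of_psi_ne_zero h2 hP hy j hj fun i hi _ => h i hi
  have w1 : psi A B (xc P) (yc P) 1 = 1 := normEDS_one ..
  have hne : ∀ j, 2 ≤ j → xc (j • P) ≠ xc P := by
    intro j hj he
    have h1 := (hX j (by omega)).2
    rw [he, sub_self, zero_mul] at h1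
    have h3 := h (j + 1) (by omega)
    have h4 := h (j - 1) (by omega)
    push_cast [show 1 ≤ j by omega] at h3 h4
    exact mul_ne_zero h3 h4 h1.symm
  -- the product formula for the abscissae of `j • P ± P`
  have hS : ∀ j : ℕ, 2 ≤ j → ∀ t, (xc ((j + 1) • P) - t) * (xc ((j - 1) • P) - t) *
      (psi A B (xc P) (yc P) (j + 1) * psi A B (xc P) (yc P) (j - 1)) ^ 2 =
      sumPoly A B (xc (j • P)) (xc P) t * psi A B (xc P) (yc P) j ^ 4 := by
    intro j hj t
    have e1 := sub_mul_sub_eq_sumPoly (hX j (by omega)).1 hP (hne j hj) t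
    obtain ⟨i, rfl⟩ : ∃ i, j = i + 1 := ⟨j - 1, by omega⟩
    rw [← succ_nsmul, show (i + 1) • P - P = i • P by rw [succ_nsmul, add_sub_cancel_right]] at e1
    rw [← (hX _ (by omega)).2, ← e1, Nat.add_sub_cancel]
    ring
  induction n using Nat.strong_induction_on generalizing m with
  | _ n ih =>
    rcases Nat.lt_or_ge n 2 with hn2 | hn2
    · obtain rfl : n = 1 := by omega
      have := (hX m (by omega)).2
      rw [Nat.cast_one, one_nsmul, w1, ← this]
      ring
    obtain ⟨n, rfl⟩ : ∃ i, n = i + 1 := ⟨n - 1, by omega⟩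
    obtain ⟨m, rfl⟩ : ∃ i, m = i + 1 := ⟨m - 1, by omega⟩
    have d1 := ih n (by omega) (by omega) (m + 2) (by omega)
    have d2 := ih n (by omega) (by omega) m (by omega)
    have s1 := hS (m + 1) (by omega) (xc (n • P))
    push_cast at d1 d2 s1 ⊢
    simp only [add_sub_cancel_right] at s1
    rw [show (m : ℤ) + 2 + n = m + n + 2 by ring, show (m : ℤ) + 2 - n = m - n + 2 by ring] at d1
    rw [show (m : ℤ) + 1 + 1 = m + 2 by ring] at s1
    rw [show (m : ℤ) + 1 + (n + 1) = m + n + 2 by ring, show (m : ℤ) + 1 - (n + 1) = m - n by ring]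
    rw [show m + 1 + 1 = m + 2 from rfl] at s1
    -- For n = 1 the pair (m + 1, n - 1) would involve the point at infinity; the doubling formula
    -- takes its place.
    rcases Nat.lt_or_ge n 2 with hn1 | hn1
    · obtain rfl : n = 1 := by omega
      have e : sumPoly A B (xc ((m + 1) • P)) (xc P) (xc P) =
          (2 * yc P) ^ 2 * (xc (2 • P) - xc ((m + 1) • P)) := by
        rw [sumPoly_rotate, sumPoly_rotate, sumPoly_double h2 hP hy, two_smul]
      have w2 : psi A B (xc P) (yc P) 2 = 2 * yc P := normEDS_two ..
      have hm0 := h (m + 1) (by omega)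
      push_cast at hm0 d1 d2 ⊢
      rw [one_nsmul] at s1 d1 d2
      rw [w2]
      rw [w1] at d1 d2
      rw [e] at s1
      rw [show (m : ℤ) - 1 + 2 = m + 1 by ring] at d1
      set w := psi A B (xc P) (yc P)
      apply mul_right_cancel₀ (pow_ne_zero 2 hm0)
      linear_combination w (m + 1) * w (m - 1) * d1 +
        (xc P - xc ((m + 2) • P)) * w (m + 2) ^ 2 * 1 ^ 2 * d2 + s1
    · have d3 := ih (n - 1) (by omega) (by omega) (m + 1) (by omega)
      have s2 := hS n (by omega) (xc ((m + 1) • P))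
      have hm1 := h (m + n) (by omega)
      have hm2 := h (m - n + 2) (by omega)
      push_cast [show 1 ≤ n by omega, show n ≤ m by omega] at d3 hm1 hm2
      rw [show (m : ℤ) + 1 + (n - 1) = m + n by ring, show (m : ℤ) + 1 - (n - 1) = m - n + 2 by ring]
        at d3
      set w := psi A B (xc P) (yc P)
      apply mul_right_cancel₀ (mul_ne_zero hm1 hm2)
      rw [sumPoly_swap, sumPoly_rotate] at s1
      linear_combination w (m + n) * w (m - n) * d1 +
        (xc (n • P) - xc ((m + 2) • P)) * w (m + 2) ^ 2 * w n ^ 2 * d2 + w n ^ 4 * s1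
        - w (m + 1) ^ 4 * s2 - (xc ((n + 1) • P) - xc ((m + 1) • P)) * w (m + 1) ^ 2 *
          w (n + 1) ^ 2 * d3

theorem psi_relation_of_ne_zero (h2 : (2 : F) ≠ 0) (hP : P ≠ 0) (hy : yc P ≠ 0)
    (h : ∀ j : ℕ, 1 ≤ j → psi A B (xc P) (yc P) j ≠ 0) {n m : ℕ} (hn : 1 ≤ n) (hnm : n < m) :
    psi A B (xc P) (yc P) (m + n) * psi A B (xc P) (yc P) (m - n) =
      psi A B (xc P) (yc P) (m + 1) * psi A B (xc P) (yc P) (m - 1) *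
        psi A B (xc P) (yc P) n ^ 2 -
      psi A B (xc P) (yc P) (n + 1) * psi A B (xc P) (yc P) (n - 1) *
        psi A B (xc P) (yc P) m ^ 2 := by
  have hX : ∀ j, 1 ≤ j → MulFormula P j := fun j hj =>
    mulFormula_of_psi_ne_zero h2 hP hy j hj fun i hi _ => h i hi
  rw [psi_add_mul_psi_sub h2 hP hy h n hn m hnm, ← (hX n hn).2, ← (hX m (by omega)).2]
  ring

end Generic

/-- The smooth points of y² = x³ form an additive group, where ψ_n at (1, 1) degenerates to n. This
serves to show that the universal ψ_n is not the zero polynomial. -/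
theorem psi_cusp (n : ℕ) : psi (0 : ℤ) 0 1 1 n = n := by
  induction n using normEDSRec' with
  | zero => simp [psi]
  | one => simp [psi]
  | two => simp [psi]
  | three => exact normEDS_three ..
  | four => exact normEDS_four ..
  | even m ih =>
    have h := psi_even (0 : ℤ) 0 1 1 (m + 3)
    have i1 := ih (m + 1) (by omega)
    have i2 := ih (m + 2) (by omega)
    have i3 := ih (m + 3) (by omega)
    have i4 := ih (m + 4) (by omega)
    have i5 := ih (m + 5) (by omega)
    push_cast at i1 i2 i3 i4 i5 ⊢
    rw [show (m : ℤ) + 3 - 1 = m + 2 by ring, show (m : ℤ) + 3 - 2 = m + 1 by ring,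
      show (m : ℤ) + 3 + 1 = m + 4 by ring, show (m : ℤ) + 3 + 2 = m + 5 by ring,
      i1, i2, i3, i4, i5] at h
    apply mul_right_cancel₀ (two_ne_zero : (2 : ℤ) ≠ 0)
    linear_combination h
  | odd m ih =>
    have h := psi_odd (0 : ℤ) 0 1 1 (m + 2)
    have i1 := ih (m + 1) (by omega)
    have i2 := ih (m + 2) (by omega)
    have i3 := ih (m + 3) (by omega)
    have i4 := ih (m + 4) (by omega)
    push_cast at i1 i2 i3 i4 ⊢
    rw [show (m : ℤ) + 2 - 1 = m + 1 by ring, show (m : ℤ) + 2 + 2 = m + 4 by ring,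
      show (m : ℤ) + 2 + 1 = m + 3 by ring, i1, i2, i3, i4] at h
    linear_combination h

/-- The elliptic relation for the values of the division polynomials. -/
theorem psi_relation {R : Type*} [CommRing R] {A B x y : R} (h : y ^ 2 = x ^ 3 + A * x + B)
    {n m : ℕ} (hn : 1 ≤ n) (hnm : n < m) :
    psi A B x y (m + n) * psi A B x y (m - n) =
      psi A B x y (m + 1) * psi A B x y (m - 1) * psi A B x y n ^ 2 -
      psi A B x y (n + 1) * psi A B x y (n - 1) * psi A B x y m ^ 2 := by
  classical
  -- the universal point, with coefficient `A` and coordinates `x`, `y` indeterminates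
  let U := MvPolynomial (Fin 3) ℤ
  let a : U := MvPolynomial.X 0
  let s : U := MvPolynomial.X 1
  let t : U := MvPolynomial.X 2
  let b : U := t ^ 2 - s ^ 3 - a * s
  have key : psi a b s t (m + n) * psi a b s t (m - n) =
      psi a b s t (m + 1) * psi a b s t (m - 1) * psi a b s t n ^ 2 -
      psi a b s t (n + 1) * psi a b s t (n - 1) * psi a b s t m ^ 2 := by
    let K := FractionRing U
    let f : U →+* K := algebraMap U K
    have hf : Function.Injective f := IsFractionRing.injective U K
    have hpsi : ∀ j : ℕ, 1 ≤ j → psi (f a) (f b) (f s) (f t) j ≠ 0 := by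
      intro j hj h0
      rw [← map_psi, map_eq_zero_iff f hf] at h0
      -- A zero would persist under specialisation to the point (1, 1) of y² = x³, where the value
      -- is j.
      have h1 := congrArg (MvPolynomial.eval ![(0 : ℤ), 1, 1]) h0
      rw [map_psi, map_zero] at h1
      have h2 := psi_cusp j
      have : psi (MvPolynomial.eval ![(0 : ℤ), 1, 1] a) (MvPolynomial.eval ![(0 : ℤ), 1, 1] b)
        (MvPolynomial.eval ![(0 : ℤ), 1, 1] s) (MvPolynomial.eval ![(0 : ℤ), 1, 1] t) j =
        psi (0 : ℤ) 0 1 1 j := by simp [a, b, s, t]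
      rw [this, h2] at h1
      omega
    have hK2 : (2 : K) ≠ 0 := two_ne_zero
    have ht : f t ≠ 0 := by
      rw [Ne, map_eq_zero_iff f hf]
      exact MvPolynomial.X_ne_zero 2
    have heq : f t ^ 2 = f s ^ 3 + f a * f s + f b := by
      simp only [b, map_sub, map_mul, map_pow]; ring
    have := psi_relation_of_ne_zero (A := f a) (B := f b)
      (P := .some (f s) (f t) (nonsingular_of_ne_zero hK2 heq ht)) hK2
      (Affine.Point.some_ne_zero _) ht hpsi hn hnm
    apply hf
    simp only [map_sub, map_mul, map_pow, map_psi]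
    exact this
  -- The universal identity has integer coefficients, so it specialises to any commutative ring.
  have := congrArg (MvPolynomial.eval₂Hom (Int.castRingHom R) ![A, x, y]) key
  simp only [map_sub, map_mul, map_pow, map_psi] at this
  have hb : B = y ^ 2 - x ^ 3 - A * x := by rw [h]; ring
  rw [hb]
  simpa only [a, b, s, t, map_sub, map_mul, map_pow, MvPolynomial.coe_eval₂Hom,
    MvPolynomial.eval₂_X, Matrix.cons_val] using this

section Zeros

variable {F : Type*} [Field F] {A B x y : F}

/-- For N = 2 a double vanishing would make the point singular, and for N = 3 it would force 2y = 0.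
For N ≥ 4 the relation with m = N - 1 and n = 2 would give ψ₃ψ_{N-1}² = 0, against the minimality of
N. -/
theorem psi_succ_ne_zero (h2 : (2 : F) ≠ 0) (h : (shortCurve A B).toAffine.Nonsingular x y)
    {N : ℕ} (hN2 : 2 ≤ N) (hN : psi A B x y N = 0)
    (hlt : ∀ j : ℕ, 1 ≤ j → j < N → psi A B x y j ≠ 0) : psi A B x y (N + 1) ≠ 0 := by
  have heq := equation_iff.1 h.1
  have w1 : psi A B x y 1 = 1 := normEDS_one ..
  have w2 : psi A B x y 2 = 2 * y := normEDS_two ..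
  have w3 : psi A B x y 3 = psiThree A B x := normEDS_three ..
  have w4 : psi A B x y 4 = psiFour A B x * (2 * y) := normEDS_four ..
  obtain rfl | rfl | hN4 : N = 2 ∨ N = 3 ∨ 4 ≤ N := by omega
  · push_cast at hN ⊢
    rw [w2] at hN
    have hy : y = 0 := by simpa [h2] using hN
    subst hy
    have hns := (Affine.nonsingular_iff _ _).1 h
    have h3 : 3 * x ^ 2 + A ≠ 0 := by
      intro h0
      rcases hns.2 with h' | h'
      · apply h'
        simp only [shortCurve]
        linear_combination -h0
      · simp [shortCurve] at h'
    rw [w3]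
    have : psiThree A B x = -(3 * x ^ 2 + A) ^ 2 := by
      rw [psiThree]
      linear_combination (-12 * x) * heq
    rw [this]
    exact neg_ne_zero.2 (pow_ne_zero 2 h3)
  · push_cast at hN ⊢
    have hy := hlt 2 (by omega) (by omega)
    push_cast at hy
    rw [w2] at hy
    rw [w3] at hN
    rw [w4, psiFour_eq heq, hN]
    simpa using hy
  · intro h0
    have e := psi_relation heq (n := 2) (m := N - 1) (by omega) (by omega)
    have h5 := hlt (N - 1) (by omega) (by omega)
    have h3 := hlt 3 (by omega) (by omega)
    push_cast [show 1 ≤ N by omega] at e h5 h3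
    rw [show (N : ℤ) - 1 + 2 = N + 1 by ring, show (N : ℤ) - 1 + 1 = N by ring, h0, hN,
      w1] at e
    apply mul_ne_zero h3 (pow_ne_zero 2 h5)
    linear_combination e

/-- In the relation between N and i the terms with ψ_N drop out. A zero at N + i then gives
ψ_{N+1}ψ_{N-1}ψ_i² = 0, hence a zero at i, and one descends by steps of N. -/
theorem dvd_of_psi_eq_zero (h2 : (2 : F) ≠ 0) (h : (shortCurve A B).toAffine.Nonsingular x y)
    {N : ℕ} (hN2 : 2 ≤ N) (hN : psi A B x y N = 0)
    (hlt : ∀ j : ℕ, 1 ≤ j → j < N → psi A B x y j ≠ 0) (m : ℕ) (hm : psi A B x y m = 0) :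
    N ∣ m := by
  have heq := equation_iff.1 h.1
  have hs := psi_succ_ne_zero h2 h hN2 hN hlt
  have hp := hlt (N - 1) (by omega) (by omega)
  push_cast [show 1 ≤ N by omega] at hp
  induction m using Nat.strong_induction_on with
  | _ m ih =>
    rcases Nat.eq_zero_or_pos m with rfl | hm0
    · exact dvd_zero N
    rcases Nat.lt_or_ge m N with hmN | hmN
    · exact absurd hm (hlt m hm0 hmN)
    obtain ⟨i, rfl⟩ := Nat.exists_eq_add_of_le hmN
    rw [Nat.dvd_add_right (dvd_refl N)]
    have hi : psi A B x y i = 0 := by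
      push_cast at hm
      rcases Nat.eq_zero_or_pos i with rfl | hi0
      · exact normEDS_zero ..
      rcases Nat.lt_trichotomy i N with hiN | rfl | hiN
      · have e := psi_relation heq hi0 hiN
        rw [hm, hN] at e
        have : psi A B x y (N + 1) * psi A B x y (N - 1) * psi A B x y i ^ 2 = 0 := by
          linear_combination -e
        simpa [hs, hp] using this
      · exact hN
      · have e := psi_relation heq (by omega) hiN
        rw [add_comm (i : ℤ), hm, hN] at e
        have : psi A B x y (N + 1) * psi A B x y (N - 1) * psi A B x y i ^ 2 = 0 := by
          linear_combination e
        simpa [hs, hp] using this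
    exact ih i (by omega) hi

end Zeros

end ShortCurve

end EllipticRelation

/-! ### The `p`-torsion of a short Weierstrass curve -/

section Torsion

open WeierstrassCurve

namespace ShortCurve

section Criterion

variable {F : Type*} [Field F] {A B : F} {P : (shortCurve A B).toAffine.Point}

theorem nonsingular_coord (hP : P ≠ 0) : (shortCurve A B).toAffine.Nonsingular (xc P) (yc P) := by
  rcases P with _ | ⟨x, y, h⟩
  · exact absurd rfl hP
  · exact h

variable [DecidableEq F]

theorem two_nsmul_eq_zero (hP : P ≠ 0) (hy : yc P = 0) : 2 • P = 0 := by
  rcases P with _ | ⟨x, y, h⟩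
  · exact absurd rfl hP
  change y = 0 at hy
  rw [two_smul]
  exact Affine.Point.add_self_of_Y_eq (by rw [negY_eq, hy, neg_zero])

/-- The multiplication formula for N - 1 gives x((N - 1)P) = x(P), so (N - 1)P = ±P. The plus sign
would mean (N - 2)P = 0, which the formula for N - 2 excludes. -/
theorem nsmul_eq_zero_of_first_zero (h2 : (2 : F) ≠ 0) (hP : P ≠ 0) {N : ℕ} (hN2 : 2 ≤ N)
    (hN : psi A B (xc P) (yc P) N = 0)
    (hlt : ∀ j : ℕ, 1 ≤ j → j < N → psi A B (xc P) (yc P) j ≠ 0) : N • P = 0 := by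
  have w2 : psi A B (xc P) (yc P) 2 = 2 * yc P := normEDS_two ..
  by_cases hy : yc P = 0
  · have : N = 2 := by
      by_contra hne
      have := hlt 2 (by omega) (by omega)
      push_cast at this
      rw [w2, hy, mul_zero] at this
      exact this rfl
    rw [this]
    exact two_nsmul_eq_zero hP hy
  have hN3 : N ≠ 2 := by
    rintro rfl
    push_cast at hN
    rw [w2] at hN
    exact mul_ne_zero h2 hy hN
  have hX : ∀ j, 1 ≤ j → j < N → MulFormula P j := fun j hj hjN =>
    mulFormula_of_psi_ne_zero h2 hP hy j hj fun i hi hij => hlt i hi (by omega)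
  have h1 := hX (N - 1) (by omega) (by omega)
  have h3 := (hX (N - 2) (by omega) (by omega)).1
  have h4 := h1.2
  have h5 := hlt (N - 1) (by omega) (by omega)
  push_cast [show 1 ≤ N by omega] at h4 h5
  rw [sub_add_cancel, hN, zero_mul] at h4
  have h6 : xc ((N - 1) • P) = xc P := by
    have := (mul_eq_zero.1 h4).resolve_right (pow_ne_zero 2 h5)
    exact (sub_eq_zero.1 this).symm
  rcases (xc_eq_iff h1.1 hP).1 h6 with h | h
  · exfalso
    apply h3
    have : (N - 2) • P + P = (N - 1) • P := by rw [← succ_nsmul]; congr 1; omega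
    rw [h] at this
    exact add_eq_right.1 this
  · have : N • P = (N - 1) • P + P := by rw [← succ_nsmul]; congr 1; omega
    rw [this, h, neg_add_cancel]

/-- A nonzero point is killed by the prime `p` iff the `p`-th division polynomial vanishes at it. -/
theorem nsmul_eq_zero_iff_psi (h2 : (2 : F) ≠ 0) {p : ℕ} (hp : p.Prime) (hP : P ≠ 0) :
    p • P = 0 ↔ psi A B (xc P) (yc P) p = 0 := by
  classical
  have w1 : psi A B (xc P) (yc P) 1 = 1 := normEDS_one ..
  have w2 : psi A B (xc P) (yc P) 2 = 2 * yc P := normEDS_two ..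
  -- The index N of the first zero satisfies NP = 0. In both directions below N = p: either p, the
  -- order of P, divides N ≤ p, or N ≥ 2 divides the prime p.
  have hex : ∀ h : ∃ j : ℕ, 1 ≤ j ∧ j ≤ p ∧ psi A B (xc P) (yc P) j = 0,
      ∃ N : ℕ, 2 ≤ N ∧ N ≤ p ∧ psi A B (xc P) (yc P) N = 0 ∧ N • P = 0 ∧
        ∀ j : ℕ, 1 ≤ j → j < N → psi A B (xc P) (yc P) j ≠ 0 := by
    intro h
    obtain ⟨h1, hle, h0⟩ := Nat.find_spec h
    have hlt : ∀ j : ℕ, 1 ≤ j → j < Nat.find h → psi A B (xc P) (yc P) j ≠ 0 :=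
      fun j hj hjN hj0 => Nat.find_min h hjN ⟨hj, by omega, hj0⟩
    have hN2 : 2 ≤ Nat.find h := by
      rcases Nat.lt_or_ge (Nat.find h) 2 with h' | h'
      · rw [show Nat.find h = 1 by omega, Nat.cast_one, w1] at h0
        exact absurd h0 one_ne_zero
      · exact h'
    exact ⟨Nat.find h, hN2, hle, h0, nsmul_eq_zero_of_first_zero h2 hP hN2 h0 hlt, hlt⟩
  constructor
  · intro h
    have hz : ∃ j : ℕ, 1 ≤ j ∧ j ≤ p ∧ psi A B (xc P) (yc P) j = 0 := by
      by_contra! hne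
      have hy : yc P ≠ 0 := by
        intro hy
        apply hne 2 (by omega) hp.two_le
        push_cast
        rw [w2, hy, mul_zero]
      exact (mulFormula_of_psi_ne_zero h2 hP hy p hp.one_le hne).1 h
    obtain ⟨N, hN2, hNp, h0, hNP, -⟩ := hex hz
    have : Fact p.Prime := ⟨hp⟩
    have hord := addOrderOf_eq_prime h hP
    have hdvd := addOrderOf_dvd_of_nsmul_eq_zero hNP
    rw [hord] at hdvd
    rwa [le_antisymm (Nat.le_of_dvd (by omega) hdvd) hNp]
  · intro h
    obtain ⟨N, hN2, hNp, h0, hNP, hlt⟩ := hex ⟨p, hp.one_le, le_rfl, h⟩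
    have hdvd := dvd_of_psi_eq_zero h2 (nonsingular_coord hP) hN2 h0 hlt p h
    rcases (Nat.dvd_prime hp).1 hdvd with h' | h'
    · omega
    · rwa [← h']

end Criterion

section Count

variable {F : Type*} [Field F] {A B : F}

/-- For odd index the division polynomial involves y only through powers of (2y)⁴, which on the
curve is the square of `Ψ₂Sq`. -/
theorem eval_preΨ' {p : ℕ} (hp : Odd p) {x y : F} (h : y ^ 2 = x ^ 3 + A * x + B) :
    ((shortCurve A B).preΨ' p).eval x = psi A B x y p := by
  rw [psi, normEDS_ofNat, if_neg (Nat.not_even_iff_odd.2 hp), mul_one, preΨ', ← Polynomial.coe_evalRingHom,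
    map_preNormEDS']
  congr 1
  · simp only [Ψ₂Sq, b₂, b₄, b₆, shortCurve, Polynomial.coe_evalRingHom]
    simp
    linear_combination (-16 * (x ^ 3 + A * x + B + y ^ 2)) * h
  · simp only [Ψ₃, b₂, b₄, b₆, b₈, shortCurve, Polynomial.coe_evalRingHom, psiThree]
    simp
    ring
  · simp only [preΨ₄, b₂, b₄, b₆, b₈, shortCurve, Polynomial.coe_evalRingHom, psiFour]
    simp
    ring

variable [DecidableEq F] (A B)

/-- The abscissae of the nonzero torsion points are roots of a polynomial of degree (p² - 1)/2, and
each belongs to at most the two points ±Q. -/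
theorem torsion_finite_and_card_le (h2 : (2 : F) ≠ 0) {p : ℕ} (hp : p.Prime) (hp2 : p ≠ 2)
    (hpF : (p : F) ≠ 0) :
    {P : (shortCurve A B).toAffine.Point | p • P = 0}.Finite ∧
      {P : (shortCurve A B).toAffine.Point | p • P = 0}.ncard ≤ p ^ 2 := by
  classical
  have hodd := hp.odd_of_ne_two hp2
  set f := (shortCurve A B).preΨ' p with hf
  have hf0 : f ≠ 0 := preΨ'_ne_zero _ hpF
  have hdeg : f.natDegree = (p ^ 2 - 1) / 2 := by
    rw [hf, natDegree_preΨ' _ hpF, if_neg (Nat.not_even_iff_odd.2 hodd)]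
  set S := {P : (shortCurve A B).toAffine.Point | p • P = 0 ∧ P ≠ 0} with hS
  have himg : xc '' S ⊆ f.roots.toFinset := by
    rintro _ ⟨P, ⟨hpP, hP⟩, rfl⟩
    rw [Finset.mem_coe, Multiset.mem_toFinset, Polynomial.mem_roots hf0, Polynomial.IsRoot,
      hf, eval_preΨ' hodd (yc_sq hP)]
    exact (nsmul_eq_zero_iff_psi h2 hp hP).1 hpP
  have hfib : ∀ Q ∈ S, S ∩ xc ⁻¹' {xc Q} ⊆ ({Q, -Q} : Finset _) := by
    rintro Q ⟨-, hQ⟩ P ⟨⟨-, hP⟩, hPQ⟩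
    simpa using (xc_eq_iff hP hQ).1 hPQ
  have hfin : S.Finite := by
    refine Set.Finite.of_finite_fibers xc ((Finset.finite_toSet _).subset himg) ?_
    rintro _ ⟨Q, hQ, rfl⟩
    exact (Finset.finite_toSet _).subset (hfib Q hQ)
  have hcard : S.ncard ≤ 2 * ((p ^ 2 - 1) / 2) := by
    rw [Set.ncard_eq_toFinset_card _ hfin]
    refine (Finset.card_le_mul_card_image (f := xc) hfin.toFinset 2 ?_).trans ?_
    · intro a ha
      obtain ⟨Q, hQ, rfl⟩ := Finset.mem_image.1 ha
      rw [Set.Finite.mem_toFinset] at hQ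
      refine (Finset.card_le_card (t := {Q, -Q}) ?_).trans Finset.card_le_two
      intro P hP
      rw [Finset.mem_filter, Set.Finite.mem_toFinset] at hP
      exact hfib Q hQ ⟨hP.1, hP.2⟩
    · refine Nat.mul_le_mul_left 2 ?_
      rw [← hdeg]
      refine (Finset.card_le_card (t := f.roots.toFinset) ?_).trans
        ((Multiset.toFinset_card_le _).trans f.card_roots')
      intro a ha
      obtain ⟨Q, hQ, rfl⟩ := Finset.mem_image.1 ha
      rw [Set.Finite.mem_toFinset] at hQ
      exact himg ⟨Q, hQ, rfl⟩
  have heq : {P : (shortCurve A B).toAffine.Point | p • P = 0} = insert 0 S := by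
    ext P
    by_cases hP : P = 0 <;> simp [hS, hP]
  rw [heq]
  refine ⟨hfin.insert 0, (Set.ncard_insert_le 0 S).trans ?_⟩
  have : 1 ≤ p ^ 2 := Nat.one_le_pow _ _ hp.pos
  omega

/-- Over an algebraically closed field the division polynomial has a root x, and the equation of the
curve can be solved for y. -/
theorem exists_torsion_ne_zero [IsAlgClosed F] (hΔ : (shortCurve A B).IsElliptic)
    (h2 : (2 : F) ≠ 0) {p : ℕ} (hp : p.Prime) (hp2 : p ≠ 2) (hpF : (p : F) ≠ 0) :
    ∃ P : (shortCurve A B).toAffine.Point, p • P = 0 ∧ P ≠ 0 := by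
  have hp3 : 2 < p := lt_of_le_of_ne hp.two_le hp2.symm
  obtain ⟨x, hx⟩ := IsAlgClosed.exists_root ((shortCurve A B).preΨ' p) (by
    rw [Polynomial.degree_eq_natDegree (preΨ'_ne_zero _ hpF)]
    exact_mod_cast (natDegree_preΨ'_pos _ hp3 hpF).ne')
  obtain ⟨y, hy⟩ := IsAlgClosed.exists_pow_nat_eq (x ^ 3 + A * x + B) two_pos
  have hns : (shortCurve A B).toAffine.Nonsingular x y :=
    Affine.equation_iff_nonsingular.1 (equation_iff.2 hy)
  refine ⟨.some x y hns, ?_, Affine.Point.some_ne_zero hns⟩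
  rw [nsmul_eq_zero_iff_psi h2 hp (Affine.Point.some_ne_zero hns)]
  rw [Polynomial.IsRoot, eval_preΨ' (hp.odd_of_ne_two hp2) hy] at hx
  exact hx

end Count

end ShortCurve

end Torsion

/-! ### Cyclic arrangements that are a single orbit of a permutation -/

section OrbitCycle

variable {α : Type*}

/-- `c` lists all of `α` without repetition in such a way that `σ` maps each entry to the next. -/
def IsOrbitCycle (c : Cycle α) (σ : Equiv.Perm α) : Prop :=
  ∃ l : List α, (l : Cycle α) = c ∧ l.Nodup ∧ (∀ P, P ∈ l) ∧ l.IsChain (fun P Q => σ P = Q)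

namespace IsOrbitCycle

variable {c c' : Cycle α} {σ τ g : Equiv.Perm α}

/-- The chain condition says nothing about the image of the last entry. It must be the first one,
since every other entry is already the image of its predecessor. -/
theorem exists_formPerm_eq [DecidableEq α] (h : IsOrbitCycle c σ) :
    ∃ hc : c.Nodup, c.formPerm hc = σ := by
  obtain ⟨l, rfl, hl, hall, hch⟩ := h
  rw [List.isChain_iff_getElem] at hch
  refine ⟨hl, ?_⟩
  rw [Cycle.formPerm_coe]
  ext x
  obtain ⟨i, hi, rfl⟩ := List.mem_iff_getElem.1 (hall x)
  rw [List.formPerm_apply_getElem _ hl]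
  rcases Nat.lt_or_ge (i + 1) l.length with h1 | h1
  · simp only [Nat.mod_eq_of_lt h1]
    exact (hch i h1).symm
  · obtain rfl : i = l.length - 1 := by omega
    have h2 : l.length - 1 + 1 = l.length := by omega
    simp only [h2, Nat.mod_self]
    obtain ⟨j, hj, hj'⟩ := List.mem_iff_getElem.1 (hall (σ l[l.length - 1]))
    rw [← hj']
    rcases Nat.eq_zero_or_pos j with rfl | hj0
    · rfl
    · exfalso
      have h3 := hch (j - 1) (by omega)
      simp only [Nat.sub_add_cancel hj0] at h3
      rw [hj'] at h3
      have h4 := (List.Nodup.getElem_inj_iff hl).1 (σ.injective h3)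
      omega

theorem perm_unique (h : IsOrbitCycle c σ) (h' : IsOrbitCycle c τ) : σ = τ := by
  classical
  obtain ⟨_, rfl⟩ := h.exists_formPerm_eq
  obtain ⟨_, rfl⟩ := h'.exists_formPerm_eq
  rfl

/-- A permutation determines its cyclic list except when the list has length at most one, which
cannot exhaust a set with two elements. -/
theorem cycle_unique [Nontrivial α] (h : IsOrbitCycle c σ) (h' : IsOrbitCycle c' σ) : c = c' := by
  classical
  obtain ⟨hc, e⟩ := h.exists_formPerm_eq
  obtain ⟨hc', e'⟩ := h'.exists_formPerm_eq
  rcases Cycle.formPerm_eq_formPerm_iff.1 (e.trans e'.symm) with h1 | ⟨h1, -⟩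
  · exact h1
  · exfalso
    obtain ⟨l, rfl, hl, hall, hch⟩ := h
    rw [Cycle.length_subsingleton_iff, Cycle.length_coe] at h1
    obtain ⟨x, y, hxy⟩ := exists_pair_ne α
    have hx := hall x
    have hy := hall y
    match l, h1 with
    | [], _ => simp at hx
    | [a], _ =>
      simp only [List.mem_singleton] at hx hy
      exact hxy (hx.trans hy.symm)

theorem map (h : IsOrbitCycle c σ) (g : Equiv.Perm α) : IsOrbitCycle (c.map g) (g * σ * g⁻¹) := by
  obtain ⟨l, rfl, hl, hall, hch⟩ := h
  refine ⟨l.map g, rfl, hl.map g.injective, fun P => ?_, ?_⟩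
  · exact List.mem_map.2 ⟨g⁻¹ P, hall _, by simp⟩
  · rw [List.isChain_map]
    refine hch.imp ?_
    rintro P Q rfl
    simp

theorem reverse (h : IsOrbitCycle c σ) : IsOrbitCycle c.reverse σ⁻¹ := by
  obtain ⟨l, rfl, hl, hall, hch⟩ := h
  refine ⟨l.reverse, by simp, by simpa using hl, by simpa using hall, ?_⟩
  rw [List.isChain_reverse]
  refine hch.imp ?_
  rintro P Q rfl
  simp

theorem exists_pow_apply (h : IsOrbitCycle c σ) (x y : α) : ∃ k : ℤ, (σ ^ k) x = y := by
  obtain ⟨l, rfl, hl, hall, hch⟩ := h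
  rw [List.isChain_iff_getElem] at hch
  have hl0 : 0 < l.length := List.length_pos_of_mem (hall x)
  have key : ∀ i (hi : i < l.length), (σ ^ i) l[0] = l[i] := by
    intro i
    induction i with
    | zero => intro _; rfl
    | succ i ih =>
      intro hi
      rw [pow_succ', Equiv.Perm.mul_apply, ih (by omega)]
      exact hch i hi
  obtain ⟨i, hi, rfl⟩ := List.mem_iff_getElem.1 (hall x)
  obtain ⟨j, hj, rfl⟩ := List.mem_iff_getElem.1 (hall y)
  refine ⟨(j : ℤ) - i, ?_⟩
  rw [← key i hi, ← key j hj, ← zpow_natCast, ← Equiv.Perm.mul_apply, ← zpow_add,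
    sub_add_cancel, zpow_natCast]

/-- A permutation that commutes with a transitive one is a power of it. -/
theorem eq_zpow_of_commute [Nonempty α] (h : IsOrbitCycle c σ) (hg : Commute g σ) :
    ∃ k : ℤ, g = σ ^ k := by
  obtain ⟨x⟩ := ‹Nonempty α›
  obtain ⟨k, hk⟩ := h.exists_pow_apply x (g x)
  refine ⟨k, Equiv.ext fun y => ?_⟩
  obtain ⟨j, rfl⟩ := h.exists_pow_apply x y
  have h1 : g * σ ^ j = σ ^ j * g := (hg.zpow_right j)
  rw [← Equiv.Perm.mul_apply, h1, Equiv.Perm.mul_apply, ← hk, ← Equiv.Perm.mul_apply,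
    ← Equiv.Perm.mul_apply, ← zpow_add, ← zpow_add, add_comm]

/-- Arrangement and permutation determine each other, and g carries (c, σ) to (g c, gσg⁻¹). -/
theorem map_eq_iff [Nontrivial α] (h : IsOrbitCycle c σ) : c.map g = c ↔ Commute g σ := by
  constructor
  · intro hc
    have h1 := h.map g
    rw [hc] at h1
    have h2 := h1.perm_unique h
    exact mul_inv_eq_iff_eq_mul.1 h2
  · intro hg
    have h1 := h.map g
    rw [show g * σ = σ * g from hg, mul_inv_cancel_right] at h1
    exact h1.cycle_unique h

theorem exists_of_transitive [Finite α] [Nontrivial α] (h : ∀ x y, ∃ k : ℤ, (σ ^ k) x = y) :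
    ∃ c, IsOrbitCycle c σ := by
  classical
  have := Fintype.ofFinite α
  obtain ⟨x, y, hxy⟩ := exists_pair_ne α
  have hx : x ∈ σ.support := by
    rw [Equiv.Perm.mem_support]
    intro hx
    obtain ⟨k, hk⟩ := h x y
    exact hxy ((Equiv.Perm.zpow_apply_eq_self_of_apply_eq_self hx k).symm.trans hk)
  refine ⟨_, σ.toList x, rfl, σ.nodup_toList x, fun y => ?_, ?_⟩
  · rw [Equiv.Perm.mem_toList_iff]
    exact ⟨h x y, hx⟩
  · rw [List.isChain_iff_getElem]
    intro i hi
    rw [Equiv.Perm.getElem_toList, Equiv.Perm.getElem_toList, pow_succ', Equiv.Perm.mul_apply]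

end IsOrbitCycle

end OrbitCycle

/-! ### Necklaces as orbits of elements of PGL(V). -/

section NecklaceOrbit

variable {K V : Type*} [Field K] [AddCommGroup V] [Module K V]

theorem isOrientedNecklace_iff {f : Polynomial K} {c : Cycle (Projectivization K V)} :
    IsOrientedNecklace f c ↔ ∃ h ∈ charpolyClass V f, IsOrbitCycle c (PGL.toPerm K V h) := by
  constructor
  · rintro ⟨l, rfl, hl, hall, h, hh, hch⟩
    exact ⟨h, hh, l, rfl, hl, hall, hch⟩
  · rintro ⟨h, hh, l, rfl, hl, hall, hch⟩
    exact ⟨l, rfl, hl, hall, h, hh, hch⟩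

theorem PGL.toPerm_mk_mk (g : LinearMap.GeneralLinearGroup K V) {v : V} (hv : v ≠ 0)
    (hgv : (g : Module.End K V) v ≠ 0) :
    PGL.toPerm K V (g : PGL K V) (Projectivization.mk K v hv) =
      Projectivization.mk K ((g : Module.End K V) v) hgv := rfl

theorem PGL.mk_eq_one_iff (g : LinearMap.GeneralLinearGroup K V) :
    (g : PGL K V) = 1 ↔ ∃ c : Kˣ, (g : Module.End K V) = algebraMap K (Module.End K V) c := by
  rw [QuotientGroup.eq_one_iff]
  constructor
  · rintro ⟨c, rfl⟩
    exact ⟨c, rfl⟩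
  · rintro ⟨c, hc⟩
    exact ⟨c, Units.ext hc.symm⟩

theorem generalLinearGroup_apply_ne_zero (g : LinearMap.GeneralLinearGroup K V) {v : V}
    (hv : v ≠ 0) : (g : Module.End K V) v ≠ 0 := by
  intro h
  apply hv
  have : ((g⁻¹ * g : LinearMap.GeneralLinearGroup K V) : Module.End K V) v = 0 := by
    rw [Units.val_mul, Module.End.mul_apply, h, map_zero]
  rwa [inv_mul_cancel] at this

/-- If v and g v are proportional for every v, then g is a scalar. -/
theorem PGL.toPerm_injective : Function.Injective (PGL.toPerm K V) := by
  rw [injective_iff_map_eq_one]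
  intro h
  induction h using QuotientGroup.induction_on with
  | H g =>
    intro h1
    have key : ∀ v : V, ¬LinearIndependent K ![v, (g : Module.End K V) v] := by
      intro v hli
      have hv : v ≠ 0 := hli.ne_zero 0
      have h2 := Equiv.congr_fun h1 (Projectivization.mk K v hv)
      rw [PGL.toPerm_mk_mk g hv (generalLinearGroup_apply_ne_zero g hv), Equiv.Perm.coe_one, id,
        Projectivization.mk_eq_mk_iff'] at h2
      obtain ⟨a, ha⟩ := h2
      rw [LinearIndependent.pair_iff] at hli
      have := (hli a (-1) (by rw [ha]; simp)).2
      simp at this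
    obtain ⟨a, ha⟩ := LinearMap.exists_eq_smul_id_of_forall_notLinearIndependent key
    rw [PGL.mk_eq_one_iff]
    by_cases ha0 : a = 0
    · have hV : Subsingleton V := by
        refine ⟨fun x y => ?_⟩
        by_contra hxy
        apply generalLinearGroup_apply_ne_zero g (sub_ne_zero.2 hxy)
        rw [ha, ha0]
        simp
      exact ⟨1, Subsingleton.elim _ _⟩
    · refine ⟨Units.mk0 a ha0, ?_⟩
      rw [ha]
      ext v
      simp [Algebra.algebraMap_eq_smul_one]

/-- An element of `PGL(V)` that maps an oriented necklace to itself and has a fixed point in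
`ℙ(V)` is trivial. -/
theorem PGL.eq_one_of_map_eq {f : Polynomial K} {c : Cycle (Projectivization K V)}
    (hc : IsOrientedNecklace f c) [Nontrivial (Projectivization K V)] {g : PGL K V}
    (hg : c.map (PGL.toPerm K V g) = c) {x : Projectivization K V} (hx : PGL.toPerm K V g x = x) :
    g = 1 := by
  obtain ⟨h, -, ho⟩ := isOrientedNecklace_iff.1 hc
  have hcomm := ho.map_eq_iff.1 hg
  apply PGL.toPerm_injective
  rw [map_one]
  ext y
  obtain ⟨k, rfl⟩ := ho.exists_pow_apply x y
  have h1 : PGL.toPerm K V g * PGL.toPerm K V h ^ k = PGL.toPerm K V h ^ k * PGL.toPerm K V g :=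
    hcomm.zpow_right k
  rw [← Equiv.Perm.mul_apply, h1, Equiv.Perm.mul_apply, hx]
  rfl

/-- If `g ∈ GL(V)` maps the necklace belonging to `h` to itself, then it commutes with every
representative of `h`. -/
theorem commute_of_map_eq [Nontrivial (Projectivization K V)] {c : Cycle (Projectivization K V)}
    {g h : LinearMap.GeneralLinearGroup K V} (ho : IsOrbitCycle c (PGL.toPerm K V (h : PGL K V)))
    (hg : c.map (PGL.toPerm K V (g : PGL K V)) = c) : Commute g h := by
  -- In PGL(V), g is a power of h. Hence in GL(V) it is that power times a scalar, and both factors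
  -- commute with h.
  obtain ⟨k, hk⟩ := ho.eq_zpow_of_commute (ho.map_eq_iff.1 hg)
  rw [← map_zpow] at hk
  have h1 := PGL.toPerm_injective hk
  have h2 : ((g * (h ^ k)⁻¹ : LinearMap.GeneralLinearGroup K V) : PGL K V) = 1 := by
    rw [QuotientGroup.mk_mul, QuotientGroup.mk_inv, h1, QuotientGroup.mk_zpow, mul_inv_cancel]
  obtain ⟨a, ha⟩ := (PGL.mk_eq_one_iff _).1 h2
  have h3 : Commute (g * (h ^ k)⁻¹) h := by
    apply Units.ext
    change ((g * (h ^ k)⁻¹ : LinearMap.GeneralLinearGroup K V) : Module.End K V) *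
      (h : Module.End K V) = (h : Module.End K V) *
      ((g * (h ^ k)⁻¹ : LinearMap.GeneralLinearGroup K V) : Module.End K V)
    rw [ha]
    exact Algebra.commutes _ _
  have h4 : g = g * (h ^ k)⁻¹ * h ^ k := by group
  rw [h4]
  exact h3.mul_left ((Commute.refl h).zpow_left k)

end NecklaceOrbit

/-! ### Embeddings of `𝔽_{p²}` into endomorphism rings -/

section FieldEmbedding

open Polynomial

variable {p : ℕ} [Fact p.Prime]

theorem mem_range_algebraMap_iff_pow_eq {x : GaloisField p 2} :
    x ∈ Set.range (algebraMap (ZMod p) (GaloisField p 2)) ↔ x ^ p = x := by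
  rw [← Subfield.mem_bot_iff_pow_eq_self (GaloisField p 2) p, ← ZMod.fieldRange_castHom_eq_bot p,
    RingHom.mem_fieldRange, Subsingleton.elim (ZMod.castHom _ (GaloisField p 2)) (algebraMap (ZMod p) (GaloisField p 2))]
  rfl

theorem finrank_galoisField_two : Module.finrank (ZMod p) (GaloisField p 2) = 2 := GaloisField.finrank p two_ne_zero

theorem pow_card_pow_card (x : GaloisField p 2) : (x ^ p) ^ p = x := by
  have := Fintype.ofFinite (GaloisField p 2)
  rw [← pow_mul, ← sq]
  have h := FiniteField.pow_card x
  rwa [← Nat.card_eq_fintype_card, GaloisField.card p 2 two_ne_zero] at h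

theorem linearIndependent_one_of_notMem {τ : GaloisField p 2} (hτ : τ ∉ Set.range (algebraMap (ZMod p) (GaloisField p 2))) :
    LinearIndependent (ZMod p) ![1, τ] := by
  rw [LinearIndependent.pair_iff]
  intro s t h
  have ht : t = 0 := by
    by_contra ht
    apply hτ
    refine ⟨-s / t, ?_⟩
    rw [Algebra.smul_def, Algebra.smul_def, mul_one] at h
    have ht' : algebraMap (ZMod p) (GaloisField p 2) t ≠ 0 := by simpa using ht
    rw [map_div₀, map_neg, div_eq_iff ht']
    linear_combination -h
  subst ht
  simpa using h

/-- The basis `1, τ` of `𝔽_{p²}`. -/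
noncomputable def basisOneOf {τ : GaloisField p 2} (hτ : τ ∉ Set.range (algebraMap (ZMod p) (GaloisField p 2))) :
    Module.Basis (Fin 2) (ZMod p) (GaloisField p 2) :=
  basisOfLinearIndependentOfCardEqFinrank (linearIndependent_one_of_notMem hτ)
    (by rw [finrank_galoisField_two, Fintype.card_fin])

theorem coe_basisOneOf {τ : GaloisField p 2} (hτ : τ ∉ Set.range (algebraMap (ZMod p) (GaloisField p 2))) :
    ⇑(basisOneOf hτ) = ![1, τ] :=
  coe_basisOfLinearIndependentOfCardEqFinrank _ _

theorem exists_eq_add_mul {τ : GaloisField p 2} (hτ : τ ∉ Set.range (algebraMap (ZMod p) (GaloisField p 2))) (x : GaloisField p 2) :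
    ∃ a b : ZMod p, x = algebraMap _ (GaloisField p 2) a + algebraMap _ (GaloisField p 2) b * τ := by
  have h := (basisOneOf hτ).sum_repr x
  rw [Fin.sum_univ_two, coe_basisOneOf] at h
  refine ⟨(basisOneOf hτ).repr x 0, (basisOneOf hτ).repr x 1, h.symm.trans ?_⟩
  simp only [Matrix.cons_val_zero, Matrix.cons_val_one, Algebra.smul_def, mul_one]

theorem natDegree_minpoly_eq_two {τ : GaloisField p 2} (hτ : τ ∉ Set.range (algebraMap (ZMod p) (GaloisField p 2))) :
    (minpoly (ZMod p) τ).natDegree = 2 := by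
  have hint : IsIntegral (ZMod p) τ := Algebra.IsIntegral.isIntegral τ
  refine le_antisymm ?_ ?_
  · exact (minpoly.natDegree_le τ).trans_eq finrank_galoisField_two
  · rwa [minpoly.two_le_natDegree_iff hint]

theorem aeval_pow_card {q : (ZMod p)[X]} {τ : GaloisField p 2} (h : aeval τ q = 0) : aeval (τ ^ p) q = 0 := by
  have := Polynomial.aeval_algHom_apply (FiniteField.frobeniusAlgHom (ZMod p) (GaloisField p 2)) τ q
  rw [h, map_zero] at this
  simpa [ZMod.card] using this

/-- A monic quadratic polynomial over `𝔽_p` with a root `τ` outside `𝔽_p` has the roots `τ` and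
`τ ^ p`. -/
theorem eq_or_eq_pow_of_aeval_eq_zero {q : (ZMod p)[X]} (hq : q ≠ 0) (hq2 : q.natDegree ≤ 2)
    {τ : GaloisField p 2} (hτ : τ ∉ Set.range (algebraMap (ZMod p) (GaloisField p 2))) (h : aeval τ q = 0) {x : GaloisField p 2}
    (hx : aeval x q = 0) : x = τ ∨ x = τ ^ p := by
  classical
  by_contra! hne
  have h1 : τ ^ p ≠ τ := fun h' => hτ (mem_range_algebraMap_iff_pow_eq.2 h')
  have hsub : ({τ, τ ^ p, x} : Finset (GaloisField p 2)) ⊆ (q.aroots (GaloisField p 2)).toFinset := by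
    intro y hy
    rw [Multiset.mem_toFinset, mem_aroots]
    simp only [Finset.mem_insert, Finset.mem_singleton] at hy
    rcases hy with rfl | rfl | rfl
    · exact ⟨hq, h⟩
    · exact ⟨hq, aeval_pow_card h⟩
    · exact ⟨hq, hx⟩
  have hc := Finset.card_le_card hsub
  rw [Finset.card_eq_three.2 ⟨τ, τ ^ p, x, h1.symm, hne.1.symm, hne.2.symm, rfl⟩] at hc
  have := (Multiset.toFinset_card_le _).trans (card_roots' (q.map (algebraMap (ZMod p) (GaloisField p 2))))
  rw [natDegree_map] at this
  rw [aroots] at hc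
  omega

section Generator

variable {γ : (GaloisField p 2)ˣ}

theorem orderOf_generator (hγ : ∀ x : (GaloisField p 2)ˣ, x ∈ Subgroup.zpowers γ) : orderOf γ = p ^ 2 - 1 := by
  rw [orderOf_eq_card_of_forall_mem_zpowers hγ, Nat.card_units, GaloisField.card p 2 two_ne_zero]

theorem mem_range_of_pow_card_sub_one {x : (GaloisField p 2)ˣ} :
    (x : GaloisField p 2) ∈ Set.range (algebraMap (ZMod p) (GaloisField p 2)) ↔ x ^ (p - 1) = 1 := by
  have hp : 1 ≤ p := (Fact.out : p.Prime).one_le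
  have : x ^ p = x ^ (p - 1) * x := by rw [← pow_succ, Nat.sub_add_cancel hp]
  rw [mem_range_algebraMap_iff_pow_eq, ← Units.val_pow_eq_pow_val, Units.val_inj, this,
    mul_eq_right]

/-- An element of 𝔽_{p²}ˣ lies in 𝔽_p exactly when its (p - 1)-st power is 1, while γ has order (p +
1)(p - 1). Only k = 1 and k = 2 are needed later. -/
theorem generator_pow_notMem (hγ : ∀ x : (GaloisField p 2)ˣ, x ∈ Subgroup.zpowers γ) {k : ℕ} (hk : 1 ≤ k)
    (hkp : k ≤ p) : ((γ ^ k : (GaloisField p 2)ˣ) : GaloisField p 2) ∉ Set.range (algebraMap (ZMod p) (GaloisField p 2)) := by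
  intro h
  have hp : 2 ≤ p := (Fact.out : p.Prime).two_le
  rw [mem_range_of_pow_card_sub_one, ← pow_mul] at h
  have h1 := orderOf_dvd_of_pow_eq_one h
  rw [orderOf_generator hγ] at h1
  have hpos : 0 < k * (p - 1) := Nat.mul_pos (by omega) (by omega)
  have h2 := Nat.le_of_dvd hpos h1
  obtain ⟨m, rfl⟩ : ∃ m, p = m + 1 := ⟨p - 1, by omega⟩
  have h3 : (m + 1) ^ 2 - 1 = (m + 2) * m := by
    rw [Nat.sub_eq_iff_eq_add (Nat.one_le_pow _ _ (by omega))]; ring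
  rw [h3, Nat.add_sub_cancel] at h2
  have := Nat.le_of_mul_le_mul_right h2 (by omega)
  omega

end Generator

variable {V : Type*} [AddCommGroup V] [Module (ZMod p) V] (ι : GaloisField p 2 →ₐ[ZMod p] Module.End (ZMod p) V)

theorem embedding_apply_ne_zero {a : GaloisField p 2} (ha : a ≠ 0) {v : V} (hv : v ≠ 0) : ι a v ≠ 0 := by
  intro h
  apply hv
  have : ι (a⁻¹ * a) v = 0 := by rw [map_mul, Module.End.mul_apply, h, map_zero]
  rwa [inv_mul_cancel₀ ha, map_one] at this

theorem embedding_injective [Nontrivial V] : Function.Injective ι := ι.toRingHom.injective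

/-- `a ↦ ι(a) v` as an isomorphism, for `v ≠ 0`. -/
theorem exists_orbitEquiv (hV : Module.finrank (ZMod p) V = 2) {v : V} (hv : v ≠ 0) :
    ∃ e : GaloisField p 2 ≃ₗ[ZMod p] V, ∀ a, e a = ι a v := by
  have : Module.Finite (ZMod p) V := Module.finite_of_finrank_eq_succ hV
  let f : GaloisField p 2 →ₗ[ZMod p] V := (LinearMap.applyₗ v).comp ι.toLinearMap
  have hf : Function.Injective f := by
    rw [injective_iff_map_eq_zero]
    intro a ha
    by_contra ha0
    exact embedding_apply_ne_zero ι ha0 hv ha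
  exact ⟨LinearMap.linearEquivOfInjective f hf (by rw [hV, finrank_galoisField_two]),
    fun a => rfl⟩

end FieldEmbedding

/-! ### Necklaces fixed by a generator of a copy of 𝔽_{p²}. -/

section FixedNecklaces

open Polynomial

variable {p : ℕ} [Fact p.Prime] {V : Type*} [AddCommGroup V] [Module (ZMod p) V]

/-- An endomorphism that satisfies an irreducible quadratic equation generates a copy of
`𝔽_{p²}`. -/
theorem exists_embedding {q : (ZMod p)[X]} (hq : q.Monic) (hq2 : q.natDegree = 2)
    (hirr : Irreducible q) {T : Module.End (ZMod p) V} (hT : aeval T q = 0) :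
    ∃ (ι : GaloisField p 2 →ₐ[ZMod p] Module.End (ZMod p) V) (τ : GaloisField p 2),
      τ ∉ Set.range (algebraMap (ZMod p) (GaloisField p 2)) ∧ ι τ = T ∧ aeval τ q = 0 := by
  have : Fact (Irreducible q) := ⟨hirr⟩
  let pb := AdjoinRoot.powerBasis hq.ne_zero
  have hpb : minpoly (ZMod p) pb.gen = q := AdjoinRoot.minpoly_powerBasis_gen_of_monic hq
  have hfr : Module.finrank (ZMod p) (AdjoinRoot q) = 2 := by
    rw [pb.finrank, AdjoinRoot.powerBasis_dim, hq2]
  have hcard : Nat.card (AdjoinRoot q) = p ^ 2 := by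
    have : Module.Finite (ZMod p) (AdjoinRoot q) := pb.finite
    rw [Module.natCard_eq_pow_finrank (K := ZMod p), hfr, Nat.card_zmod]
  let e := GaloisField.algEquivGaloisField p 2 hcard
  let f : AdjoinRoot q →ₐ[ZMod p] Module.End (ZMod p) V := pb.lift T (by rw [hpb, hT])
  have hroot : aeval (e pb.gen) q = 0 := by
    have h := Polynomial.aeval_algHom_apply (e : AdjoinRoot q →ₐ[ZMod p] GaloisField p 2) pb.gen q
    rw [AlgEquiv.coe_toAlgHom] at h
    have h0 : aeval pb.gen q = 0 := by
      have := minpoly.aeval (ZMod p) pb.gen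
      rwa [hpb] at this
    rw [h, h0]
    exact map_zero e
  refine ⟨f.comp e.symm, e pb.gen, ?_, ?_, hroot⟩
  · rintro ⟨c, hc⟩
    rw [← hc, Polynomial.aeval_algebraMap_apply, map_eq_zero] at hroot
    have h0 := (Polynomial.irreducible_iff_roots_eq_zero_of_degree_le_three hq2.ge
      (by omega)).1 hirr
    have : c ∈ q.roots := (Polynomial.mem_roots hq.ne_zero).2 (by
      rwa [Polynomial.IsRoot, ← Polynomial.coe_aeval_eq_eval])
    rw [h0] at this
    simp at this
  · simp only [AlgHom.comp_apply, AlgEquiv.coe_toAlgHom, AlgEquiv.symm_apply_apply]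
    exact pb.lift_gen T _

variable (ι : GaloisField p 2 →ₐ[ZMod p] Module.End (ZMod p) V)
  {τ : GaloisField p 2}

/-- What commutes with a generator of 𝔽_{p²} is 𝔽_{p²}-linear, and V is one-dimensional over 𝔽_{p²}.
-/
theorem exists_eq_embedding_of_commute (hV : Module.finrank (ZMod p) V = 2)
    (hτ : τ ∉ Set.range (algebraMap (ZMod p) (GaloisField p 2))) {h : Module.End (ZMod p) V}
    (hc : Commute h (ι τ)) : ∃ a, h = ι a := by
  have hall : ∀ x, Commute h (ι x) := by
    intro x
    obtain ⟨a, b, rfl⟩ := exists_eq_add_mul hτ x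
    rw [map_add, map_mul, AlgHom.commutes, AlgHom.commutes]
    exact Commute.add_right (Algebra.commutes a h).symm
      (Commute.mul_right (Algebra.commutes b h).symm hc)
  have : Nontrivial V := Module.nontrivial_of_finrank_pos (R := ZMod p) (by omega)
  obtain ⟨v, hv⟩ := exists_ne (0 : V)
  obtain ⟨e, he⟩ := exists_orbitEquiv ι hV hv
  refine ⟨e.symm (h v), LinearMap.ext fun w => ?_⟩
  obtain ⟨b, rfl⟩ := e.surjective w
  have h1 : ι (e.symm (h v)) v = h v := by rw [← he, LinearEquiv.apply_symm_apply]
  rw [he]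
  have h2 : h (ι b v) = ι b (h v) := LinearMap.congr_fun (hall b) v
  rw [h2]
  nth_rewrite 1 [← h1]
  rw [← Module.End.mul_apply, ← Module.End.mul_apply, ← map_mul, ← map_mul, mul_comm]

/-- The minimal polynomial divides the characteristic polynomial, and both are monic of degree two.
-/
theorem charpoly_embedding (hV : Module.finrank (ZMod p) V = 2)
    (hτ : τ ∉ Set.range (algebraMap (ZMod p) (GaloisField p 2)))
    (b : Module.Basis (Fin 2) (ZMod p) V) :
    (LinearMap.toMatrix b b (ι τ)).charpoly = minpoly (ZMod p) τ := by
  have : Module.Finite (ZMod p) V := Module.finite_of_finrank_eq_succ hV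
  have : Nontrivial V := Module.nontrivial_of_finrank_pos (R := ZMod p) (by omega)
  rw [LinearMap.charpoly_toMatrix]
  apply Polynomial.eq_of_monic_of_dvd_of_natDegree_le
  · exact minpoly.monic (Algebra.IsIntegral.isIntegral τ)
  · exact LinearMap.charpoly_monic _
  · rw [← minpoly.algHom_eq ι (embedding_injective ι)]
    exact LinearMap.minpoly_dvd_charpoly _
  · rw [LinearMap.charpoly_natDegree, hV, natDegree_minpoly_eq_two hτ]

theorem aeval_eq_zero_of_charpoly_eq {f : (ZMod p)[X]} {g : Module.End (ZMod p) V}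
    {b : Module.Basis (Fin 2) (ZMod p) V} (h : (LinearMap.toMatrix b b g).charpoly = f) :
    aeval g f = 0 := by
  have : Module.Finite (ZMod p) V := Module.Finite.of_basis b
  rw [LinearMap.charpoly_toMatrix] at h
  rw [← h]
  exact LinearMap.aeval_self_charpoly g

variable {γ : (GaloisField p 2)ˣ}

/-- The class in `PGL(V)` of an element of `𝔽_{p²}ˣ`. -/
noncomputable def embeddingPGL (a : (GaloisField p 2)ˣ) : PGL (ZMod p) V :=
  ((Units.map (ι : GaloisField p 2 →* Module.End (ZMod p) V) a :
    LinearMap.GeneralLinearGroup (ZMod p) V) : PGL (ZMod p) V)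

theorem embeddingPGL_mul (a b : (GaloisField p 2)ˣ) :
    embeddingPGL ι (a * b) = embeddingPGL ι a * embeddingPGL ι b := by
  rw [embeddingPGL, map_mul, QuotientGroup.mk_mul]
  rfl

theorem embeddingPGL_zpow (a : (GaloisField p 2)ˣ) (k : ℤ) :
    embeddingPGL ι (a ^ k) = embeddingPGL ι a ^ k := by
  rw [embeddingPGL, map_zpow, QuotientGroup.mk_zpow]
  rfl

theorem embeddingPGL_eq_one_iff [Nontrivial V] (a : (GaloisField p 2)ˣ) :
    embeddingPGL ι a = 1 ↔ (a : GaloisField p 2) ∈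
      Set.range (algebraMap (ZMod p) (GaloisField p 2)) := by
  rw [embeddingPGL, PGL.mk_eq_one_iff]
  constructor
  · rintro ⟨c, hc⟩
    refine ⟨c, embedding_injective ι ?_⟩
    rw [AlgHom.commutes]
    exact hc.symm
  · rintro ⟨c, hc⟩
    have hc0 : c ≠ 0 := by
      rintro rfl
      rw [map_zero] at hc
      exact a.ne_zero hc.symm
    refine ⟨Units.mk0 c hc0, ?_⟩
    change ι a = _
    rw [← hc, AlgHom.commutes]
    rfl

/-- The product a · a^p is the norm of a, which lies in 𝔽_p and so acts as a scalar. -/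
theorem embeddingPGL_pow_card [Nontrivial V] (a : (GaloisField p 2)ˣ) :
    embeddingPGL ι (a ^ p) = (embeddingPGL ι a)⁻¹ := by
  rw [eq_inv_iff_mul_eq_one, ← embeddingPGL_mul, embeddingPGL_eq_one_iff,
    mem_range_algebraMap_iff_pow_eq, Units.val_mul, Units.val_pow_eq_pow_val, mul_pow,
    pow_card_pow_card, mul_comm]

theorem nontrivial_projectivization (hV : Module.finrank (ZMod p) V = 2) :
    Finite (Projectivization (ZMod p) V) ∧ Nontrivial (Projectivization (ZMod p) V) := by
  have : Module.Finite (ZMod p) V := Module.finite_of_finrank_eq_succ hV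
  have : Finite V := Module.finite_of_finite (ZMod p)
  refine ⟨inferInstance, ?_⟩
  have h := Projectivization.card_of_finrank_two (ZMod p) V hV
  rw [← Finite.one_lt_card_iff_nontrivial, h, Nat.card_zmod]
  have := (Fact.out : p.Prime).pos
  omega

/-- The necklaces fixed by a generator of a copy of `𝔽_{p²}` are a `w`-orbit of length two. -/
theorem exists_fixed_necklaces (hV : Module.finrank (ZMod p) V = 2)
    (hγ : ∀ x : (GaloisField p 2)ˣ, x ∈ Subgroup.zpowers γ) (hp : 3 < p)
    {T : LinearMap.GeneralLinearGroup (ZMod p) V}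
    (hτ : τ ∉ Set.range (algebraMap (ZMod p) (GaloisField p 2)))
    (hT : (T : Module.End (ZMod p) V) = ι τ) :
    ∃ v₀ : OrientedNecklace V (minpolyOf p γ), v₀ ≠ v₀.w ∧
      ∀ v : OrientedNecklace V (minpolyOf p γ),
        v.1.map (PGL.toPerm (ZMod p) V (T : PGL (ZMod p) V)) = v.1 ↔ v = v₀ ∨ v = v₀.w := by
  have hfin : Module.Finite (ZMod p) V := Module.finite_of_finrank_eq_succ hV
  have hnt : Nontrivial V := Module.nontrivial_of_finrank_pos (R := ZMod p) (by omega)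
  obtain ⟨hPfin, hPnt⟩ := nontrivial_projectivization hV
  have hγF : (γ : GaloisField p 2) ∉ Set.range (algebraMap (ZMod p) (GaloisField p 2)) := by
    have := generator_pow_notMem hγ le_rfl (by omega)
    rwa [pow_one] at this
  -- The units of 𝔽_{p²} act transitively on the nonzero vectors of V, and γ generates them.
  have htrans : ∀ x y : Projectivization (ZMod p) V,
      ∃ k : ℤ, (PGL.toPerm (ZMod p) V (embeddingPGL ι γ) ^ k) x = y := by
    intro x y
    induction x using Projectivization.ind with
    | h v hv =>
    induction y using Projectivization.ind with
    | h w hw =>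
    obtain ⟨e, he⟩ := exists_orbitEquiv ι hV hv
    have ha : e.symm w ≠ 0 := by simpa using hw
    obtain ⟨k, hk⟩ := hγ (Units.mk0 _ ha)
    replace hk : γ ^ k = Units.mk0 _ ha := hk
    refine ⟨k, ?_⟩
    rw [← map_zpow, ← embeddingPGL_zpow, hk, embeddingPGL,
      PGL.toPerm_mk_mk _ hv (generalLinearGroup_apply_ne_zero _ hv)]
    congr 1
    change ι (e.symm w) v = w
    rw [← he, LinearEquiv.apply_symm_apply]
  obtain ⟨c, hc⟩ := IsOrbitCycle.exists_of_transitive htrans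
  have hclass : embeddingPGL ι γ ∈ charpolyClass V (minpolyOf p γ) :=
    ⟨_, Module.finBasisOfFinrankEq (ZMod p) V hV, rfl, charpoly_embedding ι hV hγF _⟩
  have hTγ : ∃ k : ℤ, (T : PGL (ZMod p) V) = embeddingPGL ι γ ^ k := by
    have h0 : τ ≠ 0 := by
      rintro rfl
      exact hτ ⟨0, map_zero _⟩
    obtain ⟨k, hk⟩ := hγ (Units.mk0 τ h0)
    replace hk : γ ^ k = Units.mk0 τ h0 := hk
    refine ⟨k, ?_⟩
    rw [← embeddingPGL_zpow, hk, embeddingPGL]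
    congr 1
    exact Units.ext hT
  obtain ⟨k, hk⟩ := hTγ
  let v₀ : OrientedNecklace V (minpolyOf p γ) := ⟨c, isOrientedNecklace_iff.2 ⟨_, hclass, hc⟩⟩
  refine ⟨v₀, ?_, fun v => ⟨fun hv => ?_, ?_⟩⟩
  -- A necklace equal to its reversal would make γ its own inverse in PGL(V), so γ² would lie in
  -- 𝔽_p.
  · intro h
    have h1 : c = c.reverse := congrArg Subtype.val h
    have h2 := hc.reverse
    rw [← h1] at h2
    have h3 := hc.perm_unique h2
    rw [← map_inv] at h3
    have h4 := PGL.toPerm_injective h3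
    rw [eq_inv_iff_mul_eq_one, ← embeddingPGL_mul, embeddingPGL_eq_one_iff, ← sq] at h4
    exact generator_pow_notMem hγ one_le_two (by omega) h4
  -- The representative g of the rotation commutes with T, hence lies in 𝔽_{p²}. By Cayley–Hamilton
  -- it is a root of the minimal polynomial of γ, that is, γ or γ^p.
  · obtain ⟨_, ⟨g, b, rfl, hg⟩, ho⟩ := isOrientedNecklace_iff.1 v.2
    have hcomm := commute_of_map_eq ho hv
    have hcomm' : Commute (g : Module.End (ZMod p) V) (ι τ) := by
      rw [← hT]
      exact congrArg Units.val hcomm.symm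
    obtain ⟨a, ha⟩ := exists_eq_embedding_of_commute ι hV hτ hcomm'
    have h1 := aeval_eq_zero_of_charpoly_eq hg
    rw [ha, Polynomial.aeval_algHom_apply, map_eq_zero_iff ι (embedding_injective ι)] at h1
    have hint : IsIntegral (ZMod p) (γ : GaloisField p 2) := Algebra.IsIntegral.isIntegral _
    rcases eq_or_eq_pow_of_aeval_eq_zero (minpoly.ne_zero hint) (natDegree_minpoly_eq_two hγF).le
      hγF (minpoly.aeval _ _) h1 with rfl | rfl
    · left
      have h2 : (g : PGL (ZMod p) V) = embeddingPGL ι γ := by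
        rw [embeddingPGL]; congr 1; exact Units.ext ha
      rw [h2] at ho
      exact Subtype.ext (ho.cycle_unique hc)
    · right
      have h2 : (g : PGL (ZMod p) V) = embeddingPGL ι (γ ^ p) := by
        rw [embeddingPGL]; congr 1; refine Units.ext ?_
        rw [ha]; rfl
      rw [h2, embeddingPGL_pow_card, map_inv] at ho
      exact Subtype.ext (ho.cycle_unique hc.reverse)
  · have hcm : Commute (PGL.toPerm (ZMod p) V (T : PGL (ZMod p) V))
        (PGL.toPerm (ZMod p) V (embeddingPGL ι γ)) := by
      rw [hk, map_zpow]
      exact (Commute.refl _).zpow_left k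
    rintro (rfl | rfl)
    · exact hc.map_eq_iff.2 hcm
    · exact hc.reverse.map_eq_iff.2 hcm.inv_right

end FixedNecklaces

/-! ### Bases modulo a non-split Cartan subgroup -/

section CartanBases

open Polynomial

variable {p : ℕ} [Fact p.Prime] {V V' : Type*} [AddCommGroup V] [Module (ZMod p) V]
  [AddCommGroup V'] [Module (ZMod p) V'] {α : GaloisField p 2}
  (hα : α ∉ Set.range (algebraMap (ZMod p) (GaloisField p 2)))

/-- The isomorphism to `𝔽_{p²}` that maps the basis `b` to `1, α`. -/
noncomputable def fieldCoord (b : Module.Basis (Fin 2) (ZMod p) V) :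
    V ≃ₗ[ZMod p] GaloisField p 2 :=
  b.equiv (basisOneOf hα) (Equiv.refl _)

theorem fieldCoord_apply_self (b : Module.Basis (Fin 2) (ZMod p) V) (j : Fin 2) :
    fieldCoord hα b (b j) = (![1, α] : Fin 2 → GaloisField p 2) j := by
  rw [fieldCoord, Module.Basis.equiv_apply, coe_basisOneOf, Equiv.refl_apply]

theorem fieldCoord_map (b : Module.Basis (Fin 2) (ZMod p) V) (f : V ≃ₗ[ZMod p] V') (v : V) :
    fieldCoord hα (b.map f) (f v) = fieldCoord hα b v := by
  have : (f.trans (fieldCoord hα (b.map f))) = fieldCoord hα b := by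
    apply LinearEquiv.toLinearMap_injective
    refine b.ext fun j => ?_
    have h := fieldCoord_apply_self hα (b.map f) j
    rw [Module.Basis.map_apply] at h
    exact h.trans (fieldCoord_apply_self hα b j).symm
  exact LinearEquiv.congr_fun this v

theorem fieldCoord_rightMul (b : Module.Basis (Fin 2) (ZMod p) V) (M : GL (Fin 2) (ZMod p))
    (j : Fin 2) : fieldCoord hα b (rightMul b M j) =
      Matrix.vecMul ![1, α] (M.1.map (algebraMap (ZMod p) (GaloisField p 2))) j := by
  rw [rightMul, map_sum]
  simp only [map_smul, fieldCoord_apply_self]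
  simp only [Matrix.vecMul, dotProduct, Matrix.map_apply, Algebra.smul_def, mul_comm]

theorem exists_rightMul_eq (b b' : Module.Basis (Fin 2) (ZMod p) V) :
    ∃ M : GL (Fin 2) (ZMod p), rightMul b M = b' := by
  refine ⟨⟨b.toMatrix b', b'.toMatrix b, b.toMatrix_mul_toMatrix_flip b',
    b'.toMatrix_mul_toMatrix_flip b⟩, ?_⟩
  funext j
  exact b.sum_toMatrix_smul_self b' j

/-- In the coordinate of b, the basis b' = bM reads (1, α)M. Membership of M in the stabiliser says
that this is c(1, α), which is c times what b' reads in its own coordinate. -/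
theorem exists_mem_cartan_iff (b b' : Module.Basis (Fin 2) (ZMod p) V) :
    (∃ M ∈ cartan p α, rightMul b M = b') ↔
      ∃ c : (GaloisField p 2)ˣ, ∀ v, fieldCoord hα b v = c * fieldCoord hα b' v := by
  have key : ∀ c : (GaloisField p 2)ˣ, (∀ v, fieldCoord hα b v = c * fieldCoord hα b' v) ↔
      ∀ j, fieldCoord hα b (b' j) = c * (![1, α] : Fin 2 → GaloisField p 2) j := by
    intro c
    constructor
    · intro h j
      rw [h, fieldCoord_apply_self]
    · intro h v
      have : (fieldCoord hα b).toLinearMap =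
          (LinearMap.mulLeft (ZMod p) (c : GaloisField p 2)).comp
            (fieldCoord hα b').toLinearMap := by
        refine b'.ext fun j => ?_
        refine (h j).trans ?_
        rw [← fieldCoord_apply_self hα b']
        rfl
      exact LinearMap.congr_fun this v
  constructor
  · rintro ⟨M, ⟨c, hc⟩, hM⟩
    refine ⟨c, (key c).2 fun j => ?_⟩
    rw [← hM, fieldCoord_rightMul, hc, Pi.smul_apply, smul_eq_mul]
  · rintro ⟨c, hc⟩
    obtain ⟨M, hM⟩ := exists_rightMul_eq b b'
    refine ⟨M, ⟨c, ?_⟩, hM⟩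
    funext j
    rw [← fieldCoord_rightMul hα b M j, hM, (key c).1 hc, Pi.smul_apply, smul_eq_mul]

/-- In the coordinate given by the basis `b`, the endomorphism `T` is multiplication by `c`. -/
def IsMulBy (b : Module.Basis (Fin 2) (ZMod p) V) (T : Module.End (ZMod p) V)
    (c : GaloisField p 2) : Prop :=
  ∀ v, fieldCoord hα b (T v) = c * fieldCoord hα b v

variable {hα} {b b' : Module.Basis (Fin 2) (ZMod p) V} {T : Module.End (ZMod p) V}
  {c : GaloisField p 2}

/-- The image of b under f is again a basis, whose coordinate is that of b composed with f⁻¹; the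
preceding criterion applies to this pair. -/
theorem exists_mem_cartan_eq_rightMul_iff (f : V ≃ₗ[ZMod p] V) :
    (∃ M ∈ cartan p α, f ∘ b = rightMul b M) ↔ ∃ c, IsMulBy hα b f.toLinearMap c := by
  have h := exists_mem_cartan_iff hα b (b.map f)
  have e : ⇑(b.map f) = f ∘ b := by ext; simp
  rw [e] at h
  simp only [eq_comm (a := f ∘ b)]
  rw [h]
  constructor
  · rintro ⟨c, hc⟩
    refine ⟨c, fun v => ?_⟩
    have := hc (f v)
    rwa [fieldCoord_map] at this
  · rintro ⟨c, hc⟩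
    have hc0 : c ≠ 0 := by
      rintro rfl
      have h1 := hc (f.symm (b 0))
      rw [zero_mul, LinearEquiv.coe_coe, LinearEquiv.apply_symm_apply, fieldCoord_apply_self] at h1
      exact one_ne_zero h1
    refine ⟨Units.mk0 c hc0, fun v => ?_⟩
    obtain ⟨w, rfl⟩ := f.surjective v
    rw [fieldCoord_map]
    exact hc w

namespace IsMulBy

theorem pow (h : IsMulBy hα b T c) (n : ℕ) : IsMulBy hα b (T ^ n) (c ^ n) := by
  induction n with
  | zero => intro v; simp
  | succ n ih =>
    intro v
    rw [pow_succ, Module.End.mul_apply, ih, h, pow_succ, mul_assoc]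

theorem smul (h : IsMulBy hα b T c) (a : ZMod p) : IsMulBy hα b (a • T) (a • c) := by
  intro v
  rw [LinearMap.smul_apply, map_smul, h, smul_mul_assoc]

theorem aeval (h : IsMulBy hα b T c) (q : (ZMod p)[X]) :
    IsMulBy hα b (Polynomial.aeval T q) (Polynomial.aeval c q) := by
  induction q using Polynomial.induction_on' with
  | add q r hq hr =>
    intro v
    rw [map_add, map_add, LinearMap.add_apply, map_add, hq, hr, add_mul]
  | monomial n a =>
    rw [aeval_monomial, aeval_monomial, ← Algebra.smul_def, ← Algebra.smul_def]
    exact (h.pow n).smul a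

theorem unique {c' : GaloisField p 2} (h : IsMulBy hα b T c) (h' : IsMulBy hα b T c') :
    c = c' := by
  have h1 := (h (b 0)).symm.trans (h' (b 0))
  rw [fieldCoord_apply_self] at h1
  simpa using h1

theorem aeval_eq_zero (h : IsMulBy hα b T c) {q : (ZMod p)[X]} (hT : Polynomial.aeval T q = 0) :
    Polynomial.aeval c q = 0 := by
  have h1 := h.aeval q
  rw [hT] at h1
  refine h1.unique fun v => ?_
  rw [LinearMap.zero_apply, map_zero, zero_mul]

/-- If `T` is multiplication by `c` and has an eigenvector, then it is a scalar. -/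
theorem exists_eq_smul_of_eigenvector (h : IsMulBy hα b T c) {v : V} (hv : v ≠ 0) {a : ZMod p}
    (hav : T v = a • v) : T = a • 1 := by
  have h1 := h v
  rw [hav, map_smul, Algebra.smul_def] at h1
  have h0 : fieldCoord hα b v ≠ 0 := by simpa using hv
  have h2 := mul_right_cancel₀ h0 h1
  ext w
  apply (fieldCoord hα b).injective
  rw [h, ← h2, LinearMap.smul_apply, map_smul, Algebra.smul_def, Module.End.one_apply]

/-- Two bases in which `T` is multiplication by the same element differ by an element of the
Cartan subgroup. -/
theorem exists_mem_cartan (h : IsMulBy hα b T c) (h' : IsMulBy hα b' T c)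
    (hc : c ∉ Set.range (algebraMap (ZMod p) (GaloisField p 2))) :
    ∃ M ∈ cartan p α, rightMul b M = b' := by
  rw [exists_mem_cartan_iff hα]
  -- The transition between the two coordinates commutes with multiplication by c. Since c generates
  -- 𝔽_{p²}, it is multiplication by its value at 1.
  let L : GaloisField p 2 ≃ₗ[ZMod p] GaloisField p 2 :=
    (fieldCoord hα b').symm.trans (fieldCoord hα b)
  have hL : ∀ x, L (c * x) = c * L x := by
    intro x
    obtain ⟨v, rfl⟩ := (fieldCoord hα b').surjective x
    rw [← h' v]
    simp only [L, LinearEquiv.trans_apply, LinearEquiv.symm_apply_apply]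
    exact h v
  have hL1 : ∀ x, L x = L 1 * x := by
    intro x
    obtain ⟨s, t, rfl⟩ := exists_eq_add_mul hc x
    have h2 : L c = c * L 1 := by rw [← hL, mul_one]
    rw [← Algebra.smul_def, map_add, map_smul, h2, ← mul_one (algebraMap _ _ s),
      ← Algebra.smul_def, map_smul]
    simp only [Algebra.smul_def]
    ring
  have hL0 : L 1 ≠ 0 := by simp
  refine ⟨Units.mk0 (L 1) hL0, fun v => ?_⟩
  rw [Units.val_mk0, ← hL1]
  simp [L]

/-- The coordinates of b and b' differ by a factor in 𝔽_{p²}, which commutes with c. So the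
multiplier is an invariant of the orbit. -/
theorem of_mem_cartan (h : IsMulBy hα b T c) {M : GL (Fin 2) (ZMod p)} (hM : M ∈ cartan p α)
    (hb : rightMul b M = b') : IsMulBy hα b' T c := by
  obtain ⟨d, hd⟩ := (exists_mem_cartan_iff hα b b').1 ⟨M, hM, hb⟩
  intro v
  have h1 := h v
  rw [hd, hd] at h1
  apply mul_left_cancel₀ d.ne_zero
  rw [h1]
  ring

theorem map (h : IsMulBy hα b T c) (f : V ≃ₗ[ZMod p] V') {T' : Module.End (ZMod p) V'}
    (hT : ∀ v, T' (f v) = f (T v)) : IsMulBy hα (b.map f) T' c := by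
  intro v
  obtain ⟨w, rfl⟩ := f.surjective v
  rw [hT, fieldCoord_map, fieldCoord_map]
  exact h w

end IsMulBy

/-- The basis 1, α is carried to V by a ↦ ι(a)v, an 𝔽_{p²}-linear isomorphism. -/
theorem exists_isMulBy (hα : α ∉ Set.range (algebraMap (ZMod p) (GaloisField p 2)))
    (ι : GaloisField p 2 →ₐ[ZMod p] Module.End (ZMod p) V)
    (hV : Module.finrank (ZMod p) V = 2) (c : GaloisField p 2) :
    ∃ b : Module.Basis (Fin 2) (ZMod p) V, IsMulBy hα b (ι c) c := by
  have : Nontrivial V := Module.nontrivial_of_finrank_pos (R := ZMod p) (by omega)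
  obtain ⟨v, hv⟩ := exists_ne (0 : V)
  obtain ⟨e, he⟩ := exists_orbitEquiv ι hV hv
  have h0 : IsMulBy hα (basisOneOf hα) (LinearMap.mulLeft (ZMod p) c) c := by
    have h1 : ∀ x, fieldCoord hα (basisOneOf hα) x = x := by
      intro x
      simp [fieldCoord]
    intro x
    rw [h1, h1]
    rfl
  refine ⟨(basisOneOf hα).map e, h0.map e fun x => ?_⟩
  rw [he, he, LinearMap.mulLeft_apply, map_mul, Module.End.mul_apply]

/-- Precomposing the embedding with Frobenius exchanges the two conjugate multipliers. -/
theorem exists_isMulBy_pow_card (hα : α ∉ Set.range (algebraMap (ZMod p) (GaloisField p 2)))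
    (ι : GaloisField p 2 →ₐ[ZMod p] Module.End (ZMod p) V)
    (hV : Module.finrank (ZMod p) V = 2) (c : GaloisField p 2) :
    ∃ b : Module.Basis (Fin 2) (ZMod p) V, IsMulBy hα b (ι c) (c ^ p) := by
  have h := exists_isMulBy hα (ι.comp (FiniteField.frobeniusAlgHom (ZMod p) (GaloisField p 2))) hV
    (c ^ p)
  have e : FiniteField.frobeniusAlgHom (ZMod p) (GaloisField p 2) (c ^ p) = c := by
    simp only [FiniteField.coe_frobeniusAlgHom, ZMod.card]
    exact pow_card_pow_card c
  rwa [AlgHom.comp_apply, e] at h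

end CartanBases

/-! ### Elliptic points coming from a curve with an extra automorphism -/

section ExtraAutomorphism

open Polynomial

section Transport

variable {K V V' : Type*} [Field K] [AddCommGroup V] [Module K V] [AddCommGroup V'] [Module K V']

theorem Cycle.map_map_apply {α β δ : Type*} (f : α → β) (g : β → δ) (c : Cycle α) :
    (c.map f).map g = c.map (g ∘ f) :=
  Quotient.inductionOn' c fun l => by simp

theorem IsOrientedNecklace.map {f : K[X]} {c : Cycle (Projectivization K V)}
    (hc : IsOrientedNecklace f c) (e : V ≃ₗ[K] V') :
    IsOrientedNecklace f (c.map (Projectivization.map e.toLinearMap e.injective)) := by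
  obtain ⟨l, rfl, hl, hall, _, ⟨g, b, rfl, hg⟩, hch⟩ := hc
  -- The conjugate of g by e has the same matrix in the transported basis, hence the same
  -- characteristic polynomial.
  let g' : LinearMap.GeneralLinearGroup K V' :=
    Units.map (e.conjAlgEquiv K : Module.End K V →* Module.End K V') g
  have hg' : ∀ v, (g' : Module.End K V') (e v) = e ((g : Module.End K V) v) := by
    intro v
    change e ((g : Module.End K V) (e.symm (e v))) = _
    rw [e.symm_apply_apply]
  refine ⟨_, rfl, hl.map (Projectivization.map_injective _ e.injective), fun P => ?_, _,
    ⟨g', b.map e, rfl, ?_⟩, ?_⟩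
  · induction P using Projectivization.ind with
    | h v hv =>
      have hv' : e.symm v ≠ 0 := by simpa using hv
      refine List.mem_map.2 ⟨Projectivization.mk K (e.symm v) hv', hall _, ?_⟩
      rw [Projectivization.map_mk]
      congr 1
      exact e.apply_symm_apply v
  · rw [← hg]
    congr 1
    ext i j
    rw [LinearMap.toMatrix_apply, LinearMap.toMatrix_apply, Module.Basis.map_apply, hg',
      Module.Basis.map_repr, LinearEquiv.trans_apply, e.symm_apply_apply]
  · rw [List.isChain_map]
    refine hch.imp ?_
    rintro P Q rfl
    induction P using Projectivization.ind with
    | h v hv =>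
      rw [PGL.toPerm_mk_mk g hv (generalLinearGroup_apply_ne_zero g hv), Projectivization.map_mk,
        Projectivization.map_mk]
      refine (PGL.toPerm_mk_mk g' (e.map_ne_zero_iff.2 hv)
        (generalLinearGroup_apply_ne_zero g' (e.map_ne_zero_iff.2 hv))).trans ?_
      congr 1
      exact hg' v

theorem PGL.map_toPerm_pow {c : Cycle (Projectivization K V)} {g : PGL K V}
    (h : c.map (PGL.toPerm K V g) = c) (n : ℕ) : c.map (PGL.toPerm K V (g ^ n)) = c := by
  induction n with
  | zero =>
    rw [pow_zero, map_one]
    exact Quotient.inductionOn' c fun l => by simp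
  | succ n ih => rw [pow_succ, map_mul, Equiv.Perm.coe_mul, ← Cycle.map_map_apply, h, ih]

end Transport

variable {k : Type*} [Field k] [DecidableEq k] {p : ℕ} [Fact p.Prime]

namespace EllIso

variable {E E' : EllCurve k}

theorem toPerm_toPGL (ψ : EllIso E E) :
    ⇑(PGL.toPerm (ZMod p) (E.Tors p) (ψ.toPGL p)) = ψ.proj p := by
  ext P
  induction P using Projectivization.ind with
  | h v hv => rfl

theorem toPGL_eq_one_iff (ψ : EllIso E E) :
    ψ.toPGL p = 1 ↔ ∃ a : (ZMod p)ˣ, ∀ v, ψ.tors p v = (a : ZMod p) • v := by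
  rw [toPGL, PGL.mk_eq_one_iff]
  constructor
  · rintro ⟨a, ha⟩
    exact ⟨a, fun v => LinearMap.congr_fun ha v⟩
  · rintro ⟨a, ha⟩
    exact ⟨a, LinearMap.ext ha⟩

theorem toPGL_eq_pow_of_eq_smul [Nontrivial (E.Tors p)] {φ ψ : EllIso E E} {a : ZMod p} {n : ℕ}
    (h : ψ.torsHom p = a • (φ.torsHom p : Module.End (ZMod p) (E.Tors p)) ^ n) :
    ψ.toPGL p = φ.toPGL p ^ n := by
  obtain ⟨v, hv⟩ := exists_ne (0 : E.Tors p)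
  have ha : a ≠ 0 := by
    rintro rfl
    rw [zero_smul] at h
    have h1 : ψ.tors p v = 0 := LinearMap.congr_fun h v
    exact hv (by simpa using h1)
  have h2 : LinearMap.GeneralLinearGroup.ofLinearEquiv (ψ.tors p) =
      Units.map (algebraMap (ZMod p) (Module.End (ZMod p) (E.Tors p))).toMonoidHom
        (Units.mk0 a ha) * LinearMap.GeneralLinearGroup.ofLinearEquiv (φ.tors p) ^ n := by
    exact Units.ext (h.trans (Algebra.smul_def _ _))
  have h3 : ((Units.map (algebraMap (ZMod p) (Module.End (ZMod p) (E.Tors p))).toMonoidHom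
      (Units.mk0 a ha) : LinearMap.GeneralLinearGroup (ZMod p) (E.Tors p)) :
        PGL (ZMod p) (E.Tors p)) = 1 := (PGL.mk_eq_one_iff _).2 ⟨_, rfl⟩
  rw [toPGL, h2, QuotientGroup.mk_mul, h3, one_mul]
  rfl

theorem exists_eq_smul_of_toPGL_eq_pow {φ ψ : EllIso E E} {n : ℕ}
    (h : ψ.toPGL p = φ.toPGL p ^ n) :
    ∃ a : ZMod p, ψ.torsHom p = a • (φ.torsHom p : Module.End (ZMod p) (E.Tors p)) ^ n := by
  rw [toPGL, toPGL, ← QuotientGroup.mk_pow, ← mul_inv_eq_one, ← QuotientGroup.mk_inv,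
    ← QuotientGroup.mk_mul, PGL.mk_eq_one_iff] at h
  obtain ⟨a, ha⟩ := h
  refine ⟨a, ?_⟩
  have h1 := congrArg (· * ((LinearMap.GeneralLinearGroup.ofLinearEquiv (φ.tors p) ^ n :
    LinearMap.GeneralLinearGroup (ZMod p) (E.Tors p)) : Module.End (ZMod p) (E.Tors p))) ha
  simp only [← Units.val_mul, inv_mul_cancel_right, ← Algebra.smul_def] at h1
  exact h1

end EllIso

variable {γ : (GaloisField p 2)ˣ}

/-- The image of a necklace under an isomorphism. -/
def EllIso.mapNecklace {E E' : EllCurve k} (φ : EllIso E E') {f : (ZMod p)[X]}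
    (v : OrientedNecklace (E.Tors p) f) : OrientedNecklace (E'.Tors p) f :=
  ⟨v.1.map (φ.proj p), v.2.map (φ.tors p)⟩

theorem Ynsp.mk_mapNecklace {E E' : EllCurve k} (φ : EllIso E E')
    (v : OrientedNecklace (E.Tors p) (minpolyOf p γ)) :
    Ynsp.mk E' (φ.mapNecklace v) = Ynsp.mk E v :=
  (Quotient.sound (s := NecklacePair.setoid k p γ) ⟨φ, rfl⟩).symm

theorem finrank_eq_two_of_necklace {E : EllCurve k} {f : (ZMod p)[X]}
    (v : OrientedNecklace (E.Tors p) f) : Module.finrank (ZMod p) (E.Tors p) = 2 := by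
  obtain ⟨_, ⟨_, b, -⟩, -⟩ := isOrientedNecklace_iff.1 v.2
  rw [Module.finrank_eq_card_basis b, Fintype.card_fin]

/-- The automorphism `φ₀` of `E₀`, a zero of `q` on `E₀[p]`, generates the automorphism group of
`E₀` up to scalars, and only curves isomorphic to `E₀` have automorphisms of order `r` in
`PGL(E[p])`. -/
structure IsExtraAut (p : ℕ) [Fact p.Prime] (r : ℕ) (q : (ZMod p)[X]) (E₀ : EllCurve k)
    (φ₀ : EllIso E₀ E₀) : Prop where
  prime : r.Prime
  nonempty_iso : ∀ (E : EllCurve k) (ψ : EllIso E E), orderOf (ψ.toPGL p) = r →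
    Nonempty (EllIso E₀ E)
  exists_eq_smul_pow : ∀ ψ : EllIso E₀ E₀, ∃ (n : ℕ) (a : ZMod p),
    ψ.torsHom p = a • (φ₀.torsHom p : Module.End (ZMod p) (E₀.Tors p)) ^ n
  pow_eq_one : φ₀.toPGL p ^ r = 1
  aeval_eq_zero : aeval (φ₀.torsHom p : Module.End (ZMod p) (E₀.Tors p)) q = 0

namespace IsExtraAut

variable {r : ℕ} {q : (ZMod p)[X]} {E₀ : EllCurve k} {φ₀ : EllIso E₀ E₀}
  (h : IsExtraAut p r q E₀ φ₀)

include h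

theorem exists_toPGL_eq_pow [Nontrivial (E₀.Tors p)] (ψ : EllIso E₀ E₀) :
    ∃ n : ℕ, ψ.toPGL p = φ₀.toPGL p ^ n := by
  obtain ⟨n, a, ha⟩ := h.exists_eq_smul_pow ψ
  exact ⟨n, EllIso.toPGL_eq_pow_of_eq_smul ha⟩

/-- In a cyclic group of prime order r every nontrivial element is a generator. -/
theorem exists_pow_eq_toPGL [Nontrivial (E₀.Tors p)] {ψ : EllIso E₀ E₀} (hψ : ψ.toPGL p ≠ 1) :
    φ₀.toPGL p ≠ 1 ∧ ∃ m : ℕ, φ₀.toPGL p = ψ.toPGL p ^ m := by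
  obtain ⟨n, hn⟩ := h.exists_toPGL_eq_pow ψ
  have h1 : φ₀.toPGL p ≠ 1 := by
    intro h1
    rw [h1, one_pow] at hn
    exact hψ hn
  refine ⟨h1, ?_⟩
  have := Fact.mk h.prime
  have hord : orderOf (φ₀.toPGL p) = r := orderOf_eq_prime h.pow_eq_one h1
  have hcop : n.Coprime (orderOf (φ₀.toPGL p)) := by
    rw [hord, Nat.coprime_comm, h.prime.coprime_iff_not_dvd, ← hord]
    intro hdvd
    rw [orderOf_dvd_iff_pow_eq_one] at hdvd
    exact hψ (hn.trans hdvd)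
  obtain ⟨m, hm⟩ := exists_pow_eq_self_of_coprime hcop
  exact ⟨m, by rw [hn, hm]⟩

theorem orderOf_eq (h1 : φ₀.toPGL p ≠ 1) : orderOf (φ₀.toPGL p) = r := by
  have := Fact.mk h.prime
  exact orderOf_eq_prime h.pow_eq_one h1

/-- An automorphism of `E` of order `r`, moved to `E₀`. -/
theorem exists_transport {E : EllCurve k} {ψ : EllIso E E} (hψ : orderOf (ψ.toPGL p) = r) :
    ∃ (φ : EllIso E E₀) (ψ₀ : EllIso E₀ E₀), ψ₀.toPGL p ≠ 1 ∧
      ∀ v, ψ₀.tors p (φ.tors p v) = φ.tors p (ψ.tors p v) := by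
  obtain ⟨φ⟩ := h.nonempty_iso E ψ hψ
  have hcomm : ∀ v, ((φ.trans ψ).trans φ.symm).tors p (φ.symm.tors p v) =
      φ.symm.tors p (ψ.tors p v) := by
    intro v
    rw [EllIso.tors_trans, EllIso.tors_trans, ← EllIso.tors_trans φ.symm φ, EllIso.symm_trans,
      EllIso.tors_refl]
  refine ⟨φ.symm, (φ.trans ψ).trans φ.symm, fun h1 => ?_, hcomm⟩
  obtain ⟨a, ha⟩ := (EllIso.toPGL_eq_one_iff _).1 h1
  have h2 : ψ.toPGL p = 1 := by
    rw [EllIso.toPGL_eq_one_iff]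
    refine ⟨a, fun v => ?_⟩
    apply (φ.symm.tors p).injective
    rw [← hcomm, ha, map_smul]
  rw [h2, orderOf_one] at hψ
  exact h.prime.one_lt.ne hψ

/-- Curve and automorphism are moved to E₀. Since φ₀ is in PGL a power of the transported
automorphism, it fixes the transported necklace too, and it can serve as the single test element. -/
theorem exists_transport_necklace {x : Ynsp k p γ} (hx : x ∈ ellipticPoints k p γ r) :
    φ₀.toPGL p ≠ 1 ∧ ∃ v : OrientedNecklace (E₀.Tors p) (minpolyOf p γ), x = Ynsp.mk E₀ v ∧
      v.1.map (PGL.toPerm (ZMod p) (E₀.Tors p) (φ₀.toPGL p)) = v.1 := by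
  obtain ⟨E, v, ψ, rfl, hψ, hv⟩ := hx
  obtain ⟨φ, ψ₀, hψ₀, hcomm⟩ := h.exists_transport hψ
  have hfr := finrank_eq_two_of_necklace (φ.mapNecklace v)
  have hnt : Nontrivial (E₀.Tors p) := Module.nontrivial_of_finrank_pos (R := ZMod p) (by omega)
  obtain ⟨hne, m, hm⟩ := h.exists_pow_eq_toPGL hψ₀
  refine ⟨hne, φ.mapNecklace v, (Ynsp.mk_mapNecklace φ v).symm, ?_⟩
  have hfix : (φ.mapNecklace v).1.map (PGL.toPerm (ZMod p) (E₀.Tors p) (ψ₀.toPGL p)) =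
      (φ.mapNecklace v).1 := by
    change (v.1.map (φ.proj p)).map _ = v.1.map (φ.proj p)
    conv_rhs => rw [← hv]
    rw [EllIso.toPerm_toPGL, EllIso.toPerm_toPGL, Cycle.map_map_apply, Cycle.map_map_apply]
    congr 1
    ext P
    induction P using Projectivization.ind with
    | h w hw =>
      simp only [Function.comp_apply, EllIso.proj, Projectivization.map_mk]
      congr 1
      exact hcomm w
  rw [hm]
  exact PGL.map_toPerm_pow hfix m

/-- Up to a scalar φ₀ is a power of the transported automorphism, and multiplications by elements of
𝔽_{p²} are stable under powers and scalars. -/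
theorem exists_transport_basis {α : GaloisField p 2}
    (hα : α ∉ Set.range (algebraMap (ZMod p) (GaloisField p 2))) {x : YH k p (cartan p α)}
    (hx : x ∈ ellipticPointsH k p (cartan p α) r) :
    φ₀.toPGL p ≠ 1 ∧ ∃ (b : Module.Basis (Fin 2) (ZMod p) (E₀.Tors p)) (c : GaloisField p 2),
      x = Quotient.mk (BasisPair.setoid k p (cartan p α)) ⟨E₀, b⟩ ∧
        IsMulBy hα b (φ₀.torsHom p) c := by
  obtain ⟨E, b, ψ, rfl, hψ, hb⟩ := hx
  obtain ⟨φ, ψ₀, hψ₀, hcomm⟩ := h.exists_transport hψ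
  have hnt : Nontrivial (E₀.Tors p) :=
    nontrivial_of_ne _ _ ((b.map (φ.tors p)).ne_zero 0)
  obtain ⟨hne, m, hm⟩ := h.exists_pow_eq_toPGL hψ₀
  obtain ⟨c, hc⟩ := (exists_mem_cartan_eq_rightMul_iff (hα := hα) _).1 hb
  have hc' : IsMulBy hα (b.map (φ.tors p)) (ψ₀.tors p).toLinearMap c := hc.map (φ.tors p) hcomm
  obtain ⟨a, ha⟩ := EllIso.exists_eq_smul_of_toPGL_eq_pow hm
  refine ⟨hne, b.map (φ.tors p), a • c ^ m, ?_, ?_⟩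
  · refine Quotient.sound (s := BasisPair.setoid k p (cartan p α)) ⟨φ, 1, Subgroup.one_mem _, ?_⟩
    rw [rightMul_one]
    ext j
    simp
  · rw [ha]
    exact (hc'.pow m).smul a

end IsExtraAut

end ExtraAutomorphism

/-! ### Counting elliptic points in the irreducible and the split case. -/

section EllipticPointCount

open Polynomial

section Eigenvectors

variable {p : ℕ} [Fact p.Prime] {V : Type*} [AddCommGroup V] [Module (ZMod p) V]

/-- For v ≠ 0 the vector Tv - bv is killed by T - a: either it vanishes and v is an eigenvector, or
it is one itself. -/
theorem exists_eigenvector [Nontrivial V] {T : Module.End (ZMod p) V} {a b : ZMod p}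
    (hT : aeval T ((X - C a) * (X - C b)) = 0) :
    ∃ (c : ZMod p) (v : V), v ≠ 0 ∧ T v = c • v := by
  obtain ⟨v, hv⟩ := exists_ne (0 : V)
  have h : T (T v - b • v) = a • (T v - b • v) := by
    have := LinearMap.congr_fun hT v
    rw [← sub_eq_zero]
    simpa [sub_mul, Algebra.algebraMap_eq_smul_one, sub_smul] using this
  by_cases h0 : T v - b • v = 0
  · exact ⟨b, v, hv, sub_eq_zero.1 h0⟩
  · exact ⟨a, _, h0, h⟩

/-- A space with at most `p²` elements on which `𝔽_{p²}` acts has dimension two. -/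
theorem finrank_eq_two_of_aeval_eq_zero [Nontrivial V] [Finite V] (hcard : Nat.card V ≤ p ^ 2)
    {q : (ZMod p)[X]} (hq : q.Monic) (hq2 : q.natDegree = 2) (hirr : Irreducible q)
    {T : Module.End (ZMod p) V} (hT : aeval T q = 0) : Module.finrank (ZMod p) V = 2 := by
  obtain ⟨ι, -⟩ := exists_embedding hq hq2 hirr hT
  obtain ⟨v, hv⟩ := exists_ne (0 : V)
  -- The orbit of v under 𝔽_{p²} already has p² elements, so the bound on |V| is attained.
  have hinj : Function.Injective fun a => ι a v := by
    intro a b hab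
    by_contra hne
    have h1 : ι (a - b) v = 0 := by
      rw [map_sub, LinearMap.sub_apply, sub_eq_zero]
      exact hab
    have h2 : ι ((a - b)⁻¹ * (a - b)) v = 0 := by
      rw [map_mul, Module.End.mul_apply, h1, map_zero]
    rw [inv_mul_cancel₀ (sub_ne_zero.2 hne), map_one] at h2
    exact hv h2
  have h1 := Nat.card_le_card_of_injective _ hinj
  have h2 : Nat.card (GaloisField p 2) = p ^ 2 := GaloisField.card p 2 two_ne_zero
  have h3 : Module.Finite (ZMod p) V := inferInstance
  rw [h2] at h1
  have h4 := le_antisymm hcard h1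
  rw [Module.natCard_eq_pow_finrank (K := ZMod p), Nat.card_zmod] at h4
  exact Nat.pow_right_injective (Fact.out : p.Prime).two_le h4

end Eigenvectors

variable {k : Type*} [Field k] [DecidableEq k] {p : ℕ} [Fact p.Prime] {γ : (GaloisField p 2)ˣ}

namespace IsExtraAut

variable {r : ℕ} {q : (ZMod p)[X]} {E₀ : EllCurve k} {φ₀ : EllIso E₀ E₀}
  (h : IsExtraAut p r q E₀ φ₀)

include h

theorem toPGL_ne_one (hq : q.Monic) (hq2 : q.natDegree = 2) (hirr : Irreducible q)
    [Nontrivial (E₀.Tors p)] : φ₀.toPGL p ≠ 1 := by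
  obtain ⟨ι, τ, hτ, hιτ, -⟩ := exists_embedding hq hq2 hirr h.aeval_eq_zero
  intro h1
  rw [EllIso.toPGL, PGL.mk_eq_one_iff] at h1
  obtain ⟨c, hc⟩ := h1
  refine hτ ⟨c, embedding_injective ι ?_⟩
  rw [AlgHom.commutes, hιτ]
  exact hc.symm

theorem exists_ellipticPoints_eq (hq : q.Monic) (hq2 : q.natDegree = 2) (hirr : Irreducible q)
    (hV : Module.finrank (ZMod p) (E₀.Tors p) = 2)
    (hγ : ∀ x : (GaloisField p 2)ˣ, x ∈ Subgroup.zpowers γ) (hp : 3 < p) :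
    ∃ v : OrientedNecklace (E₀.Tors p) (minpolyOf p γ), Ynsp.mk E₀ v ≠ Ynsp.mk E₀ v.w ∧
      ellipticPoints k p γ r = {Ynsp.mk E₀ v, Ynsp.mk E₀ v.w} := by
  have hnt : Nontrivial (E₀.Tors p) := Module.nontrivial_of_finrank_pos (R := ZMod p) (by omega)
  obtain ⟨ι, τ, hτ, hιτ, -⟩ := exists_embedding hq hq2 hirr h.aeval_eq_zero
  obtain ⟨v₀, hne, hiff⟩ := exists_fixed_necklaces ι hV hγ hp
    (T := LinearMap.GeneralLinearGroup.ofLinearEquiv (φ₀.tors p)) hτ hιτ.symm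
  have h1 := h.toPGL_ne_one hq hq2 hirr
  refine ⟨v₀, fun heq => ?_, Set.ext fun x => ⟨fun hx => ?_, ?_⟩⟩
  -- An isomorphism between the two pairs is an automorphism of E₀, in PGL a power of φ₀, and
  -- therefore fixes v₀.
  · obtain ⟨ψ, hψ⟩ := Quotient.exact (s := NecklacePair.setoid k p γ) heq
    obtain ⟨n, hn⟩ := h.exists_toPGL_eq_pow ψ
    change v₀.1.map (ψ.proj p) = v₀.w.1 at hψ
    have hfix := PGL.map_toPerm_pow ((hiff v₀).2 (Or.inl rfl)) n
    rw [← EllIso.toPerm_toPGL, hn] at hψ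
    exact hne (Subtype.ext (hfix.symm.trans hψ))
  · obtain ⟨-, v, rfl, hv⟩ := h.exists_transport_necklace hx
    rcases (hiff v).1 hv with rfl | rfl
    · exact Or.inl rfl
    · exact Or.inr rfl
  · rintro (rfl | rfl)
    · exact ⟨E₀, v₀, φ₀, rfl, h.orderOf_eq h1, (hiff _).2 (Or.inl rfl)⟩
    · exact ⟨E₀, v₀.w, φ₀, rfl, h.orderOf_eq h1, (hiff _).2 (Or.inr rfl)⟩

theorem commute_torsHom (ψ : EllIso E₀ E₀) (v : E₀.Tors p) :
    φ₀.torsHom p (ψ.tors p v) = ψ.tors p (φ₀.torsHom p v) := by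
  obtain ⟨n, a, ha⟩ := h.exists_eq_smul_pow ψ
  have hc : Commute (φ₀.torsHom p : Module.End (ZMod p) (E₀.Tors p)) (ψ.torsHom p) := by
    rw [ha]
    exact (Commute.self_pow _ n).smul_right a
  exact LinearMap.congr_fun hc v

/-- The multiplier of φ₀ classifies the points: it is a root of q, so τ or τ^p. Both occur, and it
is unchanged by automorphisms of E₀ because they commute with φ₀. -/
theorem ncard_ellipticPointsH (hq : q.Monic) (hq2 : q.natDegree = 2) (hirr : Irreducible q)
    (hV : Module.finrank (ZMod p) (E₀.Tors p) = 2) {α : GaloisField p 2}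
    (hα : α ∉ Set.range (algebraMap (ZMod p) (GaloisField p 2))) :
    (ellipticPointsH k p (cartan p α) r).ncard = 2 := by
  have hnt : Nontrivial (E₀.Tors p) := Module.nontrivial_of_finrank_pos (R := ZMod p) (by omega)
  obtain ⟨ι, τ, hτ, hιτ, hτq⟩ := exists_embedding hq hq2 hirr h.aeval_eq_zero
  have h1 := h.toPGL_ne_one hq hq2 hirr
  have hττ : τ ≠ τ ^ p := fun e => hτ (mem_range_algebraMap_iff_pow_eq.2 e.symm)
  have hτ' : τ ^ p ∉ Set.range (algebraMap (ZMod p) (GaloisField p 2)) := by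
    rw [mem_range_algebraMap_iff_pow_eq, pow_card_pow_card]
    exact hττ
  obtain ⟨b₁, hb₁⟩ := exists_isMulBy hα ι hV τ
  obtain ⟨b₂, hb₂⟩ := exists_isMulBy_pow_card hα ι hV τ
  rw [hιτ] at hb₁ hb₂
  have hmem : ∀ {b : Module.Basis (Fin 2) (ZMod p) (E₀.Tors p)} {c : GaloisField p 2},
      IsMulBy hα b (φ₀.torsHom p) c → Quotient.mk (BasisPair.setoid k p (cartan p α)) ⟨E₀, b⟩ ∈
        ellipticPointsH k p (cartan p α) r := fun {b c} hb =>
    ⟨E₀, b, φ₀, rfl, h.orderOf_eq h1, (exists_mem_cartan_eq_rightMul_iff (hα := hα) _).2 ⟨c, hb⟩⟩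
  have heq : ∀ {b b' : Module.Basis (Fin 2) (ZMod p) (E₀.Tors p)} {c : GaloisField p 2},
      c ∉ Set.range (algebraMap (ZMod p) (GaloisField p 2)) →
      IsMulBy hα b (φ₀.torsHom p) c → IsMulBy hα b' (φ₀.torsHom p) c →
      Quotient.mk (BasisPair.setoid k p (cartan p α)) ⟨E₀, b⟩ =
        Quotient.mk (BasisPair.setoid k p (cartan p α)) ⟨E₀, b'⟩ := by
    intro b b' c hc hb hb'
    obtain ⟨M, hM, hbM⟩ := hb.exists_mem_cartan hb' hc
    refine Quotient.sound (s := BasisPair.setoid k p (cartan p α)) ⟨EllIso.refl E₀, M, hM, ?_⟩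
    rw [← hbM]
    congr 1
    ext j
    exact congrArg _ (EllIso.tors_refl p _)
  have hset : ellipticPointsH k p (cartan p α) r =
      {Quotient.mk (BasisPair.setoid k p (cartan p α)) ⟨E₀, b₁⟩,
        Quotient.mk (BasisPair.setoid k p (cartan p α)) ⟨E₀, b₂⟩} := by
    refine Set.ext fun x => ⟨fun hx => ?_, ?_⟩
    · obtain ⟨-, b, c, rfl, hb⟩ := h.exists_transport_basis hα hx
      rcases eq_or_eq_pow_of_aeval_eq_zero hq.ne_zero hq2.le hτ hτq
        (hb.aeval_eq_zero h.aeval_eq_zero) with rfl | rfl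
      · exact Or.inl (heq hτ hb hb₁)
      · exact Or.inr (heq hτ' hb hb₂)
    · rintro (rfl | rfl)
      · exact hmem hb₁
      · exact hmem hb₂
  rw [hset]
  refine Set.ncard_pair fun he => ?_
  obtain ⟨ψ, M, hM, hb⟩ := Quotient.exact (s := BasisPair.setoid k p (cartan p α)) he
  have hmap : IsMulBy hα (b₁.map (ψ.tors p)) (φ₀.torsHom p) τ :=
    hb₁.map (ψ.tors p) (h.commute_torsHom ψ)
  have e : ⇑(b₁.map (ψ.tors p)) = ψ.tors p ∘ b₁ := by ext; simp
  exact hττ ((hmap.of_mem_cartan hM (by rw [e]; exact hb)).unique hb₂)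

/-- An eigenvector of φ₀ is a fixed point in ℙ(E₀[p]), which makes φ₀ trivial in PGL as soon as it
preserves a necklace. -/
theorem ellipticPoints_eq_empty {a b : ZMod p} (hq : q = (X - C a) * (X - C b)) :
    ellipticPoints k p γ r = ∅ := by
  rw [Set.eq_empty_iff_forall_notMem]
  intro x hx
  obtain ⟨hne, v, -, hv⟩ := h.exists_transport_necklace hx
  have hV := finrank_eq_two_of_necklace v
  have hnt : Nontrivial (E₀.Tors p) := Module.nontrivial_of_finrank_pos (R := ZMod p) (by omega)
  obtain ⟨-, hPnt⟩ := nontrivial_projectivization hV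
  obtain ⟨c, w, hw, hcw⟩ := exists_eigenvector (hq ▸ h.aeval_eq_zero)
  refine hne (PGL.eq_one_of_map_eq v.2 hv (x := Projectivization.mk (ZMod p) w hw) ?_)
  rw [EllIso.toPGL, PGL.toPerm_mk_mk _ hw (generalLinearGroup_apply_ne_zero _ hw),
    Projectivization.mk_eq_mk_iff']
  exact ⟨c, hcw.symm⟩

/-- If φ₀ acts as multiplication by an element of 𝔽_{p²}, one eigenvector over 𝔽_p forces it to be a
scalar. -/
theorem ellipticPointsH_eq_empty {a b : ZMod p} (hq : q = (X - C a) * (X - C b))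
    {α : GaloisField p 2} (hα : α ∉ Set.range (algebraMap (ZMod p) (GaloisField p 2))) :
    ellipticPointsH k p (cartan p α) r = ∅ := by
  rw [Set.eq_empty_iff_forall_notMem]
  intro x hx
  obtain ⟨hne, bs, c, -, hb⟩ := h.exists_transport_basis hα hx
  have hnt : Nontrivial (E₀.Tors p) := nontrivial_of_ne _ _ (bs.ne_zero 0)
  obtain ⟨d, w, hw, hdw⟩ := exists_eigenvector (hq ▸ h.aeval_eq_zero)
  have h1 := hb.exists_eq_smul_of_eigenvector hw hdw
  have h2 : φ₀.torsHom p = d • (φ₀.torsHom p : Module.End (ZMod p) (E₀.Tors p)) ^ 0 := h1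
  exact hne ((EllIso.toPGL_eq_pow_of_eq_smul h2).trans (pow_zero _))

end IsExtraAut

end EllipticPointCount

/-! ### Automorphisms of short Weierstrass curves -/

section ShortAutomorphisms

open WeierstrassCurve

namespace EllIso

variable {k : Type*} [Field k] [DecidableEq k] {p : ℕ} {E E' : EllCurve k}

theorem torsHom_apply_pow {φ : EllIso E E'} {ψ : EllIso E E} {ψ' : EllIso E' E'}
    (h : ∀ v, ψ'.torsHom p (φ.torsHom p v) = φ.torsHom p (ψ.torsHom p v)) (n : ℕ) (v : E.Tors p) :
    ((ψ'.torsHom p : Module.End (ZMod p) (E'.Tors p)) ^ n) (φ.torsHom p v) =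
      φ.torsHom p (((ψ.torsHom p : Module.End (ZMod p) (E.Tors p)) ^ n) v) := by
  induction n with
  | zero => rfl
  | succ n ih => rw [pow_succ', pow_succ', Module.End.mul_apply, Module.End.mul_apply, ih, h]

theorem exists_pow (φ : EllIso E E) (n : ℕ) : ∃ ψ : EllIso E E, ψ.C.u = φ.C.u ^ n ∧
    ∀ p : ℕ, ψ.torsHom p = (φ.torsHom p : Module.End (ZMod p) (E.Tors p)) ^ n := by
  induction n with
  | zero => exact ⟨EllIso.refl E, (pow_zero _).symm, fun p => EllIso.torsHom_refl p⟩
  | succ n ih =>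
    obtain ⟨ψ, hψ, hψ'⟩ := ih
    refine ⟨φ.trans ψ, ?_, fun p => ?_⟩
    · change φ.C.u * ψ.C.u = _
      rw [hψ, pow_succ']
    · rw [torsHom_trans, hψ', pow_succ]
      rfl

theorem toPGL_pow_eq_one [Fact p.Prime] {ψ : EllIso E E} {n : ℕ} (a : (ZMod p)ˣ)
    (h : (ψ.torsHom p : Module.End (ZMod p) (E.Tors p)) ^ n = (a : ZMod p) • 1) :
    ψ.toPGL p ^ n = 1 := by
  rw [toPGL, ← QuotientGroup.mk_pow, PGL.mk_eq_one_iff]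
  exact ⟨a, h.trans (Algebra.algebraMap_eq_smul_one _).symm⟩

end EllIso

namespace ShortCurve

variable {k : Type*} [Field k] {A B : k}

theorem discriminant_eq (A B : k) : (shortCurve A B).Δ = -16 * (4 * A ^ 3 + 27 * B ^ 2) := by
  simp only [shortCurve, WeierstrassCurve.Δ, WeierstrassCurve.b₂, WeierstrassCurve.b₄,
    WeierstrassCurve.b₆, WeierstrassCurve.b₈]
  ring

/-- With 2 and 3 invertible, the vanishing of a₁, a₂, a₃ forces s, r, t to vanish in turn, so only
the scaling by u remains. -/
theorem eq_of_smul_eq (hk2 : (2 : k) ≠ 0) (hk3 : (3 : k) ≠ 0) {C : VariableChange k}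
    (h : C • shortCurve A B = shortCurve A B) :
    C = ⟨C.u, 0, 0, 0⟩ ∧ (C.u : k) ^ 4 * A = A ∧ (C.u : k) ^ 6 * B = B := by
  obtain ⟨u, r, s, t⟩ := C
  have hu : (u : k) ≠ 0 := u.ne_zero
  rw [variableChange_def, shortCurve, WeierstrassCurve.mk.injEq] at h
  obtain ⟨h1, h2, h3, h4, h6⟩ := h
  simp only [Units.val_inv_eq_inv_val] at h1 h2 h3 h4 h6
  field_simp at h1 h2 h3 h4 h6
  obtain rfl : s = 0 := by simpa [hk2] using h1
  obtain rfl : r = 0 := by simpa [hk3] using h2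
  obtain rfl : t = 0 := by simpa [hk2] using h3
  refine ⟨rfl, ?_, ?_⟩
  · linear_combination -h4
  · linear_combination -h6

/-- The isomorphism `(x, y) ↦ (u²x, u³y)`. -/
def scaleIso {A B A' B' : k} {E E' : EllCurve k} (hW : E.W = shortCurve A B)
    (hW' : E'.W = shortCurve A' B') (u : kˣ) (hA : (u : k) ^ 4 * A = A')
    (hB : (u : k) ^ 6 * B = B') : EllIso E E' where
  C := ⟨u, 0, 0, 0⟩
  smul_eq := by
    have hu : (u : k) ≠ 0 := u.ne_zero
    subst hA hB
    rw [hW, hW', variableChange_def]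
    simp only [shortCurve, WeierstrassCurve.mk.injEq]
    simp [← mul_assoc, hu]

/-- Changing the sign of u keeps u² and changes the sign of u³, that is, of the ordinate. -/
theorem pointFun_eq_neg (hk2 : (2 : k) ≠ 0) (hk3 : (3 : k) ≠ 0)
    {hE : (shortCurve A B).IsElliptic}
    {φ ψ : EllIso (⟨shortCurve A B, hE⟩ : EllCurve k) ⟨shortCurve A B, hE⟩}
    (h : ψ.C.u = -φ.C.u) (Q : EllCurve.Point ⟨shortCurve A B, hE⟩) :
    ψ.pointFun Q = -φ.pointFun Q := by
  have h1 := (eq_of_smul_eq hk2 hk3 ψ.smul_eq).1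
  have h2 := (eq_of_smul_eq hk2 hk3 φ.smul_eq).1
  rcases Q with _ | ⟨x, y, hxy⟩
  · rfl
  · simp only [EllIso.pointFun, Affine.Point.neg_some, Affine.Point.some.injEq]
    rw [h1, h2, h]
    simp only [EllIso.mapX, EllIso.mapY, negY_eq, Units.val_neg]
    constructor <;> ring

variable [DecidableEq k] {E : EllCurve k} (hk2 : (2 : k) ≠ 0) (hk3 : (3 : k) ≠ 0)
  (hW : E.W = shortCurve A B) {φ ψ : EllIso E E} {p : ℕ}

include hk2 hk3 hW

theorem torsHom_eq_of_eq (h : ψ.C.u = φ.C.u) : ψ.torsHom p = φ.torsHom p := by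
  have h1 := (eq_of_smul_eq hk2 hk3 (hW ▸ ψ.smul_eq)).1
  rw [h, ← (eq_of_smul_eq hk2 hk3 (hW ▸ φ.smul_eq)).1] at h1
  rw [EllIso.ext h1]

theorem torsHom_eq_neg (h : ψ.C.u = -φ.C.u) : ψ.torsHom p = -φ.torsHom p := by
  refine LinearMap.ext fun P => Subtype.ext ?_
  rw [LinearMap.neg_apply, AddSubgroup.coe_neg, EllIso.torsHom_apply, EllIso.torsHom_apply]
  generalize (P : E.Point) = Q
  obtain ⟨W, hE⟩ := E
  dsimp only at hW
  subst hW
  exact pointFun_eq_neg hk2 hk3 h Q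

theorem torsHom_eq_pow {n : ℕ} (h : ψ.C.u = φ.C.u ^ n) :
    ψ.torsHom p = (φ.torsHom p : Module.End (ZMod p) (E.Tors p)) ^ n := by
  obtain ⟨χ, hχ, hχ'⟩ := φ.exists_pow n
  rw [← hχ']
  exact torsHom_eq_of_eq hk2 hk3 hW (h.trans hχ.symm)

theorem torsHom_eq_neg_pow {n : ℕ} (h : ψ.C.u = -φ.C.u ^ n) :
    ψ.torsHom p = -(φ.torsHom p : Module.End (ZMod p) (E.Tors p)) ^ n := by
  obtain ⟨χ, hχ, hχ'⟩ := φ.exists_pow n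
  rw [← hχ']
  exact torsHom_eq_neg hk2 hk3 hW (by rw [h, hχ])

theorem torsHom_pow_eq_one {n : ℕ} (h : φ.C.u ^ n = 1) :
    (φ.torsHom p : Module.End (ZMod p) (E.Tors p)) ^ n = 1 := by
  rw [← torsHom_eq_pow hk2 hk3 hW (ψ := EllIso.refl _) (φ := φ) h.symm]
  exact EllIso.torsHom_refl p

theorem torsHom_pow_eq_neg_one {n : ℕ} (h : φ.C.u ^ n = -1) :
    (φ.torsHom p : Module.End (ZMod p) (E.Tors p)) ^ n = -1 := by
  have h1 : (EllIso.refl E).C.u = -φ.C.u ^ n := by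
    rw [h, neg_neg]
    rfl
  rw [← neg_eq_iff_eq_neg, ← torsHom_eq_neg_pow hk2 hk3 hW h1]
  exact EllIso.torsHom_refl p

omit [DecidableEq k] hW in
theorem exists_short_iso (E : EllCurve k) :
    ∃ (A B : k) (E' : EllCurve k), E'.W = shortCurve A B ∧ Nonempty (EllIso E' E) := by
  have := invertibleOfNonzero hk2
  have := invertibleOfNonzero hk3
  obtain ⟨C, hC⟩ := E.W.exists_variableChange_isShortNF
  exact ⟨_, _, ⟨C • E.W, inferInstance⟩, WeierstrassCurve.ext hC.a₁ hC.a₂ hC.a₃ rfl rfl, ⟨⟨C, rfl⟩⟩⟩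

omit hW in
/-- An automorphism, read on a short Weierstrass equation. -/
theorem exists_iso_of_aut [Fact p.Prime] (ψ : EllIso E E) :
    ∃ (A B : k) (E' : EllCurve k) (u : kˣ), E'.W = shortCurve A B ∧
      Nonempty (EllIso E' E) ∧ (u : k) ^ 4 * A = A ∧ (u : k) ^ 6 * B = B ∧
        ∀ n : ℕ, ((u : k) ^ n) ^ 2 = 1 → ψ.toPGL p ^ n = 1 := by
  obtain ⟨A, B, E', hW, ⟨φ⟩⟩ := exists_short_iso hk2 hk3 E
  let χ := (φ.trans ψ).trans φ.symm
  obtain ⟨-, hA, hB⟩ := eq_of_smul_eq hk2 hk3 (hW ▸ χ.smul_eq)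
  refine ⟨A, B, E', χ.C.u, hW, ⟨φ⟩, hA, hB, fun n hn => ?_⟩
  have hcomm : ∀ v, ψ.torsHom p (φ.torsHom p v) = φ.torsHom p (χ.torsHom p v) := by
    intro v
    change ψ.tors p (φ.tors p v) = φ.tors p (((φ.trans ψ).trans φ.symm).tors p v)
    rw [EllIso.tors_trans, EllIso.tors_trans, ← EllIso.tors_trans φ.symm φ, EllIso.symm_trans,
      EllIso.tors_refl]
  have key : ∀ a : (ZMod p)ˣ,
      (χ.torsHom p : Module.End (ZMod p) (E'.Tors p)) ^ n = (a : ZMod p) • 1 →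
        ψ.toPGL p ^ n = 1 := by
    intro a ha
    refine EllIso.toPGL_pow_eq_one a (LinearMap.ext fun w => ?_)
    obtain ⟨v, rfl⟩ := (φ.tors p).surjective w
    refine (EllIso.torsHom_apply_pow hcomm n v).trans ?_
    rw [ha, LinearMap.smul_apply, map_smul]
    rfl
  -- Both u^n = 1 and u^n = -1 give a scalar on the torsion, which is trivial in PGL; hence the
  -- condition (u^n)² = 1.
  rcases sq_eq_one_iff.1 hn with h | h
  · have h' : χ.C.u ^ n = 1 := Units.ext (by rw [Units.val_pow_eq_pow_val, h, Units.val_one])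
    exact key 1 (by rw [torsHom_pow_eq_one hk2 hk3 hW h', Units.val_one, one_smul])
  · have h' : χ.C.u ^ n = -1 := Units.ext (by
      rw [Units.val_pow_eq_pow_val, h, Units.val_neg, Units.val_one])
    exact key (-1) (by rw [torsHom_pow_eq_neg_one hk2 hk3 hW h', Units.val_neg, Units.val_one,
      neg_smul, one_smul])

end ShortCurve

end ShortAutomorphisms

/-! ### The curves `y² = x³ + x` and `y² = x³ + 1` -/

section ExtraCurves

open Polynomial WeierstrassCurve

namespace ShortCurve

section CubeRoot

variable {k : Type*} [Field k] [DecidableEq k] {A B : k}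

/-- Since u³ = 1, the three points Q, φ(Q), φ²(Q) have the same ordinate: they lie on a horizontal
line and sum to zero. -/
theorem pointFun_add_add_eq_zero (hk2 : (2 : k) ≠ 0) (hk3 : (3 : k) ≠ 0)
    {hE : (shortCurve 0 B).IsElliptic}
    {φ : EllIso (⟨shortCurve 0 B, hE⟩ : EllCurve k) ⟨shortCurve 0 B, hE⟩}
    (h : (φ.C.u : k) ^ 2 + φ.C.u + 1 = 0) (Q : EllCurve.Point ⟨shortCurve 0 B, hE⟩) :
    φ.pointFun (φ.pointFun Q) + φ.pointFun Q + Q = 0 := by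
  have h1 := (eq_of_smul_eq hk2 hk3 φ.smul_eq).1
  rcases Q with _ | ⟨x, y, hxy⟩
  · exact (add_zero _).trans (add_zero _)
  obtain ⟨w, hw⟩ : ∃ w : k, w = φ.C.u := ⟨_, rfl⟩
  rw [← hw] at h
  have hw3 : w ^ 3 = 1 := by linear_combination (w - 1) * h
  have hX : ∀ t, EllIso.mapX φ.C t = w ^ 2 * t := by
    intro t
    rw [h1, EllIso.mapX, add_zero, hw]
  have hY : ∀ s t, EllIso.mapY φ.C s t = t := by
    intro s t
    rw [h1, EllIso.mapY, ← hw, hw3]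
    ring
  have hfix : EllIso.mapX φ.C x = EllIso.mapX φ.C (EllIso.mapX φ.C x) → x = 0 := by
    intro hx
    rw [hX, hX] at hx
    have h2 : 3 * x = 0 := by
      linear_combination -(w ^ 2 - w) * hx + x * h - x * (w ^ 3 - w ^ 2 - w + 2) * hw3
    simpa [hk3] using h2
  -- The points to be added are not opposite: otherwise x = y = 0, so B = 0 and the discriminant
  -- vanishes.
  have hne : ¬(EllIso.mapX φ.C x = EllIso.mapX φ.C (EllIso.mapX φ.C x) ∧
      EllIso.mapY φ.C x y = (shortCurve 0 B).toAffine.negY (EllIso.mapX φ.C (EllIso.mapX φ.C x))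
        (EllIso.mapY φ.C (EllIso.mapX φ.C x) (EllIso.mapY φ.C x y))) := by
    rintro ⟨hx, hy⟩
    rw [hY, hY, negY_eq] at hy
    have hy0 : y = 0 := by
      have : 2 * y = 0 := by linear_combination hy
      simpa [hk2] using this
    have heq := equation_iff.1 hxy.1
    rw [hy0, hfix hx] at heq
    have hB : B = 0 := by linear_combination -heq
    have hΔ := hE.isUnit
    rw [discriminant_eq, hB] at hΔ
    simp at hΔ
  -- Coinciding abscissae only happen at x = 0, where the tangent is horizontal as well.
  have hslope : (shortCurve 0 B).toAffine.slope (EllIso.mapX φ.C x)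
      (EllIso.mapX φ.C (EllIso.mapX φ.C x)) (EllIso.mapY φ.C x y)
      (EllIso.mapY φ.C (EllIso.mapX φ.C x) (EllIso.mapY φ.C x y)) = 0 := by
    by_cases hx : EllIso.mapX φ.C x = EllIso.mapX φ.C (EllIso.mapX φ.C x)
    · rw [Affine.slope_of_Y_ne hx (fun hy => hne ⟨hx, hy⟩), hX, hfix hx]
      simp [shortCurve]
    · rw [Affine.slope_of_X_ne hx, hY, hY, sub_self, zero_div]
  rw [← eq_neg_iff_add_eq_zero, add_comm]
  simp only [EllIso.pointFun, Affine.Point.neg_some]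
  rw [Affine.Point.add_some hne, Affine.Point.some.injEq, Affine.addY, Affine.negAddY, negY_eq,
    negY_eq, hslope, Affine.addX, hX, hX, hY]
  simp only [shortCurve]
  constructor
  · linear_combination -x * h - x * w * hw3
  · ring

end CubeRoot

variable {k : Type*} [Field k] [DecidableEq k] [IsAlgClosed k] (hk2 : (2 : k) ≠ 0)
  (hk3 : (3 : k) ≠ 0) (p : ℕ) [Fact p.Prime]

include hk2 hk3

omit [IsAlgClosed k] in
theorem exists_eq_smul_pow {p : ℕ} {A B : k} {E : EllCurve k} (hW : E.W = shortCurve A B)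
    {φ ψ : EllIso E E} (n : ℕ) (h : (ψ.C.u : k) = φ.C.u ^ n ∨ (ψ.C.u : k) = -φ.C.u ^ n) :
    ∃ (n : ℕ) (a : ZMod p), ψ.torsHom p =
      a • (φ.torsHom p : Module.End (ZMod p) (E.Tors p)) ^ n := by
  rcases h with h | h
  · refine ⟨n, 1, ?_⟩
    rw [torsHom_eq_pow hk2 hk3 hW (φ := φ) (n := n) (Units.ext (by simpa using h)), one_smul]
  · refine ⟨n, -1, ?_⟩
    rw [torsHom_eq_neg_pow hk2 hk3 hW (φ := φ) (n := n) (Units.ext (by simpa using h)), neg_smul,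
      one_smul]

theorem exists_isExtraAut_two : ∃ (E₀ : EllCurve k) (φ₀ : EllIso E₀ E₀),
    E₀.W = shortCurve 1 0 ∧ IsExtraAut p 2 (X ^ 2 + 1) E₀ φ₀ := by
  obtain ⟨i, hi⟩ := IsAlgClosed.exists_pow_nat_eq (-1 : k) two_pos
  have hi0 : i ≠ 0 := by
    rintro rfl
    simp at hi
  have hE : (shortCurve (1 : k) 0).IsElliptic := by
    refine ⟨?_⟩
    rw [discriminant_eq, isUnit_iff_ne_zero]
    have : (2 : k) ^ 6 ≠ 0 := pow_ne_zero _ hk2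
    intro h
    apply this
    linear_combination -h
  let E₀ : EllCurve k := ⟨shortCurve 1 0, hE⟩
  have hW : E₀.W = shortCurve 1 0 := rfl
  let φ₀ : EllIso E₀ E₀ := scaleIso hW hW (Units.mk0 i hi0)
    (by simp only [Units.val_mk0]; linear_combination (i ^ 2 - 1) * hi) (mul_zero _)
  clear_value E₀
  have hu : φ₀.C.u = Units.mk0 i hi0 := rfl
  have hu2 : φ₀.C.u ^ 2 = -1 := Units.ext (by simp [hu, hi])
  have hT := torsHom_pow_eq_neg_one hk2 hk3 hW (p := p) hu2
  refine ⟨E₀, φ₀, hW, Nat.prime_two, fun E ψ hψ => ?_, fun ψ => ?_, ?_, ?_⟩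
  · obtain ⟨A, B, E', u, hW', ⟨φ⟩, hA, hB, hn⟩ := exists_iso_of_aut hk2 hk3 (p := p) ψ
    -- If B ≠ 0, then u⁶ = 1, and the order in PGL divides 3 rather than being 2.
    have hB0 : B = 0 := by
      by_contra hB0
      have h3 := hn 3 (by rw [← pow_mul]; exact mul_right_cancel₀ hB0 (hB.trans (one_mul B).symm))
      rw [← orderOf_dvd_iff_pow_eq_one, hψ] at h3
      omega
    have hA0 : A ≠ 0 := by
      rintro rfl
      have h := E'.isElliptic.isUnit
      rw [hW', discriminant_eq, hB0] at h
      simp at h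
    obtain ⟨a, ha⟩ := IsAlgClosed.exists_pow_nat_eq A four_pos
    have ha0 : a ≠ 0 := by
      rintro rfl
      exact hA0 (by simpa using ha.symm)
    exact ⟨(scaleIso hW hW' (Units.mk0 a ha0) (by simpa using ha) (by simp [hB0])).trans φ⟩
  · obtain ⟨-, h4, -⟩ := eq_of_smul_eq hk2 hk3 (hW ▸ ψ.smul_eq)
    -- So u is one of ±1, ±i: up to sign, a power of the u belonging to φ₀.
    have h5 : ((ψ.C.u : k) ^ 2) ^ 2 = 1 := by linear_combination h4
    rcases sq_eq_one_iff.1 h5 with h | h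
    · rcases sq_eq_one_iff.1 h with h | h
      · exact exists_eq_smul_pow hk2 hk3 hW 0 (Or.inl (by rw [h, pow_zero]))
      · exact exists_eq_smul_pow hk2 hk3 hW 0 (Or.inr (by rw [h, pow_zero]))
    · rw [← hi, sq_eq_sq_iff_eq_or_eq_neg] at h
      rcases h with h | h
      · exact exists_eq_smul_pow hk2 hk3 hW 1 (Or.inl (by rw [h, pow_one, hu, Units.val_mk0]))
      · exact exists_eq_smul_pow hk2 hk3 hW 1 (Or.inr (by rw [h, pow_one, hu, Units.val_mk0]))
  · refine EllIso.toPGL_pow_eq_one (-1) ?_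
    rw [hT, Units.val_neg, Units.val_one, neg_smul, one_smul]
  · rw [map_add, map_pow, aeval_X, map_one, hT, neg_add_cancel]

theorem exists_isExtraAut_three : ∃ (E₀ : EllCurve k) (φ₀ : EllIso E₀ E₀),
    E₀.W = shortCurve 0 1 ∧ IsExtraAut p 3 (X ^ 2 + X + 1) E₀ φ₀ := by
  obtain ⟨w, hw⟩ : ∃ w : k, w ^ 2 + w + 1 = 0 := by
    obtain ⟨w, hw⟩ := IsAlgClosed.exists_root (X ^ 2 + X + 1 : k[X]) (by
      rw [show (X ^ 2 + X + 1 : k[X]) = C 1 * X ^ 2 + C 1 * X + C 1 by simp,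
        degree_quadratic one_ne_zero]
      exact two_ne_zero)
    exact ⟨w, by simpa [IsRoot] using hw⟩
  have hw3 : w ^ 3 = 1 := by linear_combination (w - 1) * hw
  have hw0 : w ≠ 0 := by
    rintro rfl
    simp at hw
  have hE : (shortCurve (0 : k) 1).IsElliptic := by
    refine ⟨?_⟩
    rw [discriminant_eq, isUnit_iff_ne_zero]
    have : (2 : k) ^ 4 * 3 ^ 3 ≠ 0 := mul_ne_zero (pow_ne_zero _ hk2) (pow_ne_zero _ hk3)
    intro h
    apply this
    linear_combination -h
  obtain ⟨E₀, hW, φ₀, hu, hT⟩ : ∃ (E₀ : EllCurve k) (_ : E₀.W = shortCurve 0 1)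
      (φ₀ : EllIso E₀ E₀), (φ₀.C.u : k) = w ∧
        ∀ Q, φ₀.pointFun (φ₀.pointFun Q) + φ₀.pointFun Q + Q = 0 :=
    ⟨⟨shortCurve 0 1, hE⟩, rfl, scaleIso rfl rfl (Units.mk0 w hw0) (mul_zero _)
      (by simp only [Units.val_mk0]; linear_combination (w ^ 3 + 1) * hw3), rfl,
      fun Q => pointFun_add_add_eq_zero hk2 hk3 hw Q⟩
  have hu3 : φ₀.C.u ^ 3 = 1 := Units.ext (by simp [hu, hw3])
  refine ⟨E₀, φ₀, hW, Nat.prime_three, fun E ψ hψ => ?_, fun ψ => ?_, ?_, ?_⟩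
  · obtain ⟨A, B, E', u, hW', ⟨φ⟩, hA, hB, hn⟩ := exists_iso_of_aut hk2 hk3 (p := p) ψ
    -- If A ≠ 0, then u⁴ = 1, and the order in PGL divides 2 rather than being 3.
    have hA0 : A = 0 := by
      by_contra hA0
      have h2 := hn 2 (by rw [← pow_mul]; exact mul_right_cancel₀ hA0 (hA.trans (one_mul A).symm))
      rw [← orderOf_dvd_iff_pow_eq_one, hψ] at h2
      omega
    have hB0 : B ≠ 0 := by
      rintro rfl
      have h := E'.isElliptic.isUnit
      rw [hW', discriminant_eq, hA0] at h
      simp at h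
    obtain ⟨a, ha⟩ := IsAlgClosed.exists_pow_nat_eq B (n := 6) (by omega)
    have ha0 : a ≠ 0 := by
      rintro rfl
      exact hB0 (by simpa using ha.symm)
    exact ⟨(scaleIso hW hW' (Units.mk0 a ha0) (by simp [hA0]) (by simpa using ha)).trans φ⟩
  · obtain ⟨-, -, h6⟩ := eq_of_smul_eq hk2 hk3 (hW ▸ ψ.smul_eq)
    -- So u is, up to sign, a cube root of unity and hence ±w^n.
    have h5 : ((ψ.C.u : k) ^ 3) ^ 2 = 1 := by linear_combination h6
    have hroot : ∀ v : k, v ^ 3 = 1 → ∃ n : ℕ, v = w ^ n := by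
      intro v hv
      have h7 : (v - 1) * ((v - w) * (v - w ^ 2)) = 0 := by
        linear_combination hv - v * (v - 1) * hw - hw3 + v * hw3
      rcases mul_eq_zero.1 h7 with h8 | h8
      · exact ⟨0, by rw [sub_eq_zero.1 h8, pow_zero]⟩
      · rcases mul_eq_zero.1 h8 with h8 | h8
        · exact ⟨1, by rw [sub_eq_zero.1 h8, pow_one]⟩
        · exact ⟨2, sub_eq_zero.1 h8⟩
    rcases sq_eq_one_iff.1 h5 with h | h
    · obtain ⟨n, hn⟩ := hroot _ h
      exact exists_eq_smul_pow hk2 hk3 hW n (Or.inl (by rw [hn, hu]))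
    · obtain ⟨n, hn⟩ := hroot (-(ψ.C.u : k)) (by linear_combination -h)
      exact exists_eq_smul_pow hk2 hk3 hW n (Or.inr (by rw [hu, ← hn, neg_neg]))
  · refine EllIso.toPGL_pow_eq_one 1 ?_
    rw [torsHom_pow_eq_one hk2 hk3 hW hu3, Units.val_one, one_smul]
  · refine LinearMap.ext fun P => Subtype.ext ?_
    have e : aeval (φ₀.torsHom p : Module.End (ZMod p) (E₀.Tors p)) (X ^ 2 + X + 1 : (ZMod p)[X]) =
        φ₀.torsHom p ∘ₗ φ₀.torsHom p + φ₀.torsHom p + LinearMap.id := by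
      rw [map_add, map_add, map_pow, aeval_X, map_one, pow_two]
      rfl
    rw [e]
    exact hT (P : E₀.Point)

end ShortCurve

end ExtraCurves

/-! ### Torsion of the special curves, and the final count. -/

section FinalCount

open Polynomial

variable {k : Type*} [Field k] [DecidableEq k] {p : ℕ} [Fact p.Prime]

theorem EllCurve.tors_of_shortCurve [IsAlgClosed k] (hk2 : (2 : k) ≠ 0) (hkp : (p : k) ≠ 0)
    (hp2 : p ≠ 2) {A B : k} {E : EllCurve k} (hW : E.W = shortCurve A B) :
    Nontrivial (E.Tors p) ∧ Finite (E.Tors p) ∧ Nat.card (E.Tors p) ≤ p ^ 2 := by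
  have hmem : ∀ P : E.Point, P ∈ AddSubgroup.torsionBy E.Point (p : ℤ) ↔ p • P = 0 := fun P =>
    AddSubgroup.torsionBy.nsmul_iff
  have hset : (AddSubgroup.torsionBy E.Point (p : ℤ) : Set E.Point) = {P | p • P = 0} :=
    Set.ext hmem
  have hp := (Fact.out : p.Prime)
  obtain ⟨W, hE⟩ := E
  dsimp only at hW
  subst hW
  obtain ⟨P, hP, hP0⟩ := ShortCurve.exists_torsion_ne_zero A B hE hk2 hp hp2 hkp
  obtain ⟨hfin, hcard⟩ := ShortCurve.torsion_finite_and_card_le A B hk2 hp hp2 hkp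
  refine ⟨?_, ?_, ?_⟩
  · exact nontrivial_of_ne ⟨P, (hmem P).2 hP⟩ 0 fun h => hP0 (congrArg Subtype.val h)
  · rw [← hset] at hfin
    exact hfin
  · rw [← hset] at hcard
    exact hcard

/-! ### Roots of X² + 1 and X² + X + 1 modulo p. -/

section NumberTheory

theorem monic_and_natDegree_X_sq_add_one :
    (X ^ 2 + 1 : (ZMod p)[X]).Monic ∧ (X ^ 2 + 1 : (ZMod p)[X]).natDegree = 2 := by
  constructor
  · monicity!
  · compute_degree!

theorem monic_and_natDegree_X_sq_add_X_add_one :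
    (X ^ 2 + X + 1 : (ZMod p)[X]).Monic ∧ (X ^ 2 + X + 1 : (ZMod p)[X]).natDegree = 2 := by
  constructor
  · monicity!
  · compute_degree!

theorem irreducible_X_sq_add_one (h : ∀ a : ZMod p, a ^ 2 ≠ -1) :
    Irreducible (X ^ 2 + 1 : (ZMod p)[X]) := by
  obtain ⟨hm, hd⟩ := monic_and_natDegree_X_sq_add_one (p := p)
  rw [irreducible_iff_roots_eq_zero_of_degree_le_three hd.ge (by omega)]
  refine Multiset.eq_zero_of_forall_notMem fun a ha => h a ?_
  have := isRoot_of_mem_roots ha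
  simp only [IsRoot, eval_add, eval_pow, eval_X, eval_one] at this
  linear_combination this

theorem irreducible_X_sq_add_X_add_one (h : ∀ a : ZMod p, a ^ 2 + a + 1 ≠ 0) :
    Irreducible (X ^ 2 + X + 1 : (ZMod p)[X]) := by
  obtain ⟨hm, hd⟩ := monic_and_natDegree_X_sq_add_X_add_one (p := p)
  rw [irreducible_iff_roots_eq_zero_of_degree_le_three hd.ge (by omega)]
  refine Multiset.eq_zero_of_forall_notMem fun a ha => h a ?_
  have := isRoot_of_mem_roots ha
  simpa only [IsRoot, eval_add, eval_pow, eval_X, eval_one] using this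

/-- For p ≠ 3 the roots are the elements of order 3 in a group of order p - 1. -/
theorem exists_sq_add_add_one_eq_zero_iff (hp3 : p ≠ 3) :
    (∃ a : ZMod p, a ^ 2 + a + 1 = 0) ↔ p % 3 = 1 := by
  have hp := (Fact.out : p.Prime)
  have h3 : (3 : ZMod p) ≠ 0 := by
    intro h
    have h' : ((3 : ℕ) : ZMod p) = 0 := by exact_mod_cast h
    rw [ZMod.natCast_eq_zero_iff, Nat.prime_dvd_prime_iff_eq hp Nat.prime_three] at h'
    exact hp3 h'
  have := Fact.mk Nat.prime_three
  constructor
  · rintro ⟨a, ha⟩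
    have ha3 : a ^ 3 = 1 := by linear_combination (a - 1) * ha
    have ha0 : a ≠ 0 := by
      rintro rfl
      simp at ha
    have ha1 : a ≠ 1 := by
      rintro rfl
      exact h3 (by linear_combination ha)
    have hord : orderOf a = 3 := orderOf_eq_prime ha3 ha1
    have h := orderOf_dvd_of_pow_eq_one (ZMod.pow_card_sub_one_eq_one ha0)
    rw [hord] at h
    have := hp.two_le
    omega
  · intro h
    have hdvd : 3 ∣ Nat.card (ZMod p)ˣ := by
      rw [Nat.card_eq_fintype_card, ZMod.card_units p]
      omega
    obtain ⟨u, hu⟩ := exists_prime_orderOf_dvd_card' 3 hdvd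
    refine ⟨u, ?_⟩
    have hu3 : (u : ZMod p) ^ 3 = 1 := by
      rw [← Units.val_pow_eq_pow_val, ← hu, pow_orderOf_eq_one, Units.val_one]
    have hu1 : (u : ZMod p) - 1 ≠ 0 := by
      intro h1
      have : u = 1 := Units.ext (sub_eq_zero.1 h1)
      rw [this, orderOf_one] at hu
      omega
    apply mul_left_cancel₀ hu1
    linear_combination hu3

theorem legendreSym_neg_one :
    legendreSym p (-1) = if ∃ a : ZMod p, a ^ 2 = -1 then 1 else -1 := by
  have h0 : ((-1 : ℤ) : ZMod p) ≠ 0 := by simp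
  split_ifs with h
  · obtain ⟨a, ha⟩ := h
    rw [legendreSym.eq_one_iff p h0]
    exact ⟨a, by push_cast; rw [← ha, sq]⟩
  · rw [legendreSym.eq_neg_one_iff]
    rintro ⟨a, ha⟩
    exact h ⟨a, by push_cast at ha; rw [ha, sq]⟩

/-- The discriminant of X² + X + 1 is -3: a root a gives the square root 2a + 1 and conversely. -/
theorem legendreSym_neg_three (hp2 : p ≠ 2) (hp3 : p ≠ 3) :
    legendreSym p (-3) = if ∃ a : ZMod p, a ^ 2 + a + 1 = 0 then 1 else -1 := by
  have hp := (Fact.out : p.Prime)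
  have h2 : (2 : ZMod p) ≠ 0 := by
    intro h
    have h' : ((2 : ℕ) : ZMod p) = 0 := by exact_mod_cast h
    rw [ZMod.natCast_eq_zero_iff, Nat.prime_dvd_prime_iff_eq hp Nat.prime_two] at h'
    exact hp2 h'
  have h0 : ((-3 : ℤ) : ZMod p) ≠ 0 := by
    intro h
    have h' : ((3 : ℕ) : ZMod p) = 0 := by
      push_cast at h ⊢
      linear_combination -h
    rw [ZMod.natCast_eq_zero_iff, Nat.prime_dvd_prime_iff_eq hp Nat.prime_three] at h'
    exact hp3 h'
  split_ifs with h
  · obtain ⟨a, ha⟩ := h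
    rw [legendreSym.eq_one_iff p h0]
    exact ⟨2 * a + 1, by push_cast; linear_combination -4 * ha⟩
  · rw [legendreSym.eq_neg_one_iff]
    rintro ⟨a, ha⟩
    push_cast at ha
    refine h ⟨(a - 1) / 2, ?_⟩
    field_simp
    linear_combination -ha

end NumberTheory

variable {γ : (GaloisField p 2)ˣ}

namespace IsExtraAut

variable {r : ℕ} {q : (ZMod p)[X]} {E₀ : EllCurve k} {φ₀ : EllIso E₀ E₀}
  (h : IsExtraAut p r q E₀ φ₀)

include h

theorem count_of_irreducible [IsAlgClosed k] (hk2 : (2 : k) ≠ 0) (hkp : (p : k) ≠ 0) {A B : k}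
    (hW : E₀.W = shortCurve A B) (hq : q.Monic ∧ q.natDegree = 2) (hirr : Irreducible q)
    (hγ : ∀ x : (GaloisField p 2)ˣ, x ∈ Subgroup.zpowers γ) (hp : 3 < p) :
    ((ellipticPoints k p γ r).Finite ∧ (ellipticPoints k p γ r).ncard = 2) ∧
    (∃ (E : EllCurve k) (v : OrientedNecklace (E.Tors p) (minpolyOf p γ)),
      ellipticPoints k p γ r = {Ynsp.mk E v, Ynsp.mk E v.w}) ∧
    ∀ α : GaloisField p 2, α ∉ Set.range (algebraMap (ZMod p) (GaloisField p 2)) →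
      (ellipticPointsH k p (cartan p α) r).Finite ∧
        (ellipticPointsH k p (cartan p α) r).ncard = 2 := by
  obtain ⟨hnt, hfin, hcard⟩ := EllCurve.tors_of_shortCurve hk2 hkp (by omega) hW
  have hV := finrank_eq_two_of_aeval_eq_zero hcard hq.1 hq.2 hirr h.aeval_eq_zero
  obtain ⟨v, hne, hv⟩ := h.exists_ellipticPoints_eq hq.1 hq.2 hirr hV hγ hp
  refine ⟨?_, ⟨E₀, v, hv⟩, fun α hα => ?_⟩
  · rw [hv]
    exact ⟨Set.toFinite _, Set.ncard_pair hne⟩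
  · have h2 := h.ncard_ellipticPointsH hq.1 hq.2 hirr hV hα
    exact ⟨Set.finite_of_ncard_ne_zero (by omega), h2⟩

theorem count_of_split {a b : ZMod p} (hq : q = (X - C a) * (X - C b)) :
    ((ellipticPoints k p γ r).Finite ∧ (ellipticPoints k p γ r).ncard = 0) ∧
    ∀ α : GaloisField p 2, α ∉ Set.range (algebraMap (ZMod p) (GaloisField p 2)) →
      (ellipticPointsH k p (cartan p α) r).Finite ∧
        (ellipticPointsH k p (cartan p α) r).ncard = 0 := by
  refine ⟨?_, fun α hα => ?_⟩
  · rw [h.ellipticPoints_eq_empty hq]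
    simp
  · rw [h.ellipticPointsH_eq_empty hq hα]
    simp

end IsExtraAut

section Counts

variable [IsAlgClosed k]

/-- A root of X² + 1 modulo p decides both the Legendre symbol and the splitting of the polynomial
satisfied by φ₀, so each case falls under one of the two counts. -/
theorem elliptic_count_two (hp : 3 < p) (hk2 : (2 : k) ≠ 0) (hk3 : (3 : k) ≠ 0)
    (hkp : (p : k) ≠ 0) (hγ : ∀ x : (GaloisField p 2)ˣ, x ∈ Subgroup.zpowers γ) :
    ((ellipticPoints k p γ 2).Finite ∧
      ((ellipticPoints k p γ 2).ncard : ℤ) = 1 - legendreSym p (-1) ∧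
      (p % 4 = 1 → (ellipticPoints k p γ 2).ncard = 0) ∧
      (p % 4 = 3 → (ellipticPoints k p γ 2).ncard = 2)) ∧
    ((ellipticPoints k p γ 2).ncard = 2 →
      ∃ (E : EllCurve k) (v : OrientedNecklace (E.Tors p) (minpolyOf p γ)),
        ellipticPoints k p γ 2 = {Ynsp.mk E v, Ynsp.mk E v.w}) ∧
    ∀ α : GaloisField p 2, α ∉ Set.range (algebraMap (ZMod p) (GaloisField p 2)) →
      (ellipticPointsH k p (cartan p α) 2).Finite ∧
        ((ellipticPointsH k p (cartan p α) 2).ncard : ℤ) = 1 - legendreSym p (-1) := by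
  obtain ⟨E₀, φ₀, hW, h⟩ := ShortCurve.exists_isExtraAut_two hk2 hk3 p
  have hsq : (∃ a : ZMod p, a ^ 2 = -1) ↔ p % 4 ≠ 3 := by
    rw [← ZMod.exists_sq_eq_neg_one_iff, IsSquare]
    simp only [sq, eq_comm]
  rw [legendreSym_neg_one]
  split_ifs with ha
  · obtain ⟨a, ha'⟩ := ha
    have hq : (X ^ 2 + 1 : (ZMod p)[X]) = (X - C a) * (X - C (-a)) := by
      have : C a ^ 2 = (-1 : (ZMod p)[X]) := by rw [← C_pow, ha', C_neg, C_1]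
      rw [C_neg]
      linear_combination this
    obtain ⟨⟨h1, h2⟩, h3⟩ := h.count_of_split (γ := γ) hq
    refine ⟨⟨h1, by rw [h2]; rfl, fun _ => h2, fun h4 => ?_⟩, fun h4 => ?_, fun α hα => ?_⟩
    · exact absurd h4 (hsq.1 ⟨a, ha'⟩)
    · omega
    · exact ⟨(h3 α hα).1, by rw [(h3 α hα).2]; rfl⟩
  · obtain ⟨⟨h1, h2⟩, h3, h4⟩ := h.count_of_irreducible hk2 hkp hW
      monic_and_natDegree_X_sq_add_one
      (irreducible_X_sq_add_one fun a h' => ha ⟨a, h'⟩) hγ hp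
    rw [hsq, not_not] at ha
    refine ⟨⟨h1, by rw [h2]; rfl, fun h5 => ?_, fun _ => h2⟩, fun _ => h3, fun α hα => ?_⟩
    · omega
    · exact ⟨(h4 α hα).1, by rw [(h4 α hα).2]; rfl⟩

theorem elliptic_count_three (hp : 3 < p) (hk2 : (2 : k) ≠ 0) (hk3 : (3 : k) ≠ 0)
    (hkp : (p : k) ≠ 0) (hγ : ∀ x : (GaloisField p 2)ˣ, x ∈ Subgroup.zpowers γ) :
    ((ellipticPoints k p γ 3).Finite ∧
      ((ellipticPoints k p γ 3).ncard : ℤ) = 1 - legendreSym p (-3) ∧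
      (p % 3 = 1 → (ellipticPoints k p γ 3).ncard = 0) ∧
      (p % 3 = 2 → (ellipticPoints k p γ 3).ncard = 2)) ∧
    ((ellipticPoints k p γ 3).ncard = 2 →
      ∃ (E : EllCurve k) (v : OrientedNecklace (E.Tors p) (minpolyOf p γ)),
        ellipticPoints k p γ 3 = {Ynsp.mk E v, Ynsp.mk E v.w}) ∧
    ∀ α : GaloisField p 2, α ∉ Set.range (algebraMap (ZMod p) (GaloisField p 2)) →
      (ellipticPointsH k p (cartan p α) 3).Finite ∧
        ((ellipticPointsH k p (cartan p α) 3).ncard : ℤ) = 1 - legendreSym p (-3) := by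
  obtain ⟨E₀, φ₀, hW, h⟩ := ShortCurve.exists_isExtraAut_three hk2 hk3 p
  have hsq := exists_sq_add_add_one_eq_zero_iff (p := p) (by omega)
  rw [legendreSym_neg_three (by omega) (by omega)]
  split_ifs with ha
  · obtain ⟨a, ha'⟩ := ha
    have hq : (X ^ 2 + X + 1 : (ZMod p)[X]) = (X - C a) * (X - C (-1 - a)) := by
      have : C a ^ 2 + C a + 1 = (0 : (ZMod p)[X]) := by
        rw [← C_pow, ← C_add, ← C_1, ← C_add, ha', C_0]
      rw [C_sub, C_neg, C_1]
      linear_combination this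
    obtain ⟨⟨h1, h2⟩, h3⟩ := h.count_of_split (γ := γ) hq
    refine ⟨⟨h1, by rw [h2]; rfl, fun _ => h2, fun h4 => ?_⟩, fun h4 => ?_, fun α hα => ?_⟩
    · have := hsq.1 ⟨a, ha'⟩
      omega
    · omega
    · exact ⟨(h3 α hα).1, by rw [(h3 α hα).2]; rfl⟩
  · obtain ⟨⟨h1, h2⟩, h3, h4⟩ := h.count_of_irreducible hk2 hkp hW
      monic_and_natDegree_X_sq_add_X_add_one
      (irreducible_X_sq_add_X_add_one fun a h' => ha ⟨a, h'⟩) hγ hp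
    rw [hsq] at ha
    refine ⟨⟨h1, by rw [h2]; rfl, fun h5 => ?_, fun _ => h2⟩, fun _ => h3, fun α hα => ?_⟩
    · omega
    · exact ⟨(h4 α hα).1, by rw [(h4 α hα).2]; rfl⟩

end Counts

end FinalCount

theorem mainTheorem7 (p : ℕ) [Fact p.Prime] (hp : 3 < p)
    (k : Type*) [Field k] [IsAlgClosed k] [DecidableEq k]
    (hk2 : (2 : k) ≠ 0) (hk3 : (3 : k) ≠ 0) (hkp : (p : k) ≠ 0)
    (γ : (GaloisField p 2)ˣ) (hγ : ∀ x : (GaloisField p 2)ˣ, x ∈ Subgroup.zpowers γ) :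
    ((ellipticPoints k p γ 2).Finite ∧
      ((ellipticPoints k p γ 2).ncard : ℤ) = 1 - legendreSym p (-1) ∧
      (p % 4 = 1 → (ellipticPoints k p γ 2).ncard = 0) ∧
      (p % 4 = 3 → (ellipticPoints k p γ 2).ncard = 2)) ∧
    ((ellipticPoints k p γ 3).Finite ∧
      ((ellipticPoints k p γ 3).ncard : ℤ) = 1 - legendreSym p (-3) ∧
      (p % 3 = 1 → (ellipticPoints k p γ 3).ncard = 0) ∧
      (p % 3 = 2 → (ellipticPoints k p γ 3).ncard = 2)) ∧
    (∀ r : ℕ, r = 2 ∨ r = 3 → (ellipticPoints k p γ r).ncard = 2 →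
      ∃ (E : EllCurve k) (v : OrientedNecklace (E.Tors p) (minpolyOf p γ)),
        ellipticPoints k p γ r = {Ynsp.mk E v, Ynsp.mk E v.w}) ∧
    (∀ α : GaloisField p 2, α ∉ Set.range (algebraMap (ZMod p) (GaloisField p 2)) →
      ((ellipticPointsH k p (cartan p α) 2).Finite ∧
        ((ellipticPointsH k p (cartan p α) 2).ncard : ℤ) = 1 - legendreSym p (-1)) ∧
      ((ellipticPointsH k p (cartan p α) 3).Finite ∧
        ((ellipticPointsH k p (cartan p α) 3).ncard : ℤ) = 1 - legendreSym p (-3))) := by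
  obtain ⟨h1, h2, h3⟩ := elliptic_count_two hp hk2 hk3 hkp hγ
  obtain ⟨h4, h5, h6⟩ := elliptic_count_three hp hk2 hk3 hkp hγ
  refine ⟨h1, h4, ?_, fun α hα => ⟨h3 α hα, h6 α hα⟩⟩
  rintro r (rfl | rfl)
  · exact h2
  · exact h5
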